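/- Let $N\ge 2$, $\ell\ge 0$ be integers, $m=N\ell$, $v$ an indeterminate and $q=-v^{-1}$, so $\mathbb C(q)=\mathbb C(v)$. **Algebra.** $\dot{\mathbf U}_v(\mathfrak{sl}_m)$ is the idempotented quantum algebra over $\mathbb C(v)$: adjoin to $\mathbf U_v(\mathfrak{sl}_m)$ (generators $K_i^{\pm1},E_{\pm i}$, $1\le i\le m-1$) orthogonal idempotents $1_\lambda$, $\lambda\in\mathbb Z^{m-1}$, with $E_{\pm i}1_\lambda=1_{\lambda\pm i'}E_{\pm i}$ and $K_i1_\lambda=v^{\lambda_i}1_\lambda$, where $i'$ is the $i$-th row of the Cartan matrix, and take $\bigoplus_{\lambda,\mu}1_\lambda\mathbf U_v(\mathfrak{sl}_m)1_\mu$. **Exterior algebra.** $\Lambda^\bullet_q(\mathbb C_q^n)$ is generated by $x_1,\dots,x_n$ with $x_ix_i=0$ and $x_ix_j+q\,x_jx_i=0$ for $i<j$; its degree-$k$ part $\Lambda^k_q$ has basis the $x_S$, $|S|=k$, where $x_S$ is the product of the $x_s$, $s\in S$, in decreasing order. The same is used with $v$ in place of $q$. For $\vec k\in\mathbb N^m$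 put $\Lambda_q^{\vec k}(\mathbb C_q^N)=\Lambda_q^{k_m}(\mathbb C_q^N)\otimes\cdots\otimes\Lambda_q^{k_1}(\mathbb C_q^N)$, let $\Lambda(m,m)_N$ be the set of $\vec k\in\{0,\dots,N\}^m$ with $\sum_j k_j=m$, and let $$W=\bigoplus_{\vec k\in\Lambda(m,m)_N}\Lambda_q^{\vec k}(\mathbb C_q^N).$$ **Ladder action.** With $\ell(S,T)=|\{(i,j)\in S\times T: i<j\}|$ let $M_{a,b}\colon\Lambda_q^a\otimes\Lambda_q^b\to\Lambda_q^{a+b}$ send $x_S\otimes x_T$ to $v^{\ell(T,S)}x_{S\cup T}$ if $S\cap T=\emptyset$ and to $0$ otherwise, and let $M'_{a,b}\colon\Lambda_q^{a+b}\to\Lambda_q^a\otimes\Lambda_q^b$ send $x_S$ to $\sum_{T\subset S,\,|T|=a}v^{-\ell(T,S\setminus T)}x_T\otimes x_{S\setminus T}$. The Cautis–Kamnitzer–Morrison functor to webs, followed by the functor from webs to intertwiners, prescribes the following action of $\dot{\mathbf U}_v(\mathfrak{sl}_m)$ on $W$. If there is $\vec k\in\Lambda(m,m)_N$ with $k_i-k_{i+1}=\lambda_i$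 for all $i$, then $1_\lambda$ is the projection onto $\Lambda_q^{\vec k}$, and on $\Lambda_q^{\vec k}$ the elements $E_{-i}1_\lambda$ and $E_{+i}1_\lambda$ act in the two factors $\Lambda_q^{k_{i+1}}\otimes\Lambda_q^{k_i}$ as $$(M_{k_{i+1},1}\otimes\mathrm{id})(\mathrm{id}\otimes M'_{1,k_i-1})\quad\text{and}\quad(\mathrm{id}\otimes M_{1,k_i})(M'_{k_{i+1}-1,1}\otimes\mathrm{id})$$ respectively (as $0$ if $k_i=0$, respectively $k_{i+1}=0$), and as zero on the other summands. If there is no such $\vec k$, then $1_\lambda$ and $E_{\pm i}1_\lambda$ act as $0$. **Standard action.** $\dot{\mathbf U}_v(\mathfrak{sl}_m)$ acts on $\Lambda_v^\ell(\mathbb C_v^m)^{\otimes N}$ by the basic representation of $\mathbf U_v(\mathfrak{sl}_m)$ on $\mathbb C_v^m$ and the coproduct $\Delta(E_{+i})=E_{+i}\otimes K_i+1\otimes E_{+i}$, $\Delta(E_{-i})=E_{-i}\otimes1+K_i^{-1}\otimes E_{-i}$, $\Delta(K_i)=K_i\otimes K_i$, with $1_\lambda$ acting as the projection onto the $\lambda$-weight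 space. **Tableaux.** Let $\mathrm{Col}$ be the set of fillings $T$ of the $\ell\times N$ rectangle ($\ell$ rows, $N$ columns) by numbers in $\{1,\dots,m\}$ that strictly increase down every column. Put $x^T=x_{S_m}\otimes\cdots\otimes x_{S_1}\in W$, where $S_j\subset\{1,\dots,N\}$ is the set of columns of $T$ containing $j$, and $x_T=x_{T(N)}\otimes\cdots\otimes x_{T(1)}\in\Lambda_v^\ell(\mathbb C_v^m)^{\otimes N}$, where $T(c)$ is the set of entries of the $c$-th column. If $T'\in\mathrm{Col}$ is obtained from $T$ by changing one entry $i$ in column $c$ to $i+1$, let $a_{T,T'}$ be the number of entries $i$ minus the number of entries $i+1$ of $T$ in columns $>c$; if $T''\in\mathrm{Col}$ is obtained from $T$ by changing one entry $i+1$ in column $c$ to $i$, let $b_{T,T''}$ be the number of entries $i$ minus the number of entries $i+1$ of $T$ in columns $<c$. **Proposition.** The ladder action on $W$ and the standard action on $\Lambda_v^\ell(\mathbb C_v^m)^{\otimes N}$ are well defined: each exists and is uniquely determined by the above. For all $T\in\mathrm{Col}$ and $1\le i\le m-1$, $$E_{-i}x^T=\sum_{T'}v^{-a_{T,T'}}x^{T'},\qquad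 E_{i}x^T=\sum_{T''}v^{b_{T,T''}}x^{T''},$$ where $T'$ (respectively $T''$) runs over the tableaux in $\mathrm{Col}$ obtained from $T$ by changing one $i$ to $i+1$ (respectively one $i+1$ to $i$). Here $E_{\pm i}x^T$ means $E_{\pm i}1_\lambda x^T$, where $\lambda_j$ is the number of entries $j$ minus the number of entries $j+1$ of $T$; moreover $1_\lambda x^T=x^T$, and $1_\mu$ and $E_{\pm i}1_\mu$ annihilate $x^T$ for $\mu\ne\lambda$. The standard action on the $x_T$ is given by the same formulas, and $x_T\mapsto x^T$ defines an injective $\dot{\mathbf U}_v(\mathfrak{sl}_m)$-linear map $\Lambda_v^\ell(\mathbb C_v^m)^{\otimes N}\to W$. -/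

import Mathlib

open scoped TensorProduct

noncomputable section

namespace QHowe

/-! ### Index conventions

The letters `1, …, n` are the elements `0, …, n - 1` of `Fin n`, and the nodes `1, …, n - 1` of the
Dynkin diagram of `sl_n` are the elements of `Fin (n - 1)`. The node `i` joins `lo i` and `hi i`,
which play the roles of the letters `i` and `i + 1`. -/

def lo {n : ℕ} (i : Fin (n - 1)) : Fin n := ⟨i, by omega⟩

def hi {n : ℕ} (i : Fin (n - 1)) : Fin n := ⟨i + 1, by omega⟩

theorem lo_ne_hi {n : ℕ} (i : Fin (n - 1)) : lo i ≠ hi i := by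
  intro h
  have h' := congrArg Fin.val h
  simp [lo, hi] at h'

/-- Two nodes of the Dynkin diagram of type A are adjacent, that is, `|i - j| = 1`. -/
def Adj {n : ℕ} (i j : Fin (n - 1)) : Prop := (i : ℕ) + 1 = j ∨ (j : ℕ) + 1 = i

instance {n : ℕ} (i j : Fin (n - 1)) : Decidable (Adj i j) :=
  inferInstanceAs (Decidable (_ ∨ _))

/-- The Cartan matrix `(α_i, α_j)` of `sl_n`. -/
def cartan {n : ℕ} (i j : Fin (n - 1)) : ℤ := if i = j then 2 else if Adj i j then -1 else 0

/-- The weight lattice `ℤ^(n-1)` of `sl_n`. -/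
abbrev Wt (n : ℕ) : Type := Fin (n - 1) → ℤ

/-- The simple root `i'` in the weight lattice: `(0, …, -1, 2, -1, …, 0)`. -/
def root {n : ℕ} (i : Fin (n - 1)) : Wt n := fun j => cartan i j

/-! ### The idempotented quantum special linear algebra -/

/-- Generators of `U_q(sl_n)` with idempotents adjoined: `K i`, its inverse, `E i = E_{+i}`,
`F i = E_{-i}`, and `one lam = 1_lam` for every weight `lam`. -/
inductive Gen (n : ℕ) : Type
  | K (i : Fin (n - 1))
  | Kinv (i : Fin (n - 1))
  | E (i : Fin (n - 1))
  | F (i : Fin (n - 1))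
  | one (lam : Wt n)

section Algebra

variable (k : Type) [Field k] (n : ℕ) (q : k)

/-- A generator, as an element of the free algebra. -/
abbrev gen {n : ℕ} (g : Gen n) : FreeAlgebra k (Gen n) := FreeAlgebra.ι k g

/-- The defining relations of `U_q(sl_n)` (from `K_comm` to `F_comm`) and the relations of the
idempotents `1_lam` adjoined to it (from `one_mul_one_self` on). -/
inductive URel : FreeAlgebra k (Gen n) → FreeAlgebra k (Gen n) → Prop
  | K_comm (i j) : URel (gen k (.K i) * gen k (.K j)) (gen k (.K j) * gen k (.K i))
  | K_Kinv (i) : URel (gen k (.K i) * gen k (.Kinv i)) 1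
  | Kinv_K (i) : URel (gen k (.Kinv i) * gen k (.K i)) 1
  | E_F_self (i) : URel (gen k (.E i) * gen k (.F i) - gen k (.F i) * gen k (.E i))
      ((q - q⁻¹)⁻¹ • (gen k (.K i) - gen k (.Kinv i)))
  | E_F_ne (i j) (h : i ≠ j) : URel (gen k (.E i) * gen k (.F j) - gen k (.F j) * gen k (.E i)) 0
  | K_E (i j) : URel (gen k (.K i) * gen k (.E j))
      (q ^ (cartan i j) • (gen k (.E j) * gen k (.K i)))
  | K_F (i j) : URel (gen k (.K i) * gen k (.F j))
      (q ^ (-cartan i j) • (gen k (.F j) * gen k (.K i)))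
  | E_serre (i j) (h : Adj i j) : URel
      (gen k (.E i) ^ 2 * gen k (.E j) - (q + q⁻¹) • (gen k (.E i) * gen k (.E j) * gen k (.E i))
        + gen k (.E j) * gen k (.E i) ^ 2) 0
  | F_serre (i j) (h : Adj i j) : URel
      (gen k (.F i) ^ 2 * gen k (.F j) - (q + q⁻¹) • (gen k (.F i) * gen k (.F j) * gen k (.F i))
        + gen k (.F j) * gen k (.F i) ^ 2) 0
  | E_comm (i j) (h : ¬ Adj i j) : URel (gen k (.E i) * gen k (.E j)) (gen k (.E j) * gen k (.E i))
  | F_comm (i j) (h : ¬ Adj i j) : URel (gen k (.F i) * gen k (.F j)) (gen k (.F j) * gen k (.F i))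
  | one_mul_one_self (lam) : URel (gen k (.one lam) * gen k (.one lam)) (gen k (.one lam))
  | one_mul_one_ne (lam mu) (h : lam ≠ mu) : URel (gen k (.one lam) * gen k (.one mu)) 0
  | E_one (i lam) : URel (gen k (.E i) * gen k (.one lam))
      (gen k (.one (lam + root i)) * gen k (.E i))
  | F_one (i lam) : URel (gen k (.F i) * gen k (.one lam))
      (gen k (.one (lam - root i)) * gen k (.F i))
  | K_one (i lam) : URel (gen k (.K i) * gen k (.one lam)) (q ^ (lam i) • gen k (.one lam))

/-- The algebra `U_q(sl_n)` with the idempotents `1_lam` adjoined. -/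
abbrev UAdj : Type := RingQuot (URel k n q)

/-- The image of a generator in `UAdj`. -/
def ugen {n : ℕ} (g : Gen n) : UAdj k n q := RingQuot.mkAlgHom k (URel k n q) (gen k g)

/-- The idempotented quantum special linear algebra: the non-unital subalgebra
`⨁_{lam, mu} 1_lam U_q(sl_n) 1_mu` of `UAdj`. -/
def Udot : NonUnitalSubalgebra k (UAdj k n q) where
  __ := Submodule.span k
    {y | ∃ (lam mu : Wt n) (x : UAdj k n q), y = ugen k q (.one lam) * x * ugen k q (.one mu)}
  mul_mem' := by
    intro a b ha hb
    have h := Submodule.mul_mem_mul (M := Submodule.span k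
      {y | ∃ (lam mu : Wt n) (x : UAdj k n q),
        y = ugen k q (.one lam) * x * ugen k q (.one mu)}) ha hb
    rw [Submodule.span_mul_span] at h
    refine Submodule.span_mono ?_ h
    rintro _ ⟨_, ⟨lam, mu, x, rfl⟩, _, ⟨lam', mu', x', rfl⟩, rfl⟩
    exact ⟨lam, mu', x * ugen k q (.one mu) * (ugen k q (.one lam') * x'), by
      simp only [mul_assoc]⟩

variable {k n}

theorem ugen_one_mul_self (lam : Wt n) :
    ugen k q (.one lam) * ugen k q (.one lam) = ugen k q (.one lam) := by
  have h := RingQuot.mkAlgHom_rel k (URel.one_mul_one_self (k := k) (q := q) lam)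
  simpa [ugen] using h

theorem ugen_E_one (i : Fin (n - 1)) (lam : Wt n) :
    ugen k q (.E i) * ugen k q (.one lam) = ugen k q (.one (lam + root i)) * ugen k q (.E i) := by
  have h := RingQuot.mkAlgHom_rel k (URel.E_one (k := k) (q := q) i lam)
  simpa [ugen] using h

theorem ugen_F_one (i : Fin (n - 1)) (lam : Wt n) :
    ugen k q (.F i) * ugen k q (.one lam) = ugen k q (.one (lam - root i)) * ugen k q (.F i) := by
  have h := RingQuot.mkAlgHom_rel k (URel.F_one (k := k) (q := q) i lam)
  simpa [ugen] using h

/-- The idempotent `1_lam` of the idempotented algebra. -/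
def uOne (lam : Wt n) : Udot k n q :=
  ⟨ugen k q (.one lam), Submodule.subset_span ⟨lam, lam, 1, by
    rw [mul_one, ugen_one_mul_self]⟩⟩

/-- The element `E_{+i} 1_lam` of the idempotented algebra. -/
def uE (i : Fin (n - 1)) (lam : Wt n) : Udot k n q :=
  ⟨ugen k q (.E i) * ugen k q (.one lam), Submodule.subset_span ⟨lam + root i, lam,
    ugen k q (.E i), by rw [← ugen_E_one, mul_assoc, ugen_one_mul_self]⟩⟩

/-- The element `E_{-i} 1_lam` of the idempotented algebra. -/
def uF (i : Fin (n - 1)) (lam : Wt n) : Udot k n q :=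
  ⟨ugen k q (.F i) * ugen k q (.one lam), Submodule.subset_span ⟨lam - root i, lam,
    ugen k q (.F i), by rw [← ugen_F_one, mul_assoc, ugen_one_mul_self]⟩⟩

end Algebra

/-! ### The quantum exterior algebra -/

section Exterior

variable (k : Type) [Field k] (n : ℕ) (q : k)

/-- The standard basis vector `x_i`, in the tensor algebra of `k^n`. -/
abbrev tx {n : ℕ} (i : Fin n) : TensorAlgebra k (Fin n → k) :=
  TensorAlgebra.ι k (Pi.single i (1 : k))

/-- The relations `x_i ⊗ x_i = 0` and `x_i ⊗ x_j + q x_j ⊗ x_i = 0` for `i < j`. -/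
inductive ExtRel : TensorAlgebra k (Fin n → k) → TensorAlgebra k (Fin n → k) → Prop
  | sq (i) : ExtRel (tx k i * tx k i) 0
  | anti (i j) (h : i < j) : ExtRel (tx k i * tx k j + q • (tx k j * tx k i)) 0

/-- The quantum exterior algebra `Λ_q^•(k^n)`, with product `∧_q`. -/
def Ext : Type := RingQuot (ExtRel k n q)

instance : Ring (Ext k n q) := inferInstanceAs (Ring (RingQuot (ExtRel k n q)))

instance : Algebra k (Ext k n q) := inferInstanceAs (Algebra k (RingQuot (ExtRel k n q)))

variable {k n}

/-- The quotient map from the tensor algebra. -/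
def mkExt : TensorAlgebra k (Fin n → k) →ₐ[k] Ext k n q := RingQuot.mkAlgHom k (ExtRel k n q)

/-- The class of `x_i`. -/
def ex (i : Fin n) : Ext k n q := mkExt q (tx k i)

theorem ex_sq (i : Fin n) : ex q i * ex q i = (0 : Ext k n q) := by
  have h : mkExt q (tx k i * tx k i) = mkExt q 0 :=
    RingQuot.mkAlgHom_rel k (ExtRel.sq (k := k) (q := q) i)
  rw [map_mul, map_zero] at h
  exact h

theorem ex_anti {i j : Fin n} (h : i < j) : ex q i * ex q j = (-q) • (ex q j * ex q i : Ext k n q) := by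
  have h : mkExt q (tx k i * tx k j + q • (tx k j * tx k i)) = mkExt q 0 :=
    RingQuot.mkAlgHom_rel k (ExtRel.anti (k := k) (q := q) i j h)
  rw [map_add, map_smul, map_mul, map_mul, map_zero] at h
  rw [neg_smul]
  exact eq_neg_of_add_eq_zero_left h

/-- The universal property of the quantum exterior algebra. -/
def extLift {A : Type} [Ring A] [Algebra k A] (f : Fin n → A) (h₁ : ∀ i, f i * f i = 0)
    (h₂ : ∀ i j, i < j → f i * f j + q • (f j * f i) = 0) : Ext k n q →ₐ[k] A :=
  RingQuot.liftAlgHom k ⟨TensorAlgebra.lift k ((Pi.basisFun k (Fin n)).constr k f), by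
    have hf : ∀ i, (Pi.basisFun k (Fin n)).constr k f (Pi.single i 1) = f i := by
      intro i
      rw [← Pi.basisFun_apply, Module.Basis.constr_basis]
    intro x y hxy
    cases hxy with
    | sq i => simp only [map_mul, TensorAlgebra.lift_ι_apply, hf, h₁, map_zero]
    | anti i j h => simp only [map_add, map_smul, map_mul, TensorAlgebra.lift_ι_apply, hf,
        h₂ i j h, map_zero]⟩

theorem extLift_ex {A : Type} [Ring A] [Algebra k A] (f : Fin n → A) (h₁ : ∀ i, f i * f i = 0)
    (h₂ : ∀ i j, i < j → f i * f j + q • (f j * f i) = 0) (i : Fin n) :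
    extLift q f h₁ h₂ (ex q i) = f i := by
  unfold extLift ex mkExt
  erw [RingQuot.liftAlgHom_mkAlgHom_apply]
  rw [TensorAlgebra.lift_ι_apply, ← Pi.basisFun_apply, Module.Basis.constr_basis]

theorem ext_induction {p : Ext k n q → Prop} (h0 : p 1) (hadd : ∀ a b, p a → p b → p (a + b))
    (hsmul : ∀ (c : k) a, p a → p (c • a)) (hmul : ∀ i a, p a → p (ex q i * a)) (a : Ext k n q) :
    p a := by
  obtain ⟨t, rfl⟩ : ∃ t, mkExt q t = a := RingQuot.mkAlgHom_surjective k (ExtRel k n q) a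
  have key : ∀ b : Ext k n q, p b →
      p (mkExt q t * b) := by
    induction t using TensorAlgebra.induction with
    | algebraMap r =>
      intro b hb
      rw [AlgHom.commutes]
      have := hsmul r b hb
      rw [Algebra.smul_def] at this
      exact this
    | ι m =>
      intro b hb
      have hm : m = ∑ i, m i • (Pi.single i (1 : k) : Fin n → k) := by
        simpa using ((Pi.basisFun k (Fin n)).sum_repr m).symm
      have h2 : mkExt q (TensorAlgebra.ι k m)
          = ∑ i, m i • ex q i := by
        conv_lhs => rw [hm]
        rw [map_sum, map_sum]
        refine Finset.sum_congr rfl fun i _ => ?_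
        rw [map_smul, map_smul]
        rfl
      rw [h2, Finset.sum_mul]
      have hz : p 0 := by simpa using hsmul 0 1 h0
      refine Finset.sum_induction _ p hadd hz fun i _ => ?_
      rw [smul_mul_assoc]
      exact hsmul _ _ (hmul _ _ hb)
    | mul x y hx hy =>
      intro b hb
      have h3 := hx _ (hy b hb)
      rw [← mul_assoc] at h3
      rw [map_mul]
      exact h3
    | add x y hx hy =>
      intro b hb
      have h3 := hadd _ _ (hx b hb) (hy b hb)
      rw [← add_mul] at h3
      rw [map_add]
      exact h3
  have h4 := key 1 h0
  rwa [mul_one] at h4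

/-- The elementary tensor `x_S`: the product of the `x_s` for `s ∈ S`, in decreasing order. -/
def xS (S : Finset (Fin n)) : Ext k n q := ((S.sort (· ≥ ·)).map (ex q)).prod

theorem xS_empty : xS q (∅ : Finset (Fin n)) = (1 : Ext k n q) := by
  simp [xS]

theorem xS_insert_max {a : Fin n} {S : Finset (Fin n)} (h : ∀ s ∈ S, s < a) :
    xS q (insert a S) = (ex q a * xS q S : Ext k n q) := by
  have ha : a ∉ S := fun h' => lt_irrefl _ (h a h')
  unfold xS
  rw [Finset.sort_insert _ (fun b hb => (h b hb).le) ha, List.map_cons, List.prod_cons]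

theorem ex_mul_xS (i : Fin n) (S : Finset (Fin n)) :
    ex q i * xS q S = (if i ∈ S then 0
      else (-q) ^ (S.filter (i < ·)).card • xS q (insert i S) : Ext k n q) := by
  induction S using Finset.induction_on_max with
  | empty => simpa using (xS_insert_max (k := k) q (a := i) (S := ∅) (by simp)).symm
  | insert a S ha ih =>
    have haS : a ∉ S := fun h' => lt_irrefl _ (ha a h')
    rcases lt_trichotomy i a with hia | rfl | hai
    · rw [xS_insert_max q ha, ← mul_assoc, ex_anti q hia, smul_mul_assoc, mul_assoc, ih]
      by_cases hiS : i ∈ S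
      · simp [hiS]
      · have h1 : ∀ s ∈ insert i S, s < a := by
          intro s hs
          rcases Finset.mem_insert.1 hs with rfl | hs
          · exact hia
          · exact ha s hs
        rw [if_neg hiS, if_neg (by simp [hiS, hia.ne]), mul_smul_comm, ← xS_insert_max q h1,
          smul_smul, Finset.filter_insert, if_pos hia, Finset.card_insert_of_notMem (by simp [haS]),
          pow_succ', Finset.insert_comm]
    · rw [xS_insert_max q ha, ← mul_assoc, ex_sq, zero_mul, if_pos (by simp)]
    · have h1 : ∀ s ∈ insert a S, s < i := by
        intro s hs
        rcases Finset.mem_insert.1 hs with rfl | hs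
        · exact hai
        · exact (ha s hs).trans hai
      have h2 : i ∉ insert a S := fun h' => lt_irrefl _ (h1 i h')
      have h3 : (insert a S).filter (i < ·) = ∅ :=
        Finset.filter_eq_empty_iff.2 fun s hs => (h1 s hs).le.not_gt
      rw [if_neg h2, h3, xS_insert_max q h1]
      simp

theorem bSO_apply (S : Finset (Fin n)) :
    (Finsupp.basisSingleOne : Module.Basis (Finset (Fin n)) k _) S = Finsupp.single S 1 := by
  rw [Finsupp.coe_basisSingleOne]

/-- Left multiplication by `x_i` in the coordinates given by the elementary tensors. -/
def exOp (i : Fin n) : Module.End k (Finset (Fin n) →₀ k) :=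
  Finsupp.basisSingleOne.constr k fun S =>
    if i ∈ S then 0 else Finsupp.single (insert i S) ((-q) ^ (S.filter (i < ·)).card)

theorem exOp_single (i : Fin n) (S : Finset (Fin n)) :
    exOp q i (Finsupp.single S 1) =
      if i ∈ S then 0 else Finsupp.single (insert i S) ((-q) ^ (S.filter (i < ·)).card) := by
  unfold exOp
  rw [← bSO_apply, Module.Basis.constr_basis]

/-- The action of the quantum exterior algebra on the coordinates. -/
def exRep : Ext k n q →ₐ[k] Module.End k (Finset (Fin n) →₀ k) :=
  extLift q (exOp q)
    (by
      intro i
      refine Finsupp.basisSingleOne.ext fun S => ?_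
      rw [bSO_apply, Module.End.mul_apply, exOp_single]
      split_ifs with h
      · simp
      · rw [← mul_one ((-q) ^ _), ← smul_eq_mul, ← Finsupp.smul_single, map_smul, exOp_single]
        simp)
    (by
      intro i j hij
      refine Finsupp.basisSingleOne.ext fun S => ?_
      have e : ∀ (T : Finset (Fin n)) (c : k), Finsupp.single T c = c • Finsupp.single T 1 := by
        intro T c
        rw [Finsupp.smul_single, smul_eq_mul, mul_one]
      rw [bSO_apply, LinearMap.add_apply, LinearMap.smul_apply,
        Module.End.mul_apply, Module.End.mul_apply, exOp_single, exOp_single]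
      by_cases hi : i ∈ S <;> by_cases hj : j ∈ S
      · simp [hi, hj]
      · rw [if_neg hj, if_pos hi, e, map_smul, exOp_single]
        simp [hi]
      · rw [if_pos hj, if_neg hi, e, map_smul, exOp_single]
        simp [hj]
      · rw [if_neg hj, if_neg hi, e (insert j S), e (insert i S), map_smul, map_smul, exOp_single,
          exOp_single, if_neg (by simp [hi, hij.ne]), if_neg (by simp [hj, hij.ne']),
          Finset.filter_insert, if_pos hij, Finset.filter_insert, if_neg hij.not_gt,
          Finset.card_insert_of_notMem (by simp [hj]), Finset.insert_comm]
        rw [e _ ((-q) ^ (_ + 1)), e _ ((-q) ^ (Finset.card (S.filter (j < ·))))]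
        simp only [smul_smul, ← add_smul]
        rw [show ∀ a b : ℕ, (-q) ^ a * (-q) ^ (b + 1) + q * ((-q) ^ b * (-q) ^ a) = 0 by
          intro a b; ring]
        simp)

theorem exRep_ex (i : Fin n) : exRep (k := k) q (ex q i) = exOp q i := extLift_ex q _ _ _ i

/-- The linear combination of elementary tensors with given coordinates. -/
def exSum : (Finset (Fin n) →₀ k) →ₗ[k] Ext k n q := Finsupp.basisSingleOne.constr k (xS q)

theorem exSum_single (S : Finset (Fin n)) (c : k) :
    exSum q (Finsupp.single S c) = c • xS q S := by
  rw [← mul_one c, ← smul_eq_mul, ← Finsupp.smul_single, map_smul]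
  unfold exSum
  rw [← bSO_apply, Module.Basis.constr_basis, smul_eq_mul, mul_one]

theorem exSum_exRep (a : Ext k n q) (f : Finset (Fin n) →₀ k) :
    exSum q (exRep q a f) = a * exSum q f := by
  induction a using ext_induction q generalizing f with
  | h0 => simp
  | hadd a b ha hb => rw [map_add, LinearMap.add_apply, map_add, ha, hb, add_mul]
  | hsmul c a ha => rw [map_smul, LinearMap.smul_apply, map_smul, ha, smul_mul_assoc]
  | hmul i a ha =>
    rw [map_mul, Module.End.mul_apply, mul_assoc, ← ha, exRep_ex]
    generalize exRep q a f = g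
    have h : exSum q ∘ₗ exOp q i = LinearMap.mulLeft k (ex q i) ∘ₗ exSum q := by
      refine Finsupp.basisSingleOne.ext fun S => ?_
      rw [bSO_apply, LinearMap.comp_apply, LinearMap.comp_apply, exOp_single,
        exSum_single, one_smul, LinearMap.mulLeft_apply, ex_mul_xS]
      split_ifs with h
      · rw [map_zero]
      · rw [exSum_single]
    exact LinearMap.congr_fun h g

theorem exRep_xS (S : Finset (Fin n)) :
    exRep q (xS q S) (Finsupp.single ∅ 1) = (Finsupp.single S 1 : Finset (Fin n) →₀ k) := by
  induction S using Finset.induction_on_max with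
  | empty => simp [xS_empty]
  | insert a S ha ih =>
    have haS : a ∉ S := fun h' => lt_irrefl _ (ha a h')
    have h3 : S.filter (a < ·) = ∅ := Finset.filter_eq_empty_iff.2 fun s hs => (ha s hs).le.not_gt
    rw [xS_insert_max q ha, map_mul, Module.End.mul_apply, ih, exRep_ex, exOp_single, if_neg haS, h3]
    simp

/-- The standard basis of `Λ_q^•(k^n)`, which consists of the elementary tensors `x_S`. -/
def xBasis : Module.Basis (Finset (Fin n)) k (Ext k n q) :=
  .ofRepr
    { toFun := fun a => exRep q a (Finsupp.single ∅ 1)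
      map_add' := fun a b => by rw [map_add, LinearMap.add_apply]
      map_smul' := fun c a => by rw [map_smul, LinearMap.smul_apply, RingHom.id_apply]
      invFun := exSum q
      left_inv := fun a => by
        rw [exSum_exRep, exSum_single, one_smul, xS_empty, mul_one]
      right_inv := fun f => by
        change exRep q (exSum q f) (Finsupp.single ∅ 1) = f
        induction f using Finsupp.induction_linear with
        | zero => simp
        | add f g hf hg =>
          rw [map_add, map_add, LinearMap.add_apply]
          exact congrArg₂ (· + ·) hf hg
        | single S c =>
          rw [exSum_single, map_smul, LinearMap.smul_apply, exRep_xS, Finsupp.smul_single,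
            smul_eq_mul, mul_one] }

theorem xBasis_apply (S : Finset (Fin n)) : xBasis q S = (xS q S : Ext k n q) := by
  change exSum q (Finsupp.single S 1) = _
  rw [exSum_single, one_smul]

/-- The homogeneous summand `Λ_q^d(k^n)`, spanned by the `x_S` with `|S| = d`. -/
def extDeg (d : ℕ) : Submodule k (Ext k n q) := Submodule.span k {y | ∃ S, S.card = d ∧ y = xS q S}

/-- The projection of `Λ_q^•(k^n)` onto `Λ_q^d(k^n)`. -/
def projDeg (d : ℕ) : Ext k n q →ₗ[k] Ext k n q :=
  (xBasis q).constr k fun S => if S.card = d then xS q S else 0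

end Exterior

/-! ### The standard operators of `U_q(sl_n)` on the quantum exterior algebra -/

section Standard

variable {k : Type} [Field k] {n : ℕ} {q : k}

/-- `K_i` multiplies `x_j` by this scalar. -/
def kap (q : k) (i : Fin (n - 1)) (j : Fin n) : k :=
  if j = lo i then q else if j = hi i then q⁻¹ else 1

/-- `E_{+i} x_j` in the basic representation. -/
def exE (q : k) (i : Fin (n - 1)) (j : Fin n) : Ext k n q := if j = hi i then ex q (lo i) else 0

/-- `E_{-i} x_j` in the basic representation. -/
def exF (q : k) (i : Fin (n - 1)) (j : Fin n) : Ext k n q := if j = lo i then ex q (hi i) else 0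

theorem scaled_sq (c : Fin n → k) (i : Fin n) :
    (c i • ex q i) * (c i • ex q i) = (0 : Ext k n q) := by
  rw [smul_mul_smul_comm, ex_sq, smul_zero]

theorem scaled_anti (c : Fin n → k) (i j : Fin n) (h : i < j) :
    (c i • ex q i) * (c j • ex q j) + q • ((c j • ex q j) * (c i • ex q i)) =
      (0 : Ext k n q) := by
  rw [smul_mul_smul_comm, smul_mul_smul_comm, ex_anti q h, smul_comm q, mul_comm (c j), ← smul_add,
    neg_smul, neg_add_cancel, smul_zero]

/-- The group-like `K_i` acts by an algebra automorphism, as `Δ(K_i) = K_i ⊗ K_i`. -/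
def opK (i : Fin (n - 1)) : Ext k n q →ₐ[k] Ext k n q :=
  extLift q (fun j => kap q i j • ex q j) (scaled_sq _) (scaled_anti _)

/-- The inverse of `K_i`. -/
def opKinv (i : Fin (n - 1)) : Ext k n q →ₐ[k] Ext k n q :=
  extLift q (fun j => (kap q i j)⁻¹ • ex q j) (scaled_sq _) (scaled_anti _)

theorem opK_ex (i : Fin (n - 1)) (j : Fin n) :
    opK i (ex q j) = (kap q i j • ex q j : Ext k n q) := extLift_ex q _ _ _ j

theorem opKinv_ex (i : Fin (n - 1)) (j : Fin n) :
    opKinv i (ex q j) = ((kap q i j)⁻¹ • ex q j : Ext k n q) := extLift_ex q _ _ _ j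

theorem lo_lt_hi (i : Fin (n - 1)) : lo i < hi i := by
  simp [lo, hi, Fin.lt_def]

theorem lt_lo_of_lt_hi {i : Fin (n - 1)} {a : Fin n} (h : a < hi i) (h' : a ≠ lo i) :
    a < lo i := by
  simp only [lo, hi, Fin.lt_def, ne_eq, Fin.ext_iff] at *
  omega

theorem hi_lt_of_lo_lt {i : Fin (n - 1)} {b : Fin n} (h : lo i < b) (h' : b ≠ hi i) :
    hi i < b := by
  simp only [lo, hi, Fin.lt_def, ne_eq, Fin.ext_iff] at *
  omega

theorem ex_anti' {i j : Fin n} (h : i < j) :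
    ex q i * ex q j + q • (ex q j * ex q i) = (0 : Ext k n q) := by
  rw [ex_anti q h, neg_smul, neg_add_cancel]

variable [NeZero q]

/-- The upper triangular matrices that encode the action of `E_{+i}` on products through the
coproduct `Δ(E_{+i}) = E_{+i} ⊗ K_i + 1 ⊗ E_{+i}`. -/
def thetaE (i : Fin (n - 1)) : Ext k n q →ₐ[k] Matrix (Fin 2) (Fin 2) (Ext k n q) :=
  extLift q (fun j => !![ex q j, exE q i j; 0, kap q i j • ex q j])
    (by
      have hq : q ≠ 0 := NeZero.ne q
      intro j
      have h1 : ex q j * exE q i j + exE q i j * (kap q i j • ex q j) = (0 : Ext k n q) := by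
        unfold exE
        split_ifs with hj
        · subst hj
          rw [kap, if_neg (lo_ne_hi i).symm, if_pos rfl, mul_smul_comm, ex_anti q (lo_lt_hi i),
            smul_smul, mul_neg, inv_mul_cancel₀ hq, neg_one_smul, add_neg_cancel]
        · simp
      rw [Matrix.mul_fin_two]
      ext x y
      fin_cases x <;> fin_cases y
      · simpa using ex_sq q j
      · simpa using h1
      · simp
      · simp [ex_sq])
    (by
      have hq : q ≠ 0 := NeZero.ne q
      intro a b hab
      have h1 : ex q a * exE q i b + exE q i a * (kap q i b • ex q b)
          + q • (ex q b * exE q i a + exE q i b * (kap q i a • ex q a)) = (0 : Ext k n q) := by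
        unfold exE
        by_cases hb : b = hi i
        · subst hb
          rw [if_pos rfl, if_neg hab.ne]
          by_cases ha : a = lo i
          · subst ha
            simp [ex_sq]
          · rw [kap, kap, if_neg ha, if_neg hab.ne]
            simpa using ex_anti' (q := q) (lt_lo_of_lt_hi hab ha)
        · by_cases ha : a = hi i
          · subst ha
            rw [if_neg hb, if_pos rfl, kap, if_neg ((lo_lt_hi i).trans hab).ne', if_neg hb]
            simpa using ex_anti' (q := q) ((lo_lt_hi i).trans hab)
          · simp [ha, hb]
      have h2 := scaled_anti (q := q) (kap q i) a b hab
      rw [Matrix.mul_fin_two, Matrix.mul_fin_two, Matrix.smul_of, Matrix.of_add_of]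
      ext x y
      fin_cases x <;> fin_cases y
      · simpa using ex_anti' hab
      · simpa using h1
      · simp
      · simpa using h2)

/-- The upper triangular matrices that encode the action of `E_{-i}` on products through the
coproduct `Δ(E_{-i}) = E_{-i} ⊗ 1 + K_i⁻¹ ⊗ E_{-i}`. -/
def thetaF (i : Fin (n - 1)) : Ext k n q →ₐ[k] Matrix (Fin 2) (Fin 2) (Ext k n q) :=
  extLift q (fun j => !![(kap q i j)⁻¹ • ex q j, exF q i j; 0, ex q j])
    (by
      have hq : q ≠ 0 := NeZero.ne q
      intro j
      have h1 : ((kap q i j)⁻¹ • ex q j) * exF q i j + exF q i j * ex q j = (0 : Ext k n q) := by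
        unfold exF
        split_ifs with hj
        · subst hj
          rw [kap, if_pos rfl, smul_mul_assoc, ex_anti q (lo_lt_hi i),
            smul_smul, mul_neg, inv_mul_cancel₀ hq, neg_one_smul, neg_add_cancel]
        · simp
      have h2 := scaled_sq (q := q) (fun j => (kap q i j)⁻¹) j
      rw [Matrix.mul_fin_two]
      ext x y
      fin_cases x <;> fin_cases y
      · simpa using h2
      · simpa using h1
      · simp
      · simpa using ex_sq q j)
    (by
      have hq : q ≠ 0 := NeZero.ne q
      intro a b hab
      have h1 : ((kap q i a)⁻¹ • ex q a) * exF q i b + exF q i a * ex q b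
          + q • (((kap q i b)⁻¹ • ex q b) * exF q i a + exF q i b * ex q a) =
            (0 : Ext k n q) := by
        unfold exF
        by_cases ha : a = lo i
        · subst ha
          rw [if_pos rfl, if_neg hab.ne']
          by_cases hb : b = hi i
          · subst hb
            simp [ex_sq]
          · rw [kap, kap, if_neg hab.ne', if_neg hb]
            simpa using ex_anti' (q := q) (hi_lt_of_lo_lt hab hb)
        · by_cases hb : b = lo i
          · subst hb
            rw [if_neg ha, if_pos rfl, kap, if_neg ha, if_neg (hab.trans (lo_lt_hi i)).ne]
            simpa using ex_anti' (q := q) (hab.trans (lo_lt_hi i))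
          · simp [ha, hb]
      have h2 := scaled_anti (q := q) (fun j => (kap q i j)⁻¹) a b hab
      rw [Matrix.mul_fin_two, Matrix.mul_fin_two, Matrix.smul_of, Matrix.of_add_of]
      ext x y
      fin_cases x <;> fin_cases y
      · simpa using h2
      · simpa using h1
      · simp
      · simpa using ex_anti' hab)

/-- The operator `E_{+i}` on the quantum exterior algebra. -/
def opE (i : Fin (n - 1)) : Ext k n q →ₗ[k] Ext k n q :=
  Matrix.entryLinearMap k (Ext k n q) 0 1 ∘ₗ (thetaE i).toLinearMap

/-- The operator `E_{-i}` on the quantum exterior algebra. -/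
def opF (i : Fin (n - 1)) : Ext k n q →ₗ[k] Ext k n q :=
  Matrix.entryLinearMap k (Ext k n q) 0 1 ∘ₗ (thetaF i).toLinearMap

theorem thetaE_apply (i : Fin (n - 1)) (a : Ext k n q) :
    thetaE i a = !![a, opE i a; 0, opK i a] := by
  suffices h : thetaE i a 0 0 = a ∧ thetaE i a 1 0 = 0 ∧ thetaE i a 1 1 = opK i a by
    ext x y
    fin_cases x <;> fin_cases y
    · exact h.1
    · rfl
    · exact h.2.1
    · exact h.2.2
  induction a using ext_induction q with
  | h0 => simp
  | hadd a b ha hb => simp [ha, hb]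
  | hsmul c a ha => simp [ha]
  | hmul j a ha =>
    have hj : thetaE i (ex q j) = !![ex q j, exE q i j; 0, kap q i j • ex q j] :=
      extLift_ex q _ _ _ j
    rw [map_mul, hj, map_mul, opK_ex]
    simp [Matrix.mul_apply, Fin.sum_univ_two, ha]

theorem thetaF_apply (i : Fin (n - 1)) (a : Ext k n q) :
    thetaF i a = !![opKinv i a, opF i a; 0, a] := by
  suffices h : thetaF i a 0 0 = opKinv i a ∧ thetaF i a 1 0 = 0 ∧ thetaF i a 1 1 = a by
    ext x y
    fin_cases x <;> fin_cases y
    · exact h.1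
    · rfl
    · exact h.2.1
    · exact h.2.2
  induction a using ext_induction q with
  | h0 => simp
  | hadd a b ha hb => simp [ha, hb]
  | hsmul c a ha => simp [ha]
  | hmul j a ha =>
    have hj : thetaF i (ex q j) = !![(kap q i j)⁻¹ • ex q j, exF q i j; 0, ex q j] :=
      extLift_ex q _ _ _ j
    rw [map_mul, hj, map_mul, opKinv_ex]
    simp [Matrix.mul_apply, Fin.sum_univ_two, ha]

theorem opE_one (i : Fin (n - 1)) : opE i (1 : Ext k n q) = 0 := by
  simp [opE]

theorem opE_ex (i : Fin (n - 1)) (j : Fin n) :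
    opE i (ex q j) = (if j = hi i then ex q (lo i) else 0 : Ext k n q) := by
  have hj : thetaE i (ex q j) = !![ex q j, exE q i j; 0, kap q i j • ex q j] :=
    extLift_ex q _ _ _ j
  simp [opE, hj, exE]

/-- `E_{+i}` acts on products through the coproduct. -/
theorem opE_mul (i : Fin (n - 1)) (a b : Ext k n q) :
    opE i (a * b) = opE i a * opK i b + a * opE i b := by
  have h := congrFun (congrFun (map_mul (thetaE i) a b) 0) 1
  rw [thetaE_apply i a, thetaE_apply i b, thetaE_apply i (a * b)] at h
  rw [add_comm]
  simpa [Matrix.mul_apply, Fin.sum_univ_two] using h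

theorem opF_one (i : Fin (n - 1)) : opF i (1 : Ext k n q) = 0 := by
  simp [opF]

theorem opF_ex (i : Fin (n - 1)) (j : Fin n) :
    opF i (ex q j) = (if j = lo i then ex q (hi i) else 0 : Ext k n q) := by
  have hj : thetaF i (ex q j) = !![(kap q i j)⁻¹ • ex q j, exF q i j; 0, ex q j] :=
    extLift_ex q _ _ _ j
  simp [opF, hj, exF]

/-- `E_{-i}` acts on products through the coproduct. -/
theorem opF_mul (i : Fin (n - 1)) (a b : Ext k n q) :
    opF i (a * b) = opF i a * b + opKinv i a * opF i b := by
  have h := congrFun (congrFun (map_mul (thetaF i) a b) 0) 1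
  rw [thetaF_apply i a, thetaF_apply i b, thetaF_apply i (a * b)] at h
  rw [add_comm]
  simpa [Matrix.mul_apply, Fin.sum_univ_two] using h

end Standard

/-! ### Tensor products of exterior powers

An indexed tensor product over `Fin m` stands for the ordered tensor product with the factors
written backwards: the factor of index `m` is the leftmost one, the factor of index `1` the
rightmost one. -/

section Tensor

variable {k : Type} [Field k] {n : ℕ} (q : k)

/-- The tensor power `Λ_q^•(k^n)^{⊗ m}`. -/
abbrev TPow (k : Type) [Field k] (n : ℕ) (q : k) (m : ℕ) : Type :=
  ⨂[k] _ : Fin m, Ext k n q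

/-- `Λ_q^d(k^n) = Λ_q^{d_m}(k^n) ⊗ ⋯ ⊗ Λ_q^{d_1}(k^n)`, inside the tensor power. -/
def extTensor {m : ℕ} (d : Fin m → ℕ) : Submodule k (TPow k n q m) :=
  Submodule.span k {y | ∃ z : Fin m → Ext k n q,
    (∀ j, z j ∈ extDeg q (d j)) ∧ y = PiTensorProduct.tprod k z}

/-- The projection of the tensor power onto `Λ_q^d(k^n)`. -/
def projTensor {m : ℕ} (d : Fin m → ℕ) : TPow k n q m →ₗ[k] TPow k n q m :=
  PiTensorProduct.map fun j => projDeg q (d j)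

/-- Put a two-fold tensor in the factors of indices `a` (left) and `b` (right), the other factors
being taken from `z`. -/
def putPair {A : Type} [AddCommGroup A] [Module k A] {m : ℕ} (a b : Fin m) (hab : a ≠ b)
    (z : Fin m → A) : A ⊗[k] A →ₗ[k] ⨂[k] _ : Fin m, A :=
  TensorProduct.lift (LinearMap.mk₂ k
    (fun s t => PiTensorProduct.tprod k (Function.update (Function.update z a s) b t))
    (fun s s' t => by
      rw [Function.update_comm hab, Function.update_comm hab, Function.update_comm hab,
        MultilinearMap.map_update_add])
    (fun c s t => by
      rw [Function.update_comm hab, Function.update_comm hab, MultilinearMap.map_update_smul])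
    (fun s t t' => by rw [MultilinearMap.map_update_add])
    (fun c s t => by rw [MultilinearMap.map_update_smul]))

theorem putPair_tmul {A : Type} [AddCommGroup A] [Module k A] {m : ℕ} (a b : Fin m) (hab : a ≠ b)
    (z : Fin m → A) (s t : A) : putPair (k := k) a b hab z (s ⊗ₜ t) =
      PiTensorProduct.tprod k (Function.update (Function.update z a s) b t) := rfl

theorem putPair_congr {A : Type} [AddCommGroup A] [Module k A] {m : ℕ} (a b : Fin m) (hab : a ≠ b)
    {z z' : Fin m → A} (h : ∀ j, j ≠ a → j ≠ b → z j = z' j) :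
    putPair (k := k) a b hab z = putPair a b hab z' := by
  refine TensorProduct.ext' fun s t => ?_
  rw [putPair_tmul, putPair_tmul]
  congr 1
  funext j
  by_cases hb : j = b
  · subst hb; simp
  · by_cases ha : j = a
    · subst ha; simp [hb]
    · simp [ha, hb, h]

theorem putPair_add {A : Type} [AddCommGroup A] [Module k A] {m : ℕ} (a b : Fin m) (hab : a ≠ b)
    (z : Fin m → A) (p : Fin m) (ha : p ≠ a) (hb : p ≠ b) (x y : A) (w : A ⊗[k] A) :
    putPair a b hab (Function.update z p (x + y)) w =
      putPair a b hab (Function.update z p x) w + putPair a b hab (Function.update z p y) w := by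
  rw [← LinearMap.add_apply]
  refine LinearMap.congr_fun (TensorProduct.ext' fun s t => ?_) w
  rw [LinearMap.add_apply, putPair_tmul, putPair_tmul, putPair_tmul]
  simp only [Function.update_comm ha, Function.update_comm hb, MultilinearMap.map_update_add]

theorem putPair_smul {A : Type} [AddCommGroup A] [Module k A] {m : ℕ} (a b : Fin m) (hab : a ≠ b)
    (z : Fin m → A) (p : Fin m) (ha : p ≠ a) (hb : p ≠ b) (c : k) (x : A) (w : A ⊗[k] A) :
    putPair a b hab (Function.update z p (c • x)) w =
      c • putPair a b hab (Function.update z p x) w := by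
  rw [← LinearMap.smul_apply]
  refine LinearMap.congr_fun (TensorProduct.ext' fun s t => ?_) w
  rw [LinearMap.smul_apply, putPair_tmul, putPair_tmul]
  simp only [Function.update_comm ha, Function.update_comm hb, MultilinearMap.map_update_smul]

/-- `id ⊗ ⋯ ⊗ f ⊗ ⋯ ⊗ id`, where `f` acts on the factors of indices `a` (left) and `b` (right). -/
def onPair {A : Type} [AddCommGroup A] [Module k A] {m : ℕ} (a b : Fin m) (hab : a ≠ b)
    (f : A ⊗[k] A →ₗ[k] A ⊗[k] A) : (⨂[k] _ : Fin m, A) →ₗ[k] ⨂[k] _ : Fin m, A :=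
  PiTensorProduct.lift
    { toFun := fun z => putPair a b hab z (f (z a ⊗ₜ z b))
      map_update_add' := by
        intro inst z p x y
        obtain rfl : inst = instDecidableEqFin m := Subsingleton.elim _ _
        by_cases ha : p = a
        · subst ha
          have hc : ∀ u, putPair (k := k) p b hab (Function.update z p u) = putPair p b hab z :=
            fun u => putPair_congr p b hab fun j hj _ => by simp [hj]
          simp [hc, hab.symm, TensorProduct.add_tmul]
        · by_cases hb : p = b
          · subst hb
            have hc : ∀ u, putPair (k := k) a p hab (Function.update z p u) = putPair a p hab z :=
              fun u => putPair_congr a p hab fun j _ hj => by simp [hj]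
            simp [hc, hab, TensorProduct.tmul_add]
          · rw [putPair_add a b hab z p ha hb]
            simp [Ne.symm ha, Ne.symm hb]
      map_update_smul' := by
        intro inst z p c x
        obtain rfl : inst = instDecidableEqFin m := Subsingleton.elim _ _
        by_cases ha : p = a
        · subst ha
          have hc : ∀ u, putPair (k := k) p b hab (Function.update z p u) = putPair p b hab z :=
            fun u => putPair_congr p b hab fun j hj _ => by simp [hj]
          simp [hc, hab.symm, ← TensorProduct.smul_tmul']
        · by_cases hb : p = b
          · subst hb
            have hc : ∀ u, putPair (k := k) a p hab (Function.update z p u) = putPair a p hab z :=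
              fun u => putPair_congr a p hab fun j _ hj => by simp [hj]
            simp [hc, hab, TensorProduct.tmul_smul]
          · rw [putPair_smul a b hab z p ha hb]
            simp [Ne.symm ha, Ne.symm hb] }

theorem onPair_tprod {A : Type} [AddCommGroup A] [Module k A] {m : ℕ} (a b : Fin m) (hab : a ≠ b)
    (f : A ⊗[k] A →ₗ[k] A ⊗[k] A) (z : Fin m → A) :
    onPair a b hab f (PiTensorProduct.tprod k z) = putPair a b hab z (f (z a ⊗ₜ z b)) := by
  simp [onPair]

end Tensor

/-! ### The generating intertwiners and the action through ladders

The ground field is `ℂ(v)`. The quantum parameter on the `sl_m` side is `v`, the one on the `sl_N`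
side is `q = -v⁻¹`. -/

/-- The field `ℂ(v) = ℂ(q)`. -/
abbrev Kv : Type := RatFunc ℂ

/-- The quantum parameter `v`. -/
def v : Kv := RatFunc.X

/-- The quantum parameter `q`, for which `v = -q⁻¹`. -/
def qN : Kv := -v⁻¹

instance : NeZero v := ⟨RatFunc.X_ne_zero⟩

/-- `Λ_q^•(C_q^N)`. -/
abbrev ExtN (N : ℕ) : Type := Ext Kv N qN

/-- `ℓ(S, T)`, the number of pairs `(i, j)` in `S × T` with `i < j`. -/
def ell {N : ℕ} (S T : Finset (Fin N)) : ℕ := ((S ×ˢ T).filter fun p => p.1 < p.2).card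

/-- The intertwiner `M_{a,b} : Λ^a ⊗ Λ^b → Λ^{a+b}`, extended by zero to all degrees:
`x_S ⊗ x_T ↦ v^{ℓ(T,S)} x_{S ∪ T}` if `S` and `T` are disjoint, and `0` otherwise. -/
def merge (N a b : ℕ) : ExtN N ⊗[Kv] ExtN N →ₗ[Kv] ExtN N :=
  TensorProduct.lift ((xBasis qN).constr Kv fun S => (xBasis qN).constr Kv fun T =>
    if S.card = a ∧ T.card = b ∧ Disjoint S T then v ^ ell T S • xS qN (S ∪ T) else 0)

/-- The intertwiner `M'_{a,b} : Λ^{a+b} → Λ^a ⊗ Λ^b`, extended by zero to all degrees: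
`x_S ↦ ∑ v^{-ℓ(T, S∖T)} x_T ⊗ x_{S∖T}`, the sum over the `T ⊆ S` with `a` elements. -/
def split (N a b : ℕ) : ExtN N →ₗ[Kv] ExtN N ⊗[Kv] ExtN N :=
  (xBasis qN).constr Kv fun S =>
    if S.card = a + b then
      ∑ T ∈ S.powersetCard a, (v ^ (-(ell T (S \ T) : ℤ))) • (xS qN T ⊗ₜ[Kv] xS qN (S \ T))
    else 0

theorem merge_xS (N a b : ℕ) (S T : Finset (Fin N)) : merge N a b (xS qN S ⊗ₜ xS qN T) =
    if S.card = a ∧ T.card = b ∧ Disjoint S T then v ^ ell T S • xS qN (S ∪ T) else 0 := by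
  rw [merge, TensorProduct.lift.tmul, ← xBasis_apply, ← xBasis_apply, Module.Basis.constr_basis,
    Module.Basis.constr_basis]

theorem split_xS (N a b : ℕ) (S : Finset (Fin N)) : split N a b (xS qN S) =
    if S.card = a + b then
      ∑ T ∈ S.powersetCard a, (v ^ (-(ell T (S \ T) : ℤ))) • (xS qN T ⊗ₜ[Kv] xS qN (S \ T))
    else 0 := by
  rw [split, ← xBasis_apply, Module.Basis.constr_basis]

/-- The value of the ladder with one rung labelled `1` that goes from the left upright to the right
upright, with bottom labels `a` (left) and `b` (right): split `a` into `a - 1` and `1`, then merge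
`1` and `b`. It is the zero map if `a = 0`. -/
def rungRight (N a b : ℕ) : ExtN N ⊗[Kv] ExtN N →ₗ[Kv] ExtN N ⊗[Kv] ExtN N :=
  if a = 0 then 0 else
    LinearMap.lTensor (ExtN N) (merge N 1 b)
      ∘ₗ (TensorProduct.assoc Kv (ExtN N) (ExtN N) (ExtN N)).toLinearMap
      ∘ₗ LinearMap.rTensor (ExtN N) (split N (a - 1) 1)

/-- The value of the ladder with one rung labelled `1` that goes from the right upright to the left
upright, with bottom labels `a` (left) and `b` (right): split `b` into `1` and `b - 1`, then merge
`a` and `1`. It is the zero map if `b = 0`. -/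
def rungLeft (N a b : ℕ) : ExtN N ⊗[Kv] ExtN N →ₗ[Kv] ExtN N ⊗[Kv] ExtN N :=
  if b = 0 then 0 else
    LinearMap.rTensor (ExtN N) (merge N a 1)
      ∘ₗ (TensorProduct.assoc Kv (ExtN N) (ExtN N) (ExtN N)).symm.toLinearMap
      ∘ₗ LinearMap.lTensor (ExtN N) (split N 1 (b - 1))

/-- The set `Λ(m,d)_N` of the `N`-bounded `gl_m`-weights of total degree `d`. -/
def IsBdd (m d N : ℕ) (a : Fin m → ℕ) : Prop := (∀ j, a j ≤ N) ∧ ∑ j, a j = d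

/-- `φ_{m,d,N}(lam) = a`: the `N`-bounded `gl_m`-weight `a` of degree `d` lifts the `sl_m`-weight
`lam`. -/
def IsLift (m d N : ℕ) (lam : Wt m) (a : Fin m → ℕ) : Prop :=
  IsBdd m d N a ∧ ∀ i, (a (lo i) : ℤ) - a (hi i) = lam i

/-- The space `⨁ Λ_q^a(C_q^N)`, the sum over `a` in `Λ(m,m)_N`, inside `Λ_q^•(C_q^N)^{⊗ m}`. -/
def HoweSpace (N m : ℕ) : Submodule Kv (TPow Kv N qN m) :=
  ⨆ a ∈ {a : Fin m → ℕ | IsBdd m m N a}, extTensor qN a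

/-- The intertwiner associated with `E_{+i} 1_lam` by the ladder functor, where `lam` lifts to `a`:
a rung from the upright `i + 1` to the upright `i`. -/
def ladderE (N : ℕ) {m : ℕ} (i : Fin (m - 1)) (a : Fin m → ℕ) :
    TPow Kv N qN m →ₗ[Kv] TPow Kv N qN m :=
  onPair (hi i) (lo i) (lo_ne_hi i).symm (rungRight N (a (hi i)) (a (lo i))) ∘ₗ projTensor qN a

/-- The intertwiner associated with `E_{-i} 1_lam` by the ladder functor, where `lam` lifts to `a`:
a rung from the upright `i` to the upright `i + 1`. -/
def ladderF (N : ℕ) {m : ℕ} (i : Fin (m - 1)) (a : Fin m → ℕ) :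
    TPow Kv N qN m →ₗ[Kv] TPow Kv N qN m :=
  onPair (hi i) (lo i) (lo_ne_hi i).symm (rungLeft N (a (hi i)) (a (lo i))) ∘ₗ projTensor qN a

/-- `ρ` is the action of the idempotented algebra on `⨁ Λ_q^a(C_q^N)` through the
Cautis-Kamnitzer-Morrison functor `γ_{m,m,N}` to webs, determined by its values on generators
(`m` upright strands for `1_lam`, a one-rung ladder for `E_{±i} 1_lam`), followed by the functor
`Γ_N` from webs to intertwiners: `1_lam` acts as the identity of `Λ_q^a(C_q^N)`, and `E_{±i} 1_lam` as the intertwiner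
of the one-rung ladder on `Λ_q^a(C_q^N)`, if `lam` lifts to `a` in `Λ(m,m)_N`, and all act as zero
on the other summands; all act as zero if `lam` has no lift. -/
structure IsHoweAction (N m : ℕ) (ρ : Udot Kv m v →ₙₐ[Kv] Module.End Kv (HoweSpace N m)) :
    Prop where
  one_lift : ∀ lam a, IsLift m m N lam a → ∀ w : HoweSpace N m,
    (ρ (uOne v lam) w : TPow Kv N qN m) = projTensor qN a w
  E_lift : ∀ i lam a, IsLift m m N lam a → ∀ w : HoweSpace N m,
    (ρ (uE v i lam) w : TPow Kv N qN m) = ladderE N i a w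
  F_lift : ∀ i lam a, IsLift m m N lam a → ∀ w : HoweSpace N m,
    (ρ (uF v i lam) w : TPow Kv N qN m) = ladderF N i a w
  one_none : ∀ lam, (¬ ∃ a, IsLift m m N lam a) → ρ (uOne v lam) = 0
  E_none : ∀ i lam, (¬ ∃ a, IsLift m m N lam a) → ρ (uE v i lam) = 0
  F_none : ∀ i lam, (¬ ∃ a, IsLift m m N lam a) → ρ (uF v i lam) = 0

/-! ### The standard action -/

section StandardAction

variable {m N : ℕ}

/-- `K_i` on the tensor power `Λ_v^•(C_v^m)^{⊗ N}`. -/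
def tensK (i : Fin (m - 1)) : TPow Kv m v N →ₗ[Kv] TPow Kv m v N :=
  PiTensorProduct.map fun _ => (opK i).toLinearMap

/-- `E_{+i}` on the tensor power, by `Δ(E_{+i}) = E_{+i} ⊗ K_i + 1 ⊗ E_{+i}`: a sum over the factor
on which `E_{+i}` acts, with `K_i` on the factors to its right. -/
def tensE (i : Fin (m - 1)) : TPow Kv m v N →ₗ[Kv] TPow Kv m v N :=
  ∑ c : Fin N, PiTensorProduct.map fun c' =>
    if c' < c then (opK i).toLinearMap else if c' = c then opE i else LinearMap.id

/-- `E_{-i}` on the tensor power, by `Δ(E_{-i}) = E_{-i} ⊗ 1 + K_i⁻¹ ⊗ E_{-i}`: a sum over the factor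
on which `E_{-i}` acts, with `K_i⁻¹` on the factors to its left. -/
def tensF (i : Fin (m - 1)) : TPow Kv m v N →ₗ[Kv] TPow Kv m v N :=
  ∑ c : Fin N, PiTensorProduct.map fun c' =>
    if c < c' then (opKinv i).toLinearMap else if c' = c then opF i else LinearMap.id

/-- The space `Λ_v^ℓ(C_v^m)^{⊗ N}`. -/
def StdSpace (N l m : ℕ) : Submodule Kv (TPow Kv m v N) := extTensor v fun _ => l

/-- `w` has `sl_m`-weight `lam`. -/
def IsWtVec (lam : Wt m) (w : TPow Kv m v N) : Prop := ∀ i, tensK i w = v ^ lam i • w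

/-- `σ` is the standard action of the idempotented algebra on `Λ_v^ℓ(C_v^m)^{⊗ N}`: `1_lam` acts as
the projection onto the `lam`-weight space along the other weight spaces, and `E_{±i} 1_lam` as
this projection followed by the operator `E_{±i}`. -/
structure IsStdAction (N l m : ℕ) (σ : Udot Kv m v →ₙₐ[Kv] Module.End Kv (StdSpace N l m)) :
    Prop where
  one_self : ∀ lam (w : StdSpace N l m), IsWtVec lam w.1 → σ (uOne v lam) w = w
  one_ne : ∀ lam mu (w : StdSpace N l m), IsWtVec mu w.1 → lam ≠ mu → σ (uOne v lam) w = 0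
  E_apply : ∀ i lam (w : StdSpace N l m),
    (σ (uE v i lam) w : TPow Kv m v N) = tensE i (σ (uOne v lam) w : TPow Kv m v N)
  F_apply : ∀ i lam (w : StdSpace N l m),
    (σ (uF v i lam) w : TPow Kv m v N) = tensF i (σ (uOne v lam) w : TPow Kv m v N)

end StandardAction

/-! ### Column-strict tableaux -/

section Tableaux

/-- Column-strict tableaux of shape `(N^l)` (that is, `l` rows of length `N`) with entries in
`{1, …, m}`; the entry in row `r` and column `c` is `T r c`. -/
abbrev Col (N l m : ℕ) : Type :=
  {T : Fin l → Fin N → Fin m // ∀ c r r', r < r' → T r c < T r' c}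

variable {N l m : ℕ}

/-- The number of entries of `T` equal to `j`. -/
def typ (T : Col N l m) (j : Fin m) : ℕ :=
  (Finset.univ.filter fun p : Fin l × Fin N => T.1 p.1 p.2 = j).card

/-- The `sl_m`-weight determined by the type of `T`. -/
def wt (T : Col N l m) : Wt m := fun i => (typ T (lo i) : ℤ) - typ T (hi i)

/-- The set of the (numbers of the) columns of `T` which contain the entry `j`. -/
def colsWith (T : Col N l m) (j : Fin m) : Finset (Fin N) :=
  Finset.univ.filter fun c => ∃ r, T.1 r c = j

/-- The set of the entries of the column `c` of `T`. -/
def column (T : Col N l m) (c : Fin N) : Finset (Fin m) := Finset.univ.image fun r => T.1 r c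

/-- `T'` is obtained from `T` by changing one entry `a` to `b`. -/
def Changes (a b : Fin m) (T T' : Col N l m) : Prop :=
  ∃ r c, T.1 r c = a ∧ T'.1 r c = b ∧ ∀ r' c', (r', c') ≠ (r, c) → T'.1 r' c' = T.1 r' c'

instance (a b : Fin m) (T T' : Col N l m) : Decidable (Changes a b T T') :=
  inferInstanceAs (Decidable (∃ _, _))

/-- The number of entries of `T` equal to `j` in columns to the right of a column in which `T` and
`T'` differ. -/
def cntRight (T T' : Col N l m) (j : Fin m) : ℕ :=
  (Finset.univ.filter fun p : Fin l × Fin N =>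
    T.1 p.1 p.2 = j ∧ ∃ r c, T.1 r c ≠ T'.1 r c ∧ c < p.2).card

/-- The number of entries of `T` equal to `j` in columns to the left of a column in which `T` and
`T'` differ. -/
def cntLeft (T T' : Col N l m) (j : Fin m) : ℕ :=
  (Finset.univ.filter fun p : Fin l × Fin N =>
    T.1 p.1 p.2 = j ∧ ∃ r c, T.1 r c ≠ T'.1 r c ∧ p.2 < c).card

/-- The exponent `a_{T,T'}`, for `T'` obtained from `T` by changing one `i` to `i + 1`. -/
def aExp (i : Fin (m - 1)) (T T' : Col N l m) : ℤ := cntRight T T' (lo i) - cntRight T T' (hi i)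

/-- The exponent `b_{T,T''}`, for `T''` obtained from `T` by changing one `i + 1` to `i`. -/
def bExp (i : Fin (m - 1)) (T T' : Col N l m) : ℤ := cntLeft T T' (lo i) - cntLeft T T' (hi i)

theorem colsWith_card (T : Col N l m) (j : Fin m) : (colsWith T j).card = typ T j := by
  have h : colsWith T j =
      (Finset.univ.filter fun p : Fin l × Fin N => T.1 p.1 p.2 = j).image Prod.snd := by
    ext c
    simp [colsWith]
  rw [h, typ]
  refine Finset.card_image_of_injOn ?_
  rintro ⟨r, c⟩ hp ⟨r', c'⟩ hp' (hc : c = c')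
  subst hc
  have h1 : T.1 r c = j := by simpa using hp
  have h2 : T.1 r' c = j := by simpa using hp'
  rcases lt_trichotomy r r' with h3 | h3 | h3
  · exact absurd (h1.trans h2.symm) (T.2 c r r' h3).ne
  · rw [h3]
  · exact absurd (h2.trans h1.symm) (T.2 c r' r h3).ne

theorem column_card (T : Col N l m) (c : Fin N) : (column T c).card = l := by
  unfold column
  rw [Finset.card_image_of_injective, Finset.card_univ, Fintype.card_fin]
  intro r r' (h : T.1 r c = T.1 r' c)
  rcases lt_trichotomy r r' with h3 | h3 | h3
  · exact absurd h (T.2 c r r' h3).ne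
  · exact h3
  · exact absurd h.symm (T.2 c r' r h3).ne

theorem typ_isBdd (T : Col N l (N * l)) : IsBdd (N * l) (N * l) N (typ T) := by
  refine ⟨fun j => ?_, ?_⟩
  · rw [← colsWith_card]
    simpa using Finset.card_le_univ (colsWith T j)
  · have h := Finset.card_eq_sum_card_fiberwise (s := (Finset.univ : Finset (Fin l × Fin N)))
      (t := Finset.univ) (f := fun p => T.1 p.1 p.2) (fun _ _ => Finset.mem_univ _)
    rw [Finset.card_univ, Fintype.card_prod, Fintype.card_fin, Fintype.card_fin, mul_comm] at h
    exact h.symm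

/-- The basis tensor `x^T = x_{S_m} ⊗ ⋯ ⊗ x_{S_1}` of `⨁ Λ_q^a(C_q^N)`, where `S_j` is the set of
the columns of `T` which contain `j`. -/
def xUp (T : Col N l (N * l)) : HoweSpace N (N * l) :=
  ⟨PiTensorProduct.tprod Kv fun j => xS qN (colsWith T j), by
    refine Submodule.mem_iSup_of_mem (typ T) (Submodule.mem_iSup_of_mem (typ_isBdd T) ?_)
    exact Submodule.subset_span ⟨_, fun j => Submodule.subset_span ⟨_, colsWith_card T j, rfl⟩,
      rfl⟩⟩

/-- The basis tensor `x_T = x_{T(N)} ⊗ ⋯ ⊗ x_{T(1)}` of `Λ_v^ℓ(C_v^m)^{⊗ N}`, where `T(c)` is the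
column `c` of `T`. -/
def xDown (T : Col N l m) : StdSpace N l m :=
  ⟨PiTensorProduct.tprod Kv fun c => xS v (column T c),
    Submodule.subset_span ⟨_, fun c => Submodule.subset_span ⟨_, column_card T c, rfl⟩, rfl⟩⟩

end Tableaux

end QHowe

end

open scoped TensorProduct

noncomputable section

namespace QHowe

/-! ### Families satisfying the relations of `U_q(sl_n)` -/

/-! Both tensor powers have bases indexed by 0-1 matrices of size `N` by `m`. A family `P` of `N`
subsets of the `m` letters gives a product of elementary tensors on the standard side; the
transposed family of `m` subsets of the `N` columns gives one on the ladder side. Transposing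
matrices is therefore a linear isomorphism `transpEquiv` of the full tensor powers, and the theorem
says that it turns the standard operators into the ladder operators.

This is a comparison of coefficients. On one exterior algebra over the `m` letters, `E_i` and `F_i`
replace one letter by its neighbour with no scalar at all (`opE_eq_moveLetter`,
`opF_eq_moveLetter`), so in the tensor power the only scalars come from the `K_i` or their inverses
that the coproduct places on one side of the active factor. Hence `E_i` and `F_i` are sums over the
columns `c` in which the replacement is possible, with exponent plus or minus the total weight of
the columns on one side of `c`. In a one-rung ladder, the split and the merge contribute exponents
that count the elements of two subsets on one side of `c`, and their difference is the same total
weight (`rungRight_xS`, `rungLeft_xS`). So the two operators agree on basis vectors of the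
appropriate degree (`ladderE_transp`, `ladderF_transp`).

Consequently no relation has to be checked for ladders. The relations hold on one exterior algebra
(`slRels_column`), the coproduct preserves them (`SlRels.coprod`, `SlRels.tensorPower`), and the
action is transported along `transpEquiv`. The idempotents match because, in total degree `m`, a
`gl_m`-weight is determined by its `sl_m`-weight (`eq_of_sub_eq`). Both actions are unique because
the idempotented algebra is generated by the `1_lam`, `E_i 1_lam` and `F_i 1_lam`
(`udot_induction`).

A column-strict tableau is a matrix with `ℓ` letters in every column, and its admissible changes of
one entry correspond to the columns in which the replacement is possible (`sum_changes`). This gives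
the tableau formulas, and the embedding is the restriction of `transpEquiv`, which lands in degree
`m` because `m = Nℓ`. -/

/-- The families `E`, `F`, `K`, `L` (with `L i` the inverse of `K i`) of elements of an algebra
satisfy the defining relations of `U_q(sl_n)`. -/
structure SlRels {k A : Type} [Field k] [Ring A] [Algebra k A] {n : ℕ} (q : k)
    (E F K L : Fin (n - 1) → A) : Prop where
  K_comm : ∀ i j, K i * K j = K j * K i
  K_L : ∀ i, K i * L i = 1
  L_K : ∀ i, L i * K i = 1
  E_F_self : ∀ i, E i * F i - F i * E i = (q - q⁻¹)⁻¹ • (K i - L i)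
  E_F_ne : ∀ i j, i ≠ j → E i * F j = F j * E i
  K_E : ∀ i j, K i * E j = q ^ cartan i j • (E j * K i)
  K_F : ∀ i j, K i * F j = q ^ (-cartan i j) • (F j * K i)
  E_serre : ∀ i j, Adj i j →
    E i ^ 2 * E j - (q + q⁻¹) • (E i * E j * E i) + E j * E i ^ 2 = 0
  F_serre : ∀ i j, Adj i j →
    F i ^ 2 * F j - (q + q⁻¹) • (F i * F j * F i) + F j * F i ^ 2 = 0
  E_comm : ∀ i j, ¬ Adj i j → E i * E j = E j * E i
  F_comm : ∀ i j, ¬ Adj i j → F i * F j = F j * F i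

theorem cartan_comm {n : ℕ} (i j : Fin (n - 1)) : cartan i j = cartan j i := by
  have h : Adj i j ↔ Adj j i := or_comm
  simp only [cartan, h, eq_comm (a := i)]

theorem cartan_self {n : ℕ} (i : Fin (n - 1)) : cartan i i = 2 := by
  simp [cartan]

theorem not_adj_self {n : ℕ} (i : Fin (n - 1)) : ¬ Adj i i := by
  simp [Adj]

theorem Adj.symm {n : ℕ} {i j : Fin (n - 1)} (h : Adj i j) : Adj j i := Or.symm h

theorem cartan_of_adj {n : ℕ} {i j : Fin (n - 1)} (h : Adj i j) : cartan i j = -1 := by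
  have : i ≠ j := fun h' => not_adj_self i (by rwa [← h'] at h)
  simp [cartan, this, h]

theorem cartan_of_not_adj {n : ℕ} {i j : Fin (n - 1)} (hij : i ≠ j) (h : ¬ Adj i j) :
    cartan i j = 0 := by
  simp [cartan, hij, h]

/-- The quantum Serre relation for sums of `q`-commuting elements. -/
theorem serre_add {k A : Type} [Field k] [Ring A] [Algebra k A] {p : k} (hp : p ≠ 0)
    {a a' b b' : A}
    (haa : b * a = p ^ (2 : ℤ) • (a * b)) (hab : b * a' = p⁻¹ • (a' * b))
    (hba : b' * a = p⁻¹ • (a * b'))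
    (ha : a ^ 2 * a' - (p + p⁻¹) • (a * a' * a) + a' * a ^ 2 = 0)
    (hb : b ^ 2 * b' - (p + p⁻¹) • (b * b' * b) + b' * b ^ 2 = 0) :
    (a + b) ^ 2 * (a' + b') - (p + p⁻¹) • ((a + b) * (a' + b') * (a + b))
      + (a' + b') * (a + b) ^ 2 = 0 := by
  have haa' : ∀ x, b * (a * x) = p ^ (2 : ℤ) • (a * (b * x)) := fun x => by
    rw [← mul_assoc, haa, smul_mul_assoc, mul_assoc]
  have hab' : ∀ x, b * (a' * x) = p⁻¹ • (a' * (b * x)) := fun x => by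
    rw [← mul_assoc, hab, smul_mul_assoc, mul_assoc]
  have hba' : ∀ x, b' * (a * x) = p⁻¹ • (a * (b' * x)) := fun x => by
    rw [← mul_assoc, hba, smul_mul_assoc, mul_assoc]
  rw [sub_add_eq_add_sub, sub_eq_zero] at ha hb ⊢
  simp only [pow_two, mul_assoc] at ha hb
  simp only [pow_two, mul_add, add_mul, mul_assoc, haa, hab, hba, haa', hab', hba',
    mul_smul_comm, smul_mul_assoc, smul_smul, smul_add]
  -- Every `b` and `b'` now stands to the right of every `a` and `a'`; no product of `b'` with `a'`
  -- occurs since the expression is linear in the primed elements. Eliminating one monomial of each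
  -- pure Serre relation leaves scalar identities in `p`, one for each normally ordered monomial.
  have ha2 : a * (a * a') = (p + p⁻¹) • (a * (a' * a)) - a' * (a * a) := eq_sub_of_add_eq ha
  have hb2 : b * (b * b') = (p + p⁻¹) • (b * (b' * b)) - b' * (b * b) := eq_sub_of_add_eq hb
  rw [ha2, hb2]
  match_scalars <;> field_simp <;> ring

namespace SlRels

variable {k A : Type} [Field k] [Ring A] [Algebra k A] {n : ℕ} {q : k}
  {E F K L E' F' K' L' : Fin (n - 1) → A}

theorem E_K (h : SlRels q E F K L) (hq : q ≠ 0) (i j : Fin (n - 1)) :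
    E j * K i = q ^ (-cartan i j) • (K i * E j) := by
  rw [h.K_E, smul_smul, ← zpow_add₀ hq, neg_add_cancel, zpow_zero, one_smul]

/-- Conjugation by `L i` inverts conjugation by `K i`, so the two scalars are inverse to each other.
This is why `SlRels` lists no relations between `L` and `E`, `F`. -/
theorem L_mul_of_K_mul (h : SlRels q E F K L) (hq : q ≠ 0) {i : Fin (n - 1)} {x : A} {c : ℤ}
    (hx : K i * x = q ^ c • (x * K i)) : L i * x = q ^ (-c) • (x * L i) := by
  calc L i * x = L i * (q ^ (-c) • (q ^ c • (x * K i)) * L i) := by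
        rw [smul_smul, ← zpow_add₀ hq, neg_add_cancel, zpow_zero, one_smul, mul_assoc x, h.K_L,
          mul_one]
    _ = q ^ (-c) • (x * L i) := by
        rw [← hx, smul_mul_assoc, mul_smul_comm, ← mul_assoc, ← mul_assoc, h.L_K, one_mul]

theorem L_E (h : SlRels q E F K L) (hq : q ≠ 0) (i j : Fin (n - 1)) :
    L i * E j = q ^ (-cartan i j) • (E j * L i) := h.L_mul_of_K_mul hq (h.K_E i j)

theorem L_F (h : SlRels q E F K L) (hq : q ≠ 0) (i j : Fin (n - 1)) :
    L i * F j = q ^ cartan i j • (F j * L i) := by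
  rw [h.L_mul_of_K_mul hq (h.K_F i j), neg_neg]

theorem L_commute (h : SlRels q E F K L) {i : Fin (n - 1)} {x : A} (hx : Commute (K i) x) :
    Commute (L i) x := by
  calc L i * x = L i * (x * K i) * L i := by rw [mul_assoc, mul_assoc x, h.K_L, mul_one]
    _ = x * L i := by rw [← hx.eq, ← mul_assoc, h.L_K, one_mul]

theorem L_K_comm (h : SlRels q E F K L) (i j : Fin (n - 1)) : Commute (L i) (K j) :=
  h.L_commute (h.K_comm i j)

theorem L_comm (h : SlRels q E F K L) (i j : Fin (n - 1)) : Commute (L i) (L j) :=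
  h.L_commute (h.L_K_comm j i).symm

/-- All three monomials contain `a` twice and `b` once, so the commuting factor `a ^ 2 * b` can be
pulled out on the left. It transfers the Serre relation to elements twisted by the group-like
factors of the coproduct. -/
theorem commute_sq_mul {a b x y : A} (h1 : Commute a x) (h2 : Commute a y) (h3 : Commute b x)
    (h4 : Commute a b) {p : k}
    (h : x ^ 2 * y - p • (x * y * x) + y * x ^ 2 = 0) :
    (a * x) ^ 2 * (b * y) - p • ((a * x) * (b * y) * (a * x)) + (b * y) * (a * x) ^ 2 = 0 := by
  have e1 : (a * x) ^ 2 * (b * y) = (a ^ 2 * b) * (x ^ 2 * y) := by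
    rw [h1.mul_pow, mul_assoc, ← mul_assoc (x ^ 2), ← (h3.pow_right 2).eq]
    simp only [mul_assoc]
  have e2 : (b * y) * (a * x) ^ 2 = (a ^ 2 * b) * (y * x ^ 2) := by
    rw [h1.mul_pow, mul_assoc, ← mul_assoc y, ← (h2.pow_left 2).eq, (h4.pow_left 2).eq]
    simp only [mul_assoc]
  have e3 : (a * x) * (b * y) * (a * x) = (a ^ 2 * b) * (x * y * x) := by
    have e4 : (a * x) * (b * y) = (a * b) * (x * y) := by
      rw [mul_assoc, ← mul_assoc x, ← h3.eq]
      simp only [mul_assoc]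
    rw [e4, pow_two, mul_assoc (a * b), ← mul_assoc (x * y) a x, ← (h1.mul_right h2).eq,
      ← mul_assoc, ← mul_assoc, mul_assoc a b, ← h4.eq]
    simp only [mul_assoc]
  rw [e1, e2, e3, ← mul_smul_comm, ← mul_sub, ← mul_add, h, mul_zero]

/-- The relations are preserved by the coproduct `Δ(E_i) = E_i ⊗ K_i + 1 ⊗ E_i`,
`Δ(F_i) = F_i ⊗ 1 + K_i⁻¹ ⊗ F_i`, `Δ(K_i) = K_i ⊗ K_i`. -/
theorem coprod (h : SlRels q E F K L) (h' : SlRels q E' F' K' L') (hq : q ≠ 0)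
    (EE : ∀ i j, Commute (E i) (E' j)) (EF : ∀ i j, Commute (E i) (F' j))
    (EK : ∀ i j, Commute (E i) (K' j))
    (FE : ∀ i j, Commute (F i) (E' j)) (FF : ∀ i j, Commute (F i) (F' j))
    (FK : ∀ i j, Commute (F i) (K' j))
    (KE : ∀ i j, Commute (K i) (E' j)) (KF : ∀ i j, Commute (K i) (F' j))
    (KK : ∀ i j, Commute (K i) (K' j)) :
    SlRels q (fun i => E i * K' i + E' i) (fun i => F i + L i * F' i) (fun i => K i * K' i)
      (fun i => L i * L' i) := by
  have LE : ∀ i j, Commute (L i) (E' j) := fun i j => h.L_commute (KE i j)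
  have LF : ∀ i j, Commute (L i) (F' j) := fun i j => h.L_commute (KF i j)
  have LK : ∀ i j, Commute (L i) (K' j) := fun i j => h.L_commute (KK i j)
  have KL : ∀ i j, Commute (K i) (L' j) := fun i j => (h'.L_commute (KK i j).symm).symm
  have LL : ∀ i j, Commute (L i) (L' j) := fun i j => (h'.L_commute (LK i j).symm).symm
  -- The two summands of each coproduct `q`-commute, with opposite powers of `q` for `E` and for
  -- `F`. This is the input of `serre_add`.
  have crossE : ∀ i j, E' i * (E j * K' j) = q ^ (-cartan i j) • (E j * K' j * E' i) := by
    intro i j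
    rw [← mul_assoc, ← (EE j i).eq, mul_assoc, h'.E_K hq, mul_smul_comm, mul_assoc, cartan_comm]
  have crossF : ∀ i j, L i * F' i * F j = q ^ cartan i j • (F j * (L i * F' i)) := by
    intro i j
    rw [mul_assoc, ← (FF j i).eq, ← mul_assoc, h.L_F hq, smul_mul_assoc, mul_assoc]
  -- Exchanging `E i` with `L j` and `K' i` with `F' j` produces inverse powers of `q`, which
  -- cancel.
  have mixed : ∀ i j, (E i * K' i) * (L j * F' j) = (L j * F' j) * (E i * K' i) := by
    intro i j
    calc (E i * K' i) * (L j * F' j) = (E i * L j) * (K' i * F' j) := by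
          rw [mul_assoc, ← mul_assoc (K' i), ← (LK j i).eq]; simp only [mul_assoc]
      _ = (L j * E i) * (F' j * K' i) := by
          rw [h'.K_F, h.L_E hq, smul_mul_assoc, mul_smul_comm, cartan_comm]
      _ = (L j * F' j) * (E i * K' i) := by
          rw [mul_assoc, ← mul_assoc (E i), (EF i j).eq]; simp only [mul_assoc]
  have EFexp : ∀ i j, (E i * K' i + E' i) * (F j + L j * F' j)
      - (F j + L j * F' j) * (E i * K' i + E' i)
      = (E i * F j - F j * E i) * K' i + L j * (E' i * F' j - F' j * E' i) := by
    intro i j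
    have e1 : E i * K' i * F j = E i * F j * K' i := by
      rw [mul_assoc, ← (FK j i).eq, mul_assoc]
    have e2 : E' i * (L j * F' j) = L j * (E' i * F' j) := by
      rw [← mul_assoc, ← (LE j i).eq, mul_assoc]
    rw [add_mul, mul_add, mul_add, mul_add, add_mul, add_mul, mixed, e1, e2, (FE j i).eq]
    simp only [sub_mul, mul_sub, mul_assoc]
    abel
  constructor
  · intro i j
    rw [mul_assoc, ← mul_assoc (K' i), ← (KK j i).eq, mul_assoc, ← mul_assoc, h.K_comm, h'.K_comm,
      mul_assoc, ← mul_assoc (K i), (KK i j).eq]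
    simp only [mul_assoc]
  · intro i
    rw [mul_assoc, ← mul_assoc (K' i), ← (LK i i).eq, mul_assoc, h'.K_L, mul_one, h.K_L]
  · intro i
    rw [mul_assoc, ← mul_assoc (L' i), ← (KL i i).eq, mul_assoc, h'.L_K, mul_one, h.L_K]
  · intro i
    -- The sum telescopes: `(K - L) K' + L (K' - L') = K K' - L L'`.
    rw [EFexp, h.E_F_self, h'.E_F_self, smul_mul_assoc, mul_smul_comm, ← smul_add, sub_mul, mul_sub]
    congr 1
    abel
  · intro i j hij
    rw [← sub_eq_zero, EFexp, h.E_F_ne i j hij, h'.E_F_ne i j hij]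
    simp
  · intro i j
    have e1 : K i * K' i * (E j * K' j) = q ^ cartan i j • (E j * K' j * (K i * K' i)) := by
      rw [mul_assoc, ← mul_assoc (K' i), ← (EK j i).eq, mul_assoc, h'.K_comm, ← mul_assoc, h.K_E,
        smul_mul_assoc, mul_assoc, ← mul_assoc (K i), (KK i j).eq]
      simp only [mul_assoc]
    have e2 : K i * K' i * E' j = q ^ cartan i j • (E' j * (K i * K' i)) := by
      rw [mul_assoc, h'.K_E, mul_smul_comm, ← mul_assoc, (KE i j).eq, mul_assoc]
    simp only [mul_add, add_mul, smul_add, e1, e2]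
  · intro i j
    have e1 : K i * K' i * F j = q ^ (-cartan i j) • (F j * (K i * K' i)) := by
      rw [mul_assoc, ← (FK j i).eq, ← mul_assoc, h.K_F, smul_mul_assoc, mul_assoc]
    have e2 : K i * K' i * (L j * F' j) = q ^ (-cartan i j) • (L j * F' j * (K i * K' i)) := by
      rw [mul_assoc, ← mul_assoc (K' i), ← (LK j i).eq, mul_assoc, h'.K_F, mul_smul_comm,
        mul_smul_comm, ← mul_assoc, ← (h.L_K_comm j i).eq, mul_assoc, ← mul_assoc (K i),
        (KF i j).eq]
      simp only [mul_assoc]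
    simp only [mul_add, add_mul, smul_add, e1, e2]
  · intro i j hij
    -- For the `E i`, the summands commute up to powers of `q⁻¹`, so `serre_add` is applied with `p
    -- = q⁻¹`; the Serre coefficient is symmetric under this inversion.
    have hs : q + q⁻¹ = q⁻¹ + (q⁻¹)⁻¹ := by rw [inv_inv, add_comm]
    have h1 := h.E_serre i j hij
    have h2 := h'.E_serre i j hij
    rw [hs] at h1 h2 ⊢
    refine serre_add (inv_ne_zero hq) ?_ ?_ ?_ ?_ h2
    · rw [crossE, cartan_self, inv_zpow']
    · rw [crossE, cartan_of_adj hij, inv_inv, neg_neg, zpow_one]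
    · rw [crossE, cartan_of_adj hij.symm, inv_inv, neg_neg, zpow_one]
    · rw [(EK i i).eq, (EK j j).eq]
      exact commute_sq_mul (EK i i).symm (EK j i).symm (EK i j).symm (h'.K_comm i j) h1
  · intro i j hij
    refine serre_add hq ?_ ?_ ?_ (h.F_serre i j hij) ?_
    · rw [crossF, cartan_self]
    · rw [crossF, cartan_of_adj hij, zpow_neg_one]
    · rw [crossF, cartan_of_adj hij.symm, zpow_neg_one]
    · exact commute_sq_mul (LF i i) (LF i j) (LF j i) (h.L_comm i j) (h'.F_serre i j hij)
  · intro i j hij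
    -- Non-adjacency includes `i = j`, where the Cartan entry is 2 and the cross terms do not
    -- commute; that case is trivial and is split off.
    by_cases hne : i = j
    · rw [hne]
    have e1 : E i * K' i * (E j * K' j) = E j * K' j * (E i * K' i) := by
      rw [mul_assoc, ← mul_assoc (K' i), ← (EK j i).eq, mul_assoc, h'.K_comm, ← mul_assoc,
        h.E_comm i j hij, mul_assoc, ← mul_assoc (E i), (EK i j).eq]
      simp only [mul_assoc]
    have e2 := crossE i j
    have e3 := crossE j i
    rw [cartan_of_not_adj hne hij, neg_zero, zpow_zero, one_smul] at e2
    rw [cartan_comm, cartan_of_not_adj hne hij, neg_zero, zpow_zero, one_smul] at e3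
    rw [add_mul, mul_add, mul_add, add_mul, mul_add, mul_add, e1, e2, e3, h'.E_comm i j hij]
    abel
  · intro i j hij
    by_cases hne : i = j
    · rw [hne]
    have e1 : L i * F' i * (L j * F' j) = L j * F' j * (L i * F' i) := by
      rw [mul_assoc, ← mul_assoc (F' i), ← (LF j i).eq, mul_assoc, h'.F_comm i j hij, ← mul_assoc,
        (h.L_comm i j).eq, mul_assoc, ← mul_assoc (L i), (LF i j).eq]
      simp only [mul_assoc]
    have e2 := crossF i j
    have e3 := crossF j i
    rw [cartan_of_not_adj hne hij, zpow_zero, one_smul] at e2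
    rw [cartan_comm, cartan_of_not_adj hne hij, zpow_zero, one_smul] at e3
    rw [add_mul, mul_add, mul_add, add_mul, mul_add, mul_add, e1, e2, e3, h.F_comm i j hij]
    abel

end SlRels

/-! ### The standard operators on one quantum exterior algebra -/

section Column

variable {k : Type} [Field k] {n : ℕ} {q : k}

/-- The weight of the elementary tensor `x_S` for the node `i`. -/
def setWt (i : Fin (n - 1)) (S : Finset (Fin n)) : ℤ :=
  (if lo i ∈ S then 1 else 0) - (if hi i ∈ S then 1 else 0)

/-- The linear map that replaces the letter `a` by the letter `b` in the elementary tensors which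
contain `a` but not `b`, and kills all the others. -/
def moveLetter (q : k) (a b : Fin n) : Module.End k (Ext k n q) :=
  (xBasis q).constr k fun S => if a ∈ S ∧ b ∉ S then xS q (insert b (S.erase a)) else 0

theorem moveLetter_xS (a b : Fin n) (S : Finset (Fin n)) :
    moveLetter q a b (xS q S) = if a ∈ S ∧ b ∉ S then xS q (insert b (S.erase a)) else 0 := by
  rw [moveLetter, ← xBasis_apply, Module.Basis.constr_basis]

theorem ext_xS {M : Type} [AddCommGroup M] [Module k M] {f g : Ext k n q →ₗ[k] M}
    (h : ∀ S, f (xS q S) = g (xS q S)) : f = g :=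
  (xBasis q).ext fun S => by rw [xBasis_apply, h]

/-- If the sources coincide, or the targets do, then either order gives zero: the letter is already
used up, or its place already taken. Otherwise the four letters interact only if one move feeds the
other, which the hypotheses exclude. -/
theorem moveLetter_commute {a b c d : Fin n} (had : a ≠ d) (hbc : b ≠ c) :
    moveLetter q a b * moveLetter q c d = moveLetter q c d * moveLetter q a b := by
  refine ext_xS fun S => ?_
  rw [Module.End.mul_apply, Module.End.mul_apply, moveLetter_xS, moveLetter_xS]
  by_cases hac : a = c
  · subst hac
    split_ifs <;> simp [moveLetter_xS, had, hbc.symm]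
  by_cases hbd : b = d
  · subst hbd
    split_ifs <;> simp [moveLetter_xS]
  by_cases h1 : a ∈ S ∧ b ∉ S <;> by_cases h2 : c ∈ S ∧ d ∉ S
  · rw [if_pos h1, if_pos h2, moveLetter_xS, moveLetter_xS,
      if_pos (by simp [h1, had, hac, hbd]),
      if_pos (by simp [h2, hbc.symm, Ne.symm hac, Ne.symm hbd])]
    congr 1
    ext x
    simp only [Finset.mem_insert, Finset.mem_erase]
    grind
  · rw [if_pos h1, if_neg h2, map_zero, moveLetter_xS, if_neg]
    simpa [hbc.symm, had.symm, Ne.symm hac, Ne.symm hbd] using h2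
  · rw [if_neg h1, if_pos h2, map_zero, moveLetter_xS, if_neg]
    simpa [had, hbc, hac, hbd] using h1
  · rw [if_neg h1, if_neg h2, map_zero, map_zero]

theorem moveLetter_sq {a b : Fin n} (hab : a ≠ b) :
    moveLetter q a b * moveLetter q a b = 0 := by
  refine ext_xS fun S => ?_
  rw [Module.End.mul_apply, moveLetter_xS]
  split_ifs with h
  · rw [moveLetter_xS, if_neg (by simp [hab])]
    rfl
  · simp

/-- After the first move `a` is absent and `b` is present. The middle move would have to both vacate
`b` and restore `a` for the last one to be possible. -/
theorem moveLetter_mul_mul {a b c d : Fin n} (hab : a ≠ b) (h : b ≠ c ∨ a ≠ d) :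
    moveLetter q a b * moveLetter q c d * moveLetter q a b = 0 := by
  refine ext_xS fun S => ?_
  rw [Module.End.mul_apply, Module.End.mul_apply, moveLetter_xS]
  split_ifs with h1
  · rw [moveLetter_xS]
    split_ifs with h2
    · rw [moveLetter_xS, if_neg]
      · rfl
      · rcases h with h | h <;> simp [hab, h]
    · simp
  · simp

/-- `opK` is multiplicative, so the scalar is the product of those of the letters. If both `lo i`
and `hi i` occur, `q` and `q⁻¹` cancel. -/
theorem opK_xS (i : Fin (n - 1)) (S : Finset (Fin n)) (hq : q ≠ 0) :
    opK i (xS q S) = (q ^ setWt i S • xS q S : Ext k n q) := by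
  induction S using Finset.induction_on_max with
  | empty => simp [xS_empty, setWt]
  | insert a S ha ih =>
    have haS : a ∉ S := fun h' => lt_irrefl _ (ha a h')
    rw [xS_insert_max q ha, map_mul, ih, opK_ex, smul_mul_smul_comm]
    congr 1
    have hne := lo_ne_hi i
    by_cases h1 : a = lo i
    · subst h1
      have : hi i ∉ S := fun h' => (ha _ h').not_gt (lo_lt_hi i)
      simp [kap, setWt, haS, this, hne.symm]
    · by_cases h2 : a = hi i
      · subst h2
        by_cases h3 : lo i ∈ S <;> simp [kap, setWt, haS, h3, h1, hne, hq]
      · simp [kap, setWt, h1, h2, Ne.symm h1, Ne.symm h2]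

theorem opKinv_xS (i : Fin (n - 1)) (S : Finset (Fin n)) (hq : q ≠ 0) :
    opKinv i (xS q S) = (q ^ (-setWt i S) • xS q S : Ext k n q) := by
  induction S using Finset.induction_on_max with
  | empty => simp [xS_empty, setWt]
  | insert a S ha ih =>
    have haS : a ∉ S := fun h' => lt_irrefl _ (ha a h')
    rw [xS_insert_max q ha, map_mul, ih, opKinv_ex, smul_mul_smul_comm]
    congr 1
    have hne := lo_ne_hi i
    by_cases h1 : a = lo i
    · subst h1
      have : hi i ∉ S := fun h' => (ha _ h').not_gt (lo_lt_hi i)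
      simp [kap, setWt, haS, this, hne.symm]
    · by_cases h2 : a = hi i
      · subst h2
        by_cases h3 : lo i ∈ S <;> simp [kap, setWt, haS, h3, h1, hne, hq]
      · simp [kap, setWt, h1, h2, Ne.symm h1, Ne.symm h2]

variable [NeZero q]

/-- No scalar appears because no letter lies between `lo i` and `hi i`: the replacement keeps the
product in decreasing order, and the `K_i` acting on the smaller letters is trivial when `lo i` is
absent. The proof peels off the largest letter, the leftmost factor, with the twisted Leibniz rule.
-/
theorem opE_eq_moveLetter (i : Fin (n - 1)) : opE i = moveLetter q (hi i) (lo i) := by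
  have hq : q ≠ 0 := NeZero.ne q
  refine ext_xS fun S => ?_
  induction S using Finset.induction_on_max with
  | empty => rw [xS_empty, opE_one, ← xS_empty q, moveLetter_xS]; simp
  | insert a S ha ih =>
    have haS : a ∉ S := fun h' => lt_irrefl _ (ha a h')
    have hne := lo_ne_hi i
    rw [xS_insert_max q ha, opE_mul, opE_ex, ih, opK_xS _ _ hq, ← xS_insert_max q ha,
      moveLetter_xS, moveLetter_xS]
    by_cases h2 : a = hi i
    · subst h2
      rw [if_pos rfl, if_neg (fun h => haS h.1), mul_zero, add_zero, mul_smul_comm, ex_mul_xS]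
      by_cases h3 : lo i ∈ S
      · simp [h3]
      -- The letters of `S` are below `hi i` and differ from `lo i`, so none exceeds `lo i` and the
      -- reordering sign-power is trivial.
      · have h4 : S.filter (lo i < ·) = ∅ := Finset.filter_eq_empty_iff.2 fun s hs =>
          (lt_lo_of_lt_hi (ha s hs) (fun h => h3 (h ▸ hs))).not_gt
        simp [h3, haS, hne, h4, setWt]
    · rw [if_neg h2, zero_mul, zero_add]
      by_cases h3 : hi i ∈ S
      · have h5 : a ≠ lo i := fun h => (ha _ h3).not_gt (h ▸ lo_lt_hi i)
        by_cases h4 : lo i ∈ S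
        · simp [h4]
        · have h6 : ∀ s ∈ insert (lo i) (S.erase (hi i)), s < a := by
            intro s hs
            rcases Finset.mem_insert.1 hs with rfl | hs
            · exact (lo_lt_hi i).trans (ha _ h3)
            · exact ha s (Finset.mem_of_mem_erase hs)
          rw [if_pos ⟨h3, h4⟩, if_pos (by simp [h3, h4, h5.symm]), ← xS_insert_max q h6,
            Finset.erase_insert_of_ne h2, Finset.insert_comm]
      · simp [h3, Ne.symm h2]

/-- The argument is that for `E_i` with the coproduct of `F_i`. The scalar of `K_i⁻¹` on the largest
letter could matter only for `hi i`, and then the product contains that letter twice and vanishes.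
-/
theorem opF_eq_moveLetter (i : Fin (n - 1)) : opF i = moveLetter q (lo i) (hi i) := by
  have hq : q ≠ 0 := NeZero.ne q
  refine ext_xS fun S => ?_
  induction S using Finset.induction_on_max with
  | empty => rw [xS_empty, opF_one, ← xS_empty q, moveLetter_xS]; simp
  | insert a S ha ih =>
    have haS : a ∉ S := fun h' => lt_irrefl _ (ha a h')
    have hne := lo_ne_hi i
    rw [xS_insert_max q ha, opF_mul, opF_ex, opKinv_ex, ih, ← xS_insert_max q ha,
      moveLetter_xS, moveLetter_xS]
    by_cases h2 : a = lo i
    · subst h2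
      have h3 : hi i ∉ S := fun h' => (ha _ h').not_gt (lo_lt_hi i)
      rw [if_pos rfl, if_neg (fun h => haS h.1), mul_zero, add_zero,
        ← xS_insert_max q (fun s hs => (ha s hs).trans (lo_lt_hi i)),
        if_pos (by simp [h3, hne.symm]), Finset.erase_insert haS]
    · rw [if_neg h2, zero_mul, zero_add]
      by_cases h3 : lo i ∈ S
      · by_cases h4 : hi i ∈ S
        · simp [h4]
        · rw [if_pos ⟨h3, h4⟩]
          by_cases h5 : a = hi i
          · subst h5
            rw [if_neg (by simp), smul_mul_assoc, ex_mul_xS, if_pos (by simp), smul_zero]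
          · have h6 : ∀ s ∈ insert (hi i) (S.erase (lo i)), s < a := by
              intro s hs
              rcases Finset.mem_insert.1 hs with rfl | hs
              · exact hi_lt_of_lo_lt (ha _ h3) h5
              · exact ha s (Finset.mem_of_mem_erase hs)
            rw [if_pos (by simp [h3, h4, Ne.symm h5]), kap, if_neg h2, if_neg h5, inv_one,
              one_smul, ← xS_insert_max q h6, Finset.erase_insert_of_ne h2, Finset.insert_comm]
      · simp [h3, Ne.symm h2]

theorem opE_xS (i : Fin (n - 1)) (S : Finset (Fin n)) : opE i (xS q S) =
    if hi i ∈ S ∧ lo i ∉ S then xS q (insert (lo i) (S.erase (hi i))) else 0 := by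
  rw [opE_eq_moveLetter, moveLetter_xS]

theorem opF_xS (i : Fin (n - 1)) (S : Finset (Fin n)) : opF i (xS q S) =
    if lo i ∈ S ∧ hi i ∉ S then xS q (insert (hi i) (S.erase (lo i))) else 0 := by
  rw [opF_eq_moveLetter, moveLetter_xS]

theorem setWt_insert_erase {a b : Fin n} (i : Fin (n - 1)) {S : Finset (Fin n)} (ha : a ∈ S)
    (hb : b ∉ S) : setWt i (insert b (S.erase a)) = setWt i S
      + ((if lo i = b then 1 else 0) - (if lo i = a then 1 else 0))
      - ((if hi i = b then 1 else 0) - (if hi i = a then 1 else 0)) := by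
  have key : ∀ x, (if x ∈ insert b (S.erase a) then 1 else 0 : ℤ) = (if x ∈ S then 1 else 0)
      + ((if x = b then 1 else 0) - (if x = a then 1 else 0)) := by
    intro x
    simp only [Finset.mem_insert, Finset.mem_erase]
    grind
  rw [setWt, setWt, key, key]
  ring

/-- This is the inner product of the roots `ε_(lo i) - ε_(hi i)` and `ε_(lo j) - ε_(hi j)`. In this
form it matches the change of `setWt` under the replacement of a letter. -/
theorem cartan_eq (i j : Fin (n - 1)) : cartan i j =
    ((if lo i = lo j then 1 else 0) - (if lo i = hi j then 1 else 0))
      - ((if hi i = lo j then 1 else 0) - (if hi i = hi j then 1 else 0)) := by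
  simp only [cartan, Adj, lo, hi, Fin.ext_iff]
  split_ifs <;> omega

theorem setWt_raise (i j : Fin (n - 1)) {S : Finset (Fin n)} (h1 : hi j ∈ S) (h2 : lo j ∉ S) :
    setWt i (insert (lo j) (S.erase (hi j))) = setWt i S + cartan i j := by
  rw [setWt_insert_erase i h1 h2, cartan_eq]
  ring

theorem setWt_lower (i j : Fin (n - 1)) {S : Finset (Fin n)} (h1 : lo j ∈ S) (h2 : hi j ∉ S) :
    setWt i (insert (hi j) (S.erase (lo j))) = setWt i S - cartan i j := by
  rw [setWt_insert_erase i h1 h2, cartan_eq]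
  ring

theorem lo_injective : Function.Injective (lo (n := n)) := by
  intro i j h
  simpa [lo, Fin.ext_iff] using h

theorem hi_injective : Function.Injective (hi (n := n)) := by
  intro i j h
  simpa [hi, Fin.ext_iff] using h

theorem hi_ne_lo_of_not_adj {i j : Fin (n - 1)} (h : ¬ Adj i j) : hi i ≠ lo j := by
  intro h'
  exact h (Or.inl (by simpa [hi, lo, Fin.ext_iff] using h'))

/-- Weights of elementary tensors are only -1, 0 and 1, and there the quantum integer equals the
weight. If exactly one of the two letters is present, one composite vanishes and the other restores
`S`; otherwise both vanish. -/
theorem opE_mul_opF_sub (hq2 : q - q⁻¹ ≠ 0) (i : Fin (n - 1)) (S : Finset (Fin n)) :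
    opE i (opF i (xS q S)) - opF i (opE i (xS q S)) =
      ((q - q⁻¹)⁻¹ * (q ^ setWt i S - q ^ (-setWt i S))) • (xS q S : Ext k n q) := by
  have hne := lo_ne_hi i
  rw [opE_xS, opF_xS]
  by_cases h1 : lo i ∈ S <;> by_cases h2 : hi i ∈ S
  · simp [h1, h2, setWt]
  · rw [if_pos ⟨h1, h2⟩, if_neg (by simp [h2]), map_zero, sub_zero, opE_xS,
      if_pos (by simp [hne]), Finset.erase_insert (by simp [h2]), Finset.insert_erase h1]
    simp [setWt, h1, h2, hq2]
  · rw [if_neg (by simp [h1]), if_pos ⟨h2, h1⟩, map_zero, zero_sub, opF_xS,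
      if_pos (by simp [hne.symm]), Finset.erase_insert (by simp [h1]), Finset.insert_erase h2]
    have : (q - q⁻¹)⁻¹ * (q⁻¹ - q) = -1 := by
      rw [← neg_sub q, mul_neg, inv_mul_cancel₀ hq2]
    simp [setWt, h1, h2, this]
  · simp [h1, h2, setWt]

/-- The standard operators on the quantum exterior algebra satisfy the relations of `U_q(sl_n)`. -/
theorem slRels_column (hq2 : q - q⁻¹ ≠ 0) : SlRels (A := Module.End k (Ext k n q)) q opE opF
    (fun i => (opK i).toLinearMap) (fun i => (opKinv i).toLinearMap) := by
  have hq : q ≠ 0 := NeZero.ne q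
  constructor
  · intro i j
    refine ext_xS fun S => ?_
    simp only [Module.End.mul_apply, AlgHom.toLinearMap_apply, opK_xS _ _ hq, map_smul, smul_smul,
      mul_comm]
  · intro i
    refine ext_xS fun S => ?_
    simp only [Module.End.mul_apply, AlgHom.toLinearMap_apply, opK_xS _ _ hq, opKinv_xS _ _ hq,
      map_smul, smul_smul, ← zpow_add₀ hq, neg_add_cancel, zpow_zero, one_smul, Module.End.one_apply]
  · intro i
    refine ext_xS fun S => ?_
    simp only [Module.End.mul_apply, AlgHom.toLinearMap_apply, opK_xS _ _ hq, opKinv_xS _ _ hq,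
      map_smul, smul_smul, ← zpow_add₀ hq, add_neg_cancel, zpow_zero, one_smul, Module.End.one_apply]
  · intro i
    refine ext_xS fun S => ?_
    rw [LinearMap.sub_apply, Module.End.mul_apply, Module.End.mul_apply, opE_mul_opF_sub hq2,
      LinearMap.smul_apply, LinearMap.sub_apply, AlgHom.toLinearMap_apply,
      AlgHom.toLinearMap_apply, opK_xS _ _ hq, opKinv_xS _ _ hq, ← sub_smul, smul_smul]
  · intro i j hij
    rw [opE_eq_moveLetter, opF_eq_moveLetter]
    exact moveLetter_commute (hi_injective.ne hij) (lo_injective.ne hij)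
  · intro i j
    refine ext_xS fun S => ?_
    rw [LinearMap.smul_apply, Module.End.mul_apply, Module.End.mul_apply,
      AlgHom.toLinearMap_apply, AlgHom.toLinearMap_apply, opK_xS _ _ hq, map_smul, opE_xS]
    split_ifs with h
    · rw [opK_xS _ _ hq, setWt_raise i j h.1 h.2, smul_smul, ← zpow_add₀ hq, add_comm]
    · simp
  · intro i j
    refine ext_xS fun S => ?_
    rw [LinearMap.smul_apply, Module.End.mul_apply, Module.End.mul_apply,
      AlgHom.toLinearMap_apply, AlgHom.toLinearMap_apply, opK_xS _ _ hq, map_smul, opF_xS]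
    split_ifs with h
    · rw [opK_xS _ _ hq, setWt_lower i j h.1 h.2, smul_smul, ← zpow_add₀ hq, neg_add_eq_sub]
    · simp
  · intro i j hij
    have hne : i ≠ j := fun h => not_adj_self i (by rwa [← h] at hij)
    -- The Serre relation is degenerate here: each monomial vanishes on its own. The middle one
    -- could survive only if `j` were both the predecessor and the successor of `i`.
    rw [opE_eq_moveLetter, opE_eq_moveLetter, pow_two, moveLetter_sq (lo_ne_hi i).symm,
      moveLetter_mul_mul (lo_ne_hi i).symm]
    · simp
    · by_contra! h
      simp only [lo, hi, Fin.ext_iff] at h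
      omega
  · intro i j hij
    rw [opF_eq_moveLetter, opF_eq_moveLetter, pow_two, moveLetter_sq (lo_ne_hi i),
      moveLetter_mul_mul (lo_ne_hi i)]
    · simp
    · by_contra! h
      simp only [lo, hi, Fin.ext_iff] at h
      omega
  · intro i j hij
    rw [opE_eq_moveLetter, opE_eq_moveLetter]
    exact moveLetter_commute (hi_ne_lo_of_not_adj hij)
      (hi_ne_lo_of_not_adj (fun h => hij h.symm)).symm
  · intro i j hij
    rw [opF_eq_moveLetter, opF_eq_moveLetter]
    exact moveLetter_commute (hi_ne_lo_of_not_adj (fun h => hij h.symm)).symm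
      (hi_ne_lo_of_not_adj hij)

end Column

/-! ### The standard operators on the tensor power -/

theorem v_ne_zero : v ≠ 0 := NeZero.ne v

/-- `v` is not a root of unity, as the degree of a power of the indeterminate shows. Hence the
eigenvalues of the `K_i` separate weights. -/
theorem v_zpow_injective : Function.Injective fun a : ℤ => v ^ a := by
  have key : ∀ n : ℕ, v ^ n = 1 → n = 0 := by
    intro n hn
    by_contra h0
    have h1 : algebraMap (Polynomial ℂ) Kv (Polynomial.X ^ n) = algebraMap (Polynomial ℂ) Kv 1 := by
      rw [map_pow, RatFunc.algebraMap_X, map_one]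
      exact hn
    have h2 := congrArg Polynomial.natDegree (RatFunc.algebraMap_injective ℂ h1)
    rw [Polynomial.natDegree_X_pow, Polynomial.natDegree_one] at h2
    exact h0 h2
  intro a b (hab : v ^ a = v ^ b)
  have h1 : v ^ (a - b) = 1 := by
    rw [zpow_sub₀ v_ne_zero, hab, div_self (zpow_ne_zero _ v_ne_zero)]
  have h2 : v ^ (a - b).natAbs = 1 := by
    rcases Int.natAbs_eq (a - b) with h | h
    · rw [h, zpow_natCast] at h1
      exact h1
    · rw [h, zpow_neg, inv_eq_one, zpow_natCast] at h1
      exact h1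
  have := key _ h2
  omega

theorem v_sub_inv_ne_zero : v - v⁻¹ ≠ 0 := by
  intro h
  have h1 : v ^ (1 : ℤ) = v ^ (-1 : ℤ) := by
    rw [zpow_one, zpow_neg_one]
    exact sub_eq_zero.1 h
  have := v_zpow_injective h1
  omega

theorem SlRels.map {k A B : Type} [Field k] [Ring A] [Algebra k A] [Ring B] [Algebra k B] {n : ℕ}
    {q : k} {E F K L : Fin (n - 1) → A} (h : SlRels q E F K L) (φ : A →ₐ[k] B) :
    SlRels q (fun i => φ (E i)) (fun i => φ (F i)) (fun i => φ (K i)) (fun i => φ (L i)) := by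
  constructor
  · intro i j; rw [← map_mul, h.K_comm, map_mul]
  · intro i; rw [← map_mul, h.K_L, map_one]
  · intro i; rw [← map_mul, h.L_K, map_one]
  · intro i; rw [← map_mul, ← map_mul, ← map_sub, h.E_F_self, map_smul, map_sub]
  · intro i j hij; rw [← map_mul, h.E_F_ne i j hij, map_mul]
  · intro i j; rw [← map_mul, h.K_E, map_smul, map_mul]
  · intro i j; rw [← map_mul, h.K_F, map_smul, map_mul]
  · intro i j hij
    have := congrArg φ (h.E_serre i j hij)
    simpa only [map_add, map_sub, map_mul, map_smul, map_pow, map_zero] using this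
  · intro i j hij
    have := congrArg φ (h.F_serre i j hij)
    simpa only [map_add, map_sub, map_mul, map_smul, map_pow, map_zero] using this
  · intro i j hij; rw [← map_mul, h.E_comm i j hij, map_mul]
  · intro i j hij; rw [← map_mul, h.F_comm i j hij, map_mul]

/-! ### Operators on single tensor factors and the iterated coproduct -/

section Site

variable {k A : Type} [Field k] [AddCommGroup A] [Module k A] {N : ℕ}

/-- An endomorphism acting on the factor of index `c` of a tensor power. -/
def siteMap (c : Fin N) (f : Module.End k A) : Module.End k (⨂[k] _ : Fin N, A) :=
  PiTensorProduct.map (Function.update (fun _ => (1 : Module.End k A)) c f)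

theorem siteMap_add (c : Fin N) (f g : Module.End k A) :
    siteMap c (f + g) = siteMap c f + siteMap c g :=
  PiTensorProduct.map_update_add (fun _ => (1 : Module.End k A)) c f g

theorem siteMap_smul (c : Fin N) (r : k) (f : Module.End k A) :
    siteMap c (r • f) = r • siteMap c f :=
  PiTensorProduct.map_update_smul (fun _ => (1 : Module.End k A)) c r f

theorem siteMap_one (c : Fin N) : siteMap c (1 : Module.End k A) = 1 := by
  rw [siteMap, Function.update_eq_self c (fun _ => (1 : Module.End k A)), PiTensorProduct.map_one]

theorem siteMap_mul (c : Fin N) (f g : Module.End k A) :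
    siteMap c (f * g) = siteMap c f * siteMap c g := by
  rw [siteMap, siteMap, siteMap, ← PiTensorProduct.map_mul]
  congr 1
  funext j
  by_cases h : j = c
  · subst h; simp
  · simp [h]

/-- The algebra homomorphism that lets endomorphisms act on the factor of index `c` of a tensor
power. -/
def siteHom (c : Fin N) : Module.End k A →ₐ[k] Module.End k (⨂[k] _ : Fin N, A) :=
  AlgHom.ofLinearMap
    { toFun := siteMap c
      map_add' := siteMap_add c
      map_smul' := siteMap_smul c } (siteMap_one c) (siteMap_mul c)

theorem siteHom_apply (c : Fin N) (f : Module.End k A) : siteHom c f =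
    PiTensorProduct.map (Function.update (fun _ => (1 : Module.End k A)) c f) := rfl

theorem siteHom_commute (c : Fin N) (f : Module.End k A) {g : Fin N → Module.End k A}
    (hg : g c = 1) : Commute (siteHom c f) (PiTensorProduct.map g) := by
  rw [Commute, SemiconjBy, siteHom_apply, ← PiTensorProduct.map_mul, ← PiTensorProduct.map_mul]
  congr 1
  funext j
  by_cases h : j = c
  · subst h; simp [hg]
  · simp [h]

/-- The operator `f` on all the factors with index in `s`. -/
def groupLike (f : Module.End k A) (s : Finset (Fin N)) : Module.End k (⨂[k] _ : Fin N, A) :=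
  PiTensorProduct.map fun c => if c ∈ s then f else 1

/-- The sum over `c ∈ s` of the operators given by `f` on the factor of index `c` and by `g` on the
factors with index in `s` which are in relation `r` with `c`. -/
def skewPrim (r : Fin N → Fin N → Prop) [DecidableRel r] (f g : Module.End k A)
    (s : Finset (Fin N)) : Module.End k (⨂[k] _ : Fin N, A) :=
  ∑ c ∈ s, PiTensorProduct.map fun c' =>
    if c' ∈ s ∧ r c c' then g else if c' = c then f else 1

theorem groupLike_insert (f : Module.End k A) {a : Fin N} {s : Finset (Fin N)} (ha : a ∉ s) :
    groupLike f (insert a s) = siteHom a f * groupLike f s := by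
  rw [groupLike, groupLike, siteHom_apply, ← PiTensorProduct.map_mul]
  congr 1
  funext j
  by_cases h : j = a
  · subst h; simp [ha]
  · simp [h]

theorem siteHom_commute_groupLike (f g : Module.End k A) {a : Fin N} {s : Finset (Fin N)}
    (ha : a ∉ s) : Commute (siteHom a f) (groupLike g s) :=
  siteHom_commute a f (by simp [ha])

theorem siteHom_commute_skewPrim (r : Fin N → Fin N → Prop) [DecidableRel r]
    (f g h : Module.End k A) {a : Fin N} {s : Finset (Fin N)}
    (ha : a ∉ s) : Commute (siteHom a f) (skewPrim r g h s) := by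
  refine Commute.sum_right _ _ _ fun c hc => siteHom_commute a f ?_
  have : a ≠ c := fun h => ha (h ▸ hc)
  simp [ha, this]

/-- Factors are written with the largest index leftmost, so the new maximal index `a` is the left
factor in `Δ(E) = E ⊗ K + 1 ⊗ E` and the factors in `s` together are the right one. -/
theorem skewPrim_gt_insert (f g : Module.End k A) {a : Fin N} {s : Finset (Fin N)}
    (ha : ∀ c ∈ s, c < a) : skewPrim (· > ·) f g (insert a s) =
      siteHom a f * groupLike g s + skewPrim (· > ·) f g s := by
  have has : a ∉ s := fun h => lt_irrefl _ (ha a h)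
  rw [skewPrim, Finset.sum_insert has, groupLike, siteHom_apply, ← PiTensorProduct.map_mul]
  congr 1
  · congr 1
    funext j
    by_cases h : j = a
    · subst h; simp [has]
    · by_cases hs : j ∈ s
      · simp [h, hs, ha j hs]
      · simp [h, hs]
  · refine Finset.sum_congr rfl fun c hc => ?_
    congr 1
    funext j
    by_cases h : j = a
    · subst h; simp [has, (ha c hc).not_gt]
    · simp [h]

/-- This is the shape of `Δ(F) = F ⊗ 1 + K⁻¹ ⊗ F`, again with the maximal index as left factor. -/
theorem skewPrim_lt_insert (f g : Module.End k A) {a : Fin N} {s : Finset (Fin N)}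
    (ha : ∀ c ∈ s, c < a) : skewPrim (· < ·) f g (insert a s) =
      siteHom a f + siteHom a g * skewPrim (· < ·) f g s := by
  have has : a ∉ s := fun h => lt_irrefl _ (ha a h)
  rw [skewPrim, Finset.sum_insert has, siteHom_apply, siteHom_apply, skewPrim, Finset.mul_sum]
  congr 1
  · congr 1
    funext j
    by_cases h : j = a
    · subst h; simp
    · by_cases hs : j ∈ s
      · simp [h, (ha j hs).not_gt]
      · simp [h, hs]
  · refine Finset.sum_congr rfl fun c hc => ?_
    rw [← PiTensorProduct.map_mul]
    congr 1
    funext j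
    by_cases h : j = a
    · subst h; simp [has, ha c hc, (ha c hc).ne']
    · simp [h]

/-- The iterated coproduct preserves the relations of `U_q(sl_n)`. -/
theorem SlRels.tensorPower {n : ℕ} {q : k} (hq : q ≠ 0) {E F K L : Fin (n - 1) → Module.End k A}
    (h : SlRels q E F K L) (s : Finset (Fin N)) :
    SlRels q (fun i => skewPrim (· > ·) (E i) (K i) s) (fun i => skewPrim (· < ·) (F i) (L i) s)
      (fun i => groupLike (K i) s) (fun i => groupLike (L i) s) := by
  induction s using Finset.induction_on_max with
  -- The empty tensor power is the trivial representation: `E` and `F` act by 0, `K` and `L` by 1.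
  | empty =>
    have h1 : ∀ f : Module.End k A, groupLike f (∅ : Finset (Fin N)) = 1 := fun f => by
      simp [groupLike, PiTensorProduct.map_one]
    have h2 : ∀ (r : Fin N → Fin N → Prop) [DecidableRel r] (f g : Module.End k A),
      skewPrim r f g (∅ : Finset (Fin N)) = 0 := fun r _ f g => by simp [skewPrim]
    constructor <;> simp [h1, h2]
  | insert a s ha ih =>
    have has : a ∉ s := fun h => lt_irrefl _ (ha a h)
    simp only [skewPrim_gt_insert _ _ ha, skewPrim_lt_insert _ _ ha, groupLike_insert _ has]
    -- The new factor and the old ones act on disjoint sets of sites, so all the commutation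
    -- hypotheses of `coprod` hold.
    refine (h.map (siteHom a)).coprod ih hq ?_ ?_ ?_ ?_ ?_ ?_ ?_ ?_ ?_ <;> intro i j
    all_goals first
      | exact siteHom_commute_groupLike _ _ has
      | exact siteHom_commute_skewPrim _ _ _ _ has

end Site

/-! ### The relations on the full tensor power -/

section TensorPower

variable {m N : ℕ}

/-- The inverse of `K_i` on the tensor power. -/
def tensKinv (i : Fin (m - 1)) : TPow Kv m v N →ₗ[Kv] TPow Kv m v N :=
  PiTensorProduct.map fun _ => (opKinv i).toLinearMap

theorem slRels_tens : SlRels (A := Module.End Kv (TPow Kv m v N)) v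
    tensE tensF tensK tensKinv := by
  have h := (slRels_column (k := Kv) (n := m) v_sub_inv_ne_zero).tensorPower v_ne_zero
    (Finset.univ : Finset (Fin N))
  have h1 : ∀ i : Fin (m - 1), tensE i = skewPrim (k := Kv) (· > ·) (opE i)
      (opK i).toLinearMap (Finset.univ : Finset (Fin N)) := by
    intro i
    simp only [skewPrim, Finset.mem_univ, true_and]
    rfl
  have h2 : ∀ i : Fin (m - 1), tensF i = skewPrim (k := Kv) (· < ·) (opF i)
      (opKinv i).toLinearMap (Finset.univ : Finset (Fin N)) := by
    intro i
    simp only [skewPrim, Finset.mem_univ, true_and]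
    rfl
  have h3 : ∀ i : Fin (m - 1), tensK i = groupLike (k := Kv)
      (opK i).toLinearMap (Finset.univ : Finset (Fin N)) := by
    intro i
    simp only [groupLike, Finset.mem_univ, if_true]
    rfl
  have h4 : ∀ i : Fin (m - 1), tensKinv i = groupLike (k := Kv)
      (opKinv i).toLinearMap (Finset.univ : Finset (Fin N)) := by
    intro i
    simp only [groupLike, Finset.mem_univ, if_true]
    rfl
  simpa only [← h1, ← h2, ← h3, ← h4] using h

end TensorPower

/-! ### Coordinates of the tensor power -/

section Coordinates

variable {k : Type} [Field k] {n m : ℕ} (q : k)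

/-- The tensor product of elementary tensors. -/
def tensXS (P : Fin m → Finset (Fin n)) : TPow k n q m :=
  PiTensorProduct.tprod k fun j => xS q (P j)

/-- The basis of the tensor power which consists of the tensor products of elementary tensors. -/
def tensBasis : Module.Basis (Fin m → Finset (Fin n)) k (TPow k n q m) :=
  Basis.piTensorProduct fun _ => xBasis q

theorem tensBasis_apply (P : Fin m → Finset (Fin n)) : tensBasis q P = tensXS q P := by
  rw [tensBasis, Basis.piTensorProduct_apply, tensXS]
  simp only [xBasis_apply]

variable {q}

theorem ext_tensXS {M : Type} [AddCommGroup M] [Module k M] {f g : TPow k n q m →ₗ[k] M}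
    (h : ∀ P, f (tensXS q P) = g (tensXS q P)) : f = g :=
  (tensBasis q).ext fun P => by rw [tensBasis_apply, h]

/-- Multilinearity allows the factors to be expanded in elementary tensors one at a time. -/
theorem extTensor_eq_span (d : Fin m → ℕ) : extTensor q d =
    Submodule.span k {y | ∃ P : Fin m → Finset (Fin n), (∀ j, (P j).card = d j) ∧
      y = tensXS q P} := by
  refine le_antisymm (Submodule.span_le.2 ?_) (Submodule.span_mono ?_)
  · rintro _ ⟨z, hz, rfl⟩
    -- The set `s` contains the positions whose factor need not yet be elementary; the induction
    -- empties it.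
    suffices H : ∀ s : Finset (Fin m), ∀ z : Fin m → Ext k n q, (∀ j, z j ∈ extDeg q (d j)) →
        (∀ j ∉ s, ∃ S : Finset (Fin n), S.card = d j ∧ z j = xS q S) →
        PiTensorProduct.tprod k z ∈ Submodule.span k {y | ∃ P : Fin m → Finset (Fin n),
          (∀ j, (P j).card = d j) ∧ y = tensXS q P} from
      H Finset.univ z hz fun j hj => absurd (Finset.mem_univ j) hj
    intro s
    induction s using Finset.induction_on with
    | empty =>
      intro z _ hz
      choose P hP using fun j => hz j (Finset.notMem_empty j)
      refine Submodule.subset_span ⟨P, fun j => (hP j).1, ?_⟩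
      rw [tensXS]
      congr 1
      funext j
      exact (hP j).2
    | insert a s ha ih =>
      intro z hz hs
      have key : ∀ y ∈ extDeg q (d a), PiTensorProduct.tprod k (Function.update z a y) ∈
          Submodule.span k {y | ∃ P : Fin m → Finset (Fin n),
            (∀ j, (P j).card = d j) ∧ y = tensXS q P} := by
        intro y hy
        induction hy using Submodule.span_induction with
        | mem y hy =>
          obtain ⟨S, hS, rfl⟩ := hy
          refine ih _ ?_ ?_
          · intro j
            by_cases hj : j = a
            · subst hj
              rw [Function.update_self]
              exact Submodule.subset_span ⟨S, hS, rfl⟩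
            · rw [Function.update_of_ne hj]
              exact hz j
          · intro j hj
            by_cases hja : j = a
            · subst hja
              exact ⟨S, hS, by rw [Function.update_self]⟩
            · rw [Function.update_of_ne hja]
              exact hs j (by simp [hj, hja])
        | zero =>
          rw [MultilinearMap.map_update_zero]
          exact Submodule.zero_mem _
        | add x y _ _ hx hy =>
          rw [MultilinearMap.map_update_add]
          exact Submodule.add_mem _ hx hy
        | smul c x _ hx =>
          rw [MultilinearMap.map_update_smul]
          exact Submodule.smul_mem _ c hx
      have := key (z a) (hz a)
      rwa [Function.update_eq_self] at this
  · rintro _ ⟨P, hP, rfl⟩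
    exact ⟨_, fun j => Submodule.subset_span ⟨P j, hP j, rfl⟩, rfl⟩

end Coordinates

theorem prod_v_zpow {ι : Type} (s : Finset ι) (f : ι → ℤ) :
    ∏ c ∈ s, v ^ f c = v ^ ∑ c ∈ s, f c := by
  classical
  induction s using Finset.induction_on with
  | empty => simp
  | insert a s ha ih => rw [Finset.prod_insert ha, Finset.sum_insert ha, ih, zpow_add₀ v_ne_zero]

/-! ### Matrix coefficients, weights and the standard representation -/

section TensorPower

variable {m N : ℕ}

/-- The weight of a tensor product of elementary tensors. -/
def tensWt (P : Fin N → Finset (Fin m)) : Wt m := fun i => ∑ c, setWt i (P c)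

theorem tensK_tensXS (i : Fin (m - 1)) (P : Fin N → Finset (Fin m)) :
    tensK i (tensXS v P) = v ^ tensWt P i • tensXS v P := by
  rw [tensK, tensXS, PiTensorProduct.map_tprod]
  simp only [AlgHom.toLinearMap_apply, opK_xS _ _ v_ne_zero]
  rw [MultilinearMap.map_smul_univ, prod_v_zpow, tensWt]

theorem tensKinv_tensXS (i : Fin (m - 1)) (P : Fin N → Finset (Fin m)) :
    tensKinv i (tensXS v P) = v ^ (-tensWt P i) • tensXS v P := by
  rw [tensKinv, tensXS, PiTensorProduct.map_tprod]
  simp only [AlgHom.toLinearMap_apply, opKinv_xS _ _ v_ne_zero]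
  rw [MultilinearMap.map_smul_univ, prod_v_zpow, Finset.sum_neg_distrib, tensWt]

/-- Replace the letter `a` by the letter `b` in the factor of index `c`. -/
def changeAt (a b : Fin m) (c : Fin N) (P : Fin N → Finset (Fin m)) : Fin N → Finset (Fin m) :=
  Function.update P c (insert b ((P c).erase a))

/-- The exponent collects the scalars of `K_i` on the factors right of the active one, those of
smaller index. Only columns where the letter can move contribute, since a single zero factor kills
the tensor. -/
theorem tensE_tensXS (i : Fin (m - 1)) (P : Fin N → Finset (Fin m)) :
    tensE i (tensXS v P) = ∑ c with hi i ∈ P c ∧ lo i ∉ P c,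
      v ^ (∑ c' with c' < c, setWt i (P c')) • tensXS v (changeAt (hi i) (lo i) c P) := by
  rw [tensE, LinearMap.sum_apply, Finset.sum_filter]
  refine Finset.sum_congr rfl fun c _ => ?_
  rw [tensXS, PiTensorProduct.map_tprod]
  split_ifs with h
  · rw [Finset.sum_filter, ← prod_v_zpow, tensXS, ← MultilinearMap.map_smul_univ]
    congr 1
    funext c'
    by_cases h1 : c' < c
    · simp [h1, h1.ne, changeAt, opK_xS _ _ v_ne_zero]
    · by_cases h2 : c' = c
      · subst h2
        simp [changeAt, opE_xS, h]
      · simp [h1, h2, changeAt]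
  · refine MultilinearMap.map_coord_zero _ c ?_
    simp [opE_xS, h]

theorem tensF_tensXS (i : Fin (m - 1)) (P : Fin N → Finset (Fin m)) :
    tensF i (tensXS v P) = ∑ c with lo i ∈ P c ∧ hi i ∉ P c,
      v ^ (-∑ c' with c < c', setWt i (P c')) • tensXS v (changeAt (lo i) (hi i) c P) := by
  rw [tensF, LinearMap.sum_apply, Finset.sum_filter]
  refine Finset.sum_congr rfl fun c _ => ?_
  rw [tensXS, PiTensorProduct.map_tprod]
  split_ifs with h
  · rw [← Finset.sum_neg_distrib, Finset.sum_filter, ← prod_v_zpow, tensXS,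
      ← MultilinearMap.map_smul_univ]
    congr 1
    funext c'
    by_cases h1 : c < c'
    · simp [h1, h1.ne', changeAt, opKinv_xS _ _ v_ne_zero]
    · by_cases h2 : c' = c
      · subst h2
        simp [changeAt, opF_xS, h]
      · simp [h1, h2, changeAt]
  · refine MultilinearMap.map_coord_zero _ c ?_
    simp [opF_xS, h]

/-- The weight is a sum over the columns and only column `c` is altered. -/
theorem tensWt_changeAt {a b : Fin m} {c : Fin N} {P : Fin N → Finset (Fin m)} {d : Wt m}
    (h : ∀ i, setWt i (insert b ((P c).erase a)) = setWt i (P c) + d i) :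
    tensWt (changeAt a b c P) = tensWt P + d := by
  funext i
  rw [Pi.add_apply, tensWt, tensWt, ← Finset.add_sum_erase _ _ (Finset.mem_univ c),
    ← Finset.add_sum_erase _ (fun c => setWt i (P c)) (Finset.mem_univ c), changeAt,
    Function.update_self, h]
  have : ∀ x ∈ Finset.univ.erase c,
      setWt i (Function.update P c (insert b ((P c).erase a)) x) = setWt i (P x) := by
    intro x hx
    rw [Function.update_of_ne (Finset.ne_of_mem_erase hx)]
  rw [Finset.sum_congr rfl this]
  ring

theorem tensWt_raise {i : Fin (m - 1)} {c : Fin N} {P : Fin N → Finset (Fin m)}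
    (h : hi i ∈ P c ∧ lo i ∉ P c) :
    tensWt (changeAt (hi i) (lo i) c P) = tensWt P + root i :=
  tensWt_changeAt fun j => by rw [setWt_raise j i h.1 h.2, root, cartan_comm]

theorem tensWt_lower {i : Fin (m - 1)} {c : Fin N} {P : Fin N → Finset (Fin m)}
    (h : lo i ∈ P c ∧ hi i ∉ P c) :
    tensWt (changeAt (lo i) (hi i) c P) = tensWt P - root i := by
  rw [sub_eq_add_neg]
  exact tensWt_changeAt fun j => by
    rw [setWt_lower j i h.1 h.2, Pi.neg_apply, root, cartan_comm, sub_eq_add_neg]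

/-- The projection of the tensor power onto the weight space of weight `lam`. -/
def wtProj (lam : Wt m) : Module.End Kv (TPow Kv m v N) :=
  (tensBasis v).constr Kv fun P => if tensWt P = lam then tensXS v P else 0

theorem wtProj_tensXS (lam : Wt m) (P : Fin N → Finset (Fin m)) :
    wtProj lam (tensXS v P) = if tensWt P = lam then tensXS v P else 0 := by
  rw [wtProj, ← tensBasis_apply, Module.Basis.constr_basis, tensBasis_apply]

/-- Each basis tensor in the image has its weight shifted by the same root, so the projections
commute with `E_i` up to that shift. -/
theorem tensE_mul_wtProj (i : Fin (m - 1)) (lam : Wt m) :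
    (tensE i : Module.End Kv (TPow Kv m v N)) * wtProj lam = wtProj (lam + root i) * tensE i := by
  refine ext_tensXS fun P => ?_
  rw [Module.End.mul_apply, Module.End.mul_apply, wtProj_tensXS, tensE_tensXS, map_sum]
  have h : ∀ c ∈ Finset.univ.filter (fun c => hi i ∈ P c ∧ lo i ∉ P c),
      wtProj (lam + root i) (v ^ (∑ c' with c' < c, setWt i (P c')) •
        tensXS v (changeAt (hi i) (lo i) c P)) =
      if tensWt P = lam then v ^ (∑ c' with c' < c, setWt i (P c')) •
        tensXS v (changeAt (hi i) (lo i) c P) else 0 := by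
    intro c hc
    rw [map_smul, wtProj_tensXS, tensWt_raise (Finset.mem_filter.1 hc).2]
    simp only [add_left_inj]
    split_ifs <;> simp
  rw [Finset.sum_congr rfl h]
  split_ifs
  · rw [tensE_tensXS]
  · simp

theorem tensF_mul_wtProj (i : Fin (m - 1)) (lam : Wt m) :
    (tensF i : Module.End Kv (TPow Kv m v N)) * wtProj lam = wtProj (lam - root i) * tensF i := by
  refine ext_tensXS fun P => ?_
  rw [Module.End.mul_apply, Module.End.mul_apply, wtProj_tensXS, tensF_tensXS, map_sum]
  have h : ∀ c ∈ Finset.univ.filter (fun c => lo i ∈ P c ∧ hi i ∉ P c),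
      wtProj (lam - root i) (v ^ (-∑ c' with c < c', setWt i (P c')) •
        tensXS v (changeAt (lo i) (hi i) c P)) =
      if tensWt P = lam then v ^ (-∑ c' with c < c', setWt i (P c')) •
        tensXS v (changeAt (lo i) (hi i) c P) else 0 := by
    intro c hc
    rw [map_smul, wtProj_tensXS, tensWt_lower (Finset.mem_filter.1 hc).2]
    simp only [sub_left_inj]
    split_ifs <;> simp
  rw [Finset.sum_congr rfl h]
  split_ifs
  · rw [tensF_tensXS]
  · simp

/-- The standard action of `U_v(sl_m)`, with the weight space projections adjoined, on the tensor
power. -/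
def stdGen : Gen m → Module.End Kv (TPow Kv m v N)
  | .K i => tensK i
  | .Kinv i => tensKinv i
  | .E i => tensE i
  | .F i => tensF i
  | .one lam => wtProj lam

/-- The standard representation of `UAdj` on the tensor power. -/
def stdHom (N m : ℕ) : UAdj Kv m v →ₐ[Kv] Module.End Kv (TPow Kv m v N) :=
  RingQuot.liftAlgHom Kv ⟨FreeAlgebra.lift Kv stdGen, by
    have h := slRels_tens (m := m) (N := N)
    intro x y hxy
    cases hxy with
    | K_comm i j => simpa [stdGen] using h.K_comm i j
    | K_Kinv i => simpa [stdGen] using h.K_L i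
    | Kinv_K i => simpa [stdGen] using h.L_K i
    | E_F_self i => simpa [stdGen] using h.E_F_self i
    | E_F_ne i j hij => simpa [stdGen, sub_eq_zero] using h.E_F_ne i j hij
    | K_E i j => simpa [stdGen] using h.K_E i j
    | K_F i j => simpa [stdGen] using h.K_F i j
    | E_serre i j hij => simpa [stdGen] using h.E_serre i j hij
    | F_serre i j hij => simpa [stdGen] using h.F_serre i j hij
    | E_comm i j hij => simpa [stdGen] using h.E_comm i j hij
    | F_comm i j hij => simpa [stdGen] using h.F_comm i j hij
    | one_mul_one_self lam =>
      simp only [map_mul, FreeAlgebra.lift_ι_apply, stdGen]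
      refine ext_tensXS fun P => ?_
      rw [Module.End.mul_apply, wtProj_tensXS]
      split_ifs with h1
      · rw [wtProj_tensXS, if_pos h1]
      · rw [map_zero]
    | one_mul_one_ne lam mu hne =>
      simp only [map_mul, FreeAlgebra.lift_ι_apply, stdGen, map_zero]
      refine ext_tensXS fun P => ?_
      rw [Module.End.mul_apply, wtProj_tensXS]
      split_ifs with h1
      · rw [wtProj_tensXS, if_neg (fun h2 => hne (h2.symm.trans h1))]
        rfl
      · rw [map_zero]
        rfl
    | E_one i lam => simpa [stdGen] using tensE_mul_wtProj i lam
    | F_one i lam => simpa [stdGen] using tensF_mul_wtProj i lam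
    | K_one i lam =>
      simp only [map_mul, map_smul, FreeAlgebra.lift_ι_apply, stdGen]
      refine ext_tensXS fun P => ?_
      rw [Module.End.mul_apply, LinearMap.smul_apply, wtProj_tensXS]
      split_ifs with h1
      · rw [tensK_tensXS, h1]
      · rw [map_zero, smul_zero]⟩

theorem stdHom_ugen (g : Gen m) : stdHom N m (ugen Kv v g) = stdGen g := by
  unfold stdHom ugen
  erw [RingQuot.liftAlgHom_mkAlgHom_apply]
  exact FreeAlgebra.lift_ι_apply _ _

attribute [irreducible] stdHom

end TensorPower

/-! ### Generators of the idempotented algebra -/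

section Generators

variable {k : Type} [Field k] {n : ℕ} {q : k}

theorem ugen_one_mul_ne {lam mu : Wt n} (h : lam ≠ mu) :
    ugen k q (.one lam) * ugen k q (.one mu) = 0 := by
  have h := RingQuot.mkAlgHom_rel k (URel.one_mul_one_ne (k := k) (q := q) lam mu h)
  simpa [ugen] using h

theorem ugen_K_one (i : Fin (n - 1)) (lam : Wt n) :
    ugen k q (.K i) * ugen k q (.one lam) = q ^ lam i • ugen k q (.one lam) := by
  have h := RingQuot.mkAlgHom_rel k (URel.K_one (k := k) (q := q) i lam)
  simpa [ugen] using h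

theorem ugen_Kinv_one (hq : q ≠ 0) (i : Fin (n - 1)) (lam : Wt n) :
    ugen k q (.Kinv i) * ugen k q (.one lam) = q ^ (-lam i) • ugen k q (.one lam) := by
  have h : ugen k q (.Kinv i) * ugen k q (.K i) = 1 := by
    have h := RingQuot.mkAlgHom_rel k (URel.Kinv_K (k := k) (q := q) i)
    simpa [ugen] using h
  calc ugen k q (.Kinv i) * ugen k q (.one lam)
      = q ^ (-lam i) • (ugen k q (.Kinv i) * (q ^ lam i • ugen k q (.one lam))) := by
        rw [mul_smul_comm, smul_smul, ← zpow_add₀ hq, neg_add_cancel, zpow_zero, one_smul]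
    _ = q ^ (-lam i) • ugen k q (.one lam) := by
        rw [← ugen_K_one, ← mul_assoc, h, one_mul]

/-- The generators `1_lam`, `E_i 1_lam` and `F_i 1_lam` of the idempotented algebra. -/
inductive IsUdotGen : Udot k n q → Prop
  | one (lam) : IsUdotGen (uOne q lam)
  | E (i lam) : IsUdotGen (uE q i lam)
  | F (i lam) : IsUdotGen (uF q i lam)

/-- The non-unital subalgebra of `UAdj` generated by `1_lam`, `E_i 1_lam` and `F_i 1_lam`. -/
def genSub (k : Type) [Field k] (n : ℕ) (q : k) : NonUnitalSubalgebra k (UAdj k n q) :=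
  NonUnitalAlgebra.adjoin k {y | ∃ x : Udot k n q, IsUdotGen x ∧ y = x}

/-- On an idempotent, `K` and its inverse become scalars and other idempotents become 0 or 1; only
`E` and `F` give something new. -/
theorem ugen_mul_one_mem (hq : q ≠ 0) (g : Gen n) (lam : Wt n) :
    ugen k q g * ugen k q (.one lam) ∈ genSub k n q := by
  have h1 : ugen k q (.one lam) ∈ genSub k n q :=
    NonUnitalAlgebra.subset_adjoin k ⟨_, .one lam, rfl⟩
  cases g with
  | K i => rw [ugen_K_one]; exact SMulMemClass.smul_mem _ h1
  | Kinv i => rw [ugen_Kinv_one hq]; exact SMulMemClass.smul_mem _ h1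
  | E i => exact NonUnitalAlgebra.subset_adjoin k ⟨_, .E i lam, rfl⟩
  | F i => exact NonUnitalAlgebra.subset_adjoin k ⟨_, .F i lam, rfl⟩
  | one mu =>
    by_cases h : mu = lam
    · rw [h, ugen_one_mul_self]; exact h1
    · rw [ugen_one_mul_ne h]; exact zero_mem _

theorem exists_one_mul {x : Udot k n q} (hx : IsUdotGen x) :
    ∃ lam : Wt n, (ugen k q (.one lam) * (x : UAdj k n q) : UAdj k n q) = x := by
  cases hx with
  | one lam => exact ⟨lam, ugen_one_mul_self q lam⟩
  | E i lam =>
    refine ⟨lam + root i, ?_⟩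
    change ugen k q (.one (lam + root i)) * (ugen k q (.E i) * ugen k q (.one lam)) = _
    rw [← mul_assoc, ← ugen_E_one, mul_assoc, ugen_one_mul_self]
    rfl
  | F i lam =>
    refine ⟨lam - root i, ?_⟩
    change ugen k q (.one (lam - root i)) * (ugen k q (.F i) * ugen k q (.one lam)) = _
    rw [← mul_assoc, ← ugen_F_one, mul_assoc, ugen_one_mul_self]
    rfl

/-- `genSub` is a left ideal: a generator of it absorbs some `1_lam` on its left by
`exists_one_mul`, and a generator of `UAdj` times `1_lam` is in `genSub`. Hence every `1_lam x 1_mu`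
lies in `genSub`. -/
theorem mul_mem_genSub (hq : q ≠ 0) (x : UAdj k n q) : ∀ y ∈ genSub k n q, x * y ∈ genSub k n q := by
  obtain ⟨t, rfl⟩ := RingQuot.mkAlgHom_surjective k (URel k n q) x
  induction t using FreeAlgebra.induction with
  | grade0 r =>
    intro y hy
    rw [AlgHom.commutes, ← Algebra.smul_def]
    exact SMulMemClass.smul_mem _ hy
  | grade1 g =>
    intro y hy
    induction hy using NonUnitalAlgebra.adjoin_induction with
    | mem y hy =>
      obtain ⟨x, hx, rfl⟩ := hy
      obtain ⟨lam, hlam⟩ := exists_one_mul hx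
      rw [← hlam, ← mul_assoc]
      exact mul_mem (ugen_mul_one_mem hq g lam) (NonUnitalAlgebra.subset_adjoin k ⟨x, hx, rfl⟩)
    | add y z _ _ hy hz => rw [mul_add]; exact add_mem hy hz
    | zero => rw [mul_zero]; exact zero_mem _
    | mul y z _ hz' hy _ => rw [← mul_assoc]; exact mul_mem hy hz'
    | smul r y _ hy => rw [mul_smul_comm]; exact SMulMemClass.smul_mem _ hy
  | mul a b ha hb =>
    intro y hy
    rw [map_mul, mul_assoc]
    exact ha _ (hb _ hy)
  | add a b ha hb =>
    intro y hy
    rw [map_add, add_mul]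
    exact add_mem (ha _ hy) (hb _ hy)

theorem mem_genSub (hq : q ≠ 0) (x : Udot k n q) : (x : UAdj k n q) ∈ genSub k n q := by
  have hx : (x : UAdj k n q) ∈ Submodule.span k
    {y | ∃ (lam mu : Wt n) (x : UAdj k n q), y = ugen k q (.one lam) * x * ugen k q (.one mu)} := x.2
  have hle : Submodule.span k
    {y | ∃ (lam mu : Wt n) (x : UAdj k n q), y = ugen k q (.one lam) * x * ugen k q (.one mu)} ≤
      (genSub k n q).toSubmodule := by
    rw [Submodule.span_le]
    rintro _ ⟨lam, mu, x, rfl⟩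
    exact mul_mem_genSub hq _ _ (NonUnitalAlgebra.subset_adjoin k ⟨_, .one mu, rfl⟩)
  exact hle hx

/-- The idempotented algebra is generated by `1_lam`, `E_i 1_lam` and `F_i 1_lam`. -/
theorem udot_induction (hq : q ≠ 0) {p : Udot k n q → Prop} (hgen : ∀ x, IsUdotGen x → p x)
    (h0 : p 0) (hadd : ∀ x y, p x → p y → p (x + y)) (hsmul : ∀ (c : k) x, p x → p (c • x))
    (hmul : ∀ x y, p x → p y → p (x * y)) (x : Udot k n q) : p x := by
  have key : ∀ y ∈ genSub k n q, ∃ h : y ∈ Udot k n q, p ⟨y, h⟩ := by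
    intro y hy
    induction hy using NonUnitalAlgebra.adjoin_induction with
    | mem y hy =>
      obtain ⟨x, hx, rfl⟩ := hy
      exact ⟨x.2, hgen x hx⟩
    | add y z _ _ hy hz => exact ⟨add_mem hy.1 hz.1, hadd _ _ hy.2 hz.2⟩
    | zero => exact ⟨zero_mem _, h0⟩
    | mul y z _ _ hy hz => exact ⟨mul_mem hy.1 hz.1, hmul _ _ hy.2 hz.2⟩
    | smul r y _ hy => exact ⟨SMulMemClass.smul_mem r hy.1, hsmul r _ hy.2⟩
  exact (key x (mem_genSub hq x)).2

end Generators

/-! ### The ladder operators in coordinates -/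

section Ladder

variable {N : ℕ}

theorem ell_singleton_right (T : Finset (Fin N)) (c : Fin N) :
    (ell T {c} : ℤ) = ∑ c' with c' < c, if c' ∈ T then 1 else 0 := by
  have h : ell T {c} = ((Finset.univ.filter (· < c)).filter (· ∈ T)).card := by
    rw [ell, Finset.product_singleton, Finset.filter_map, Finset.card_map]
    congr 1
    ext x
    simp [and_comm]
  rw [h, Finset.card_filter]
  push_cast
  rfl

theorem ell_singleton_left (T : Finset (Fin N)) (c : Fin N) :
    (ell {c} T : ℤ) = ∑ c' with c < c', if c' ∈ T then 1 else 0 := by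
  have h : ell {c} T = ((Finset.univ.filter (c < ·)).filter (· ∈ T)).card := by
    rw [ell, Finset.singleton_product, Finset.filter_map, Finset.card_map]
    congr 1
    ext x
    simp [and_comm]
  rw [h, Finset.card_filter]
  push_cast
  rfl

/-- A subset with one element fewer is the complement of a unique point. The split of `S` into
`S.card - 1` and `1` thus becomes a sum over the element carried by the rung. -/
theorem sum_powersetCard_pred {M α : Type} [AddCommMonoid M] [DecidableEq α] {S : Finset α}
    (hS : S.card ≠ 0) (f : Finset α → M) :
    ∑ T ∈ S.powersetCard (S.card - 1), f T = ∑ c ∈ S, f (S.erase c) := by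
  symm
  refine Finset.sum_bij (fun c _ => S.erase c) ?_ ?_ ?_ ?_
  · intro c hc
    rw [Finset.mem_powersetCard]
    exact ⟨Finset.erase_subset _ _, Finset.card_erase_of_mem hc⟩
  · intro c hc d hd h
    exact (Finset.erase_inj S hc).1 h
  · intro T hT
    rw [Finset.mem_powersetCard] at hT
    have h1 : (S \ T).card = 1 := by
      rw [Finset.card_sdiff_of_subset hT.1, hT.2]
      omega
    obtain ⟨c, hc⟩ := Finset.card_eq_one.1 h1
    have hcS : c ∈ S \ T := by rw [hc]; exact Finset.mem_singleton_self c
    refine ⟨c, (Finset.mem_sdiff.1 hcS).1, ?_⟩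
    rw [Finset.erase_eq, ← hc, Finset.sdiff_sdiff_eq_self hT.1]
  · intros
    rfl

/-- The element `c` travels along the rung. Splitting it off contributes minus the number of
elements of `S` below `c`, merging contributes the number of elements of `T` below `c`. -/
theorem rungRight_xS (S T : Finset (Fin N)) :
    rungRight N S.card T.card (xS qN S ⊗ₜ xS qN T) = ∑ c with c ∈ S ∧ c ∉ T,
      v ^ (∑ c' with c' < c, ((if c' ∈ T then 1 else 0) - (if c' ∈ S then 1 else 0) : ℤ)) •
        (xS qN (S.erase c) ⊗ₜ[Kv] xS qN (insert c T)) := by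
  rw [rungRight]
  split_ifs with h0
  · rw [Finset.card_eq_zero] at h0
    simp [h0]
  rw [LinearMap.comp_apply, LinearMap.comp_apply, LinearMap.rTensor_tmul, split_xS,
    if_pos (by omega), sum_powersetCard_pred h0, TensorProduct.sum_tmul, map_sum, map_sum,
    Finset.sum_filter, ← Finset.sum_subset (Finset.subset_univ S)
      (fun c _ hc => if_neg fun h => hc h.1)]
  refine Finset.sum_congr rfl fun c hc => ?_
  have h1 : S \ S.erase c = {c} := by
    rw [Finset.sdiff_erase_self hc]
  rw [h1, ← TensorProduct.smul_tmul', map_smul, map_smul, LinearEquiv.coe_coe,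
    TensorProduct.assoc_tmul, LinearMap.lTensor_tmul, merge_xS]
  by_cases hT : c ∈ T
  · rw [if_neg (by simp [hT]), if_neg (by simp [hT]), TensorProduct.tmul_zero, smul_zero]
  · rw [if_pos (by simp [hT]), if_pos ⟨hc, hT⟩, TensorProduct.tmul_smul, smul_smul,
      ← zpow_natCast, ← zpow_add₀ v_ne_zero, ell_singleton_right, ell_singleton_right,
      Finset.sum_sub_distrib, neg_add_eq_sub, ← Finset.insert_eq]
    congr 3
    -- The split sees `S.erase c` rather than `S`, which makes no difference strictly below `c`.
    refine Finset.sum_congr rfl fun c' hc' => ?_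
    simp [((Finset.mem_filter.1 hc').2).ne]

/-- Here the split and the merge count elements above `c`, in `T` with a negative sign and in `S`
with a positive one. -/
theorem rungLeft_xS (S T : Finset (Fin N)) :
    rungLeft N S.card T.card (xS qN S ⊗ₜ xS qN T) = ∑ c with c ∈ T ∧ c ∉ S,
      v ^ (-∑ c' with c < c', ((if c' ∈ T then 1 else 0) - (if c' ∈ S then 1 else 0) : ℤ)) •
        (xS qN (insert c S) ⊗ₜ[Kv] xS qN (T.erase c)) := by
  rw [rungLeft]
  split_ifs with h0
  · rw [Finset.card_eq_zero] at h0
    simp [h0]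
  rw [LinearMap.comp_apply, LinearMap.comp_apply, LinearMap.lTensor_tmul, split_xS,
    if_pos (by omega), Finset.powersetCard_one, Finset.sum_map, TensorProduct.tmul_sum, map_sum,
    map_sum, Finset.sum_filter, ← Finset.sum_subset (Finset.subset_univ T)
      (fun c _ hc => if_neg fun h => hc h.1)]
  refine Finset.sum_congr rfl fun c hc => ?_
  rw [Function.Embedding.coeFn_mk, TensorProduct.tmul_smul, map_smul, map_smul, LinearEquiv.coe_coe,
    TensorProduct.assoc_symm_tmul, LinearMap.rTensor_tmul, merge_xS]
  by_cases hS : c ∈ S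
  · rw [if_neg (by simp [hS]), if_neg (by simp [hS]), TensorProduct.zero_tmul, smul_zero]
  · rw [if_pos (by simp [hS]), if_pos ⟨hc, hS⟩, ← TensorProduct.smul_tmul', smul_smul,
      ← zpow_natCast, ← zpow_add₀ v_ne_zero, ell_singleton_left, ell_singleton_left,
      Finset.sum_sub_distrib, neg_sub, neg_add_eq_sub, Finset.union_comm, ← Finset.insert_eq,
      Finset.sdiff_singleton_eq_erase]
    congr 3
    refine Finset.sum_congr rfl fun c' hc' => ?_
    simp [((Finset.mem_filter.1 hc').2).ne']

theorem projDeg_xS {k : Type} [Field k] {n : ℕ} {q : k} (d : ℕ) (S : Finset (Fin n)) :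
    projDeg q d (xS q S) = if S.card = d then xS q S else 0 := by
  rw [projDeg, ← xBasis_apply, Module.Basis.constr_basis, xBasis_apply]

theorem projTensor_tensXS {k : Type} [Field k] {n m : ℕ} {q : k} (a : Fin m → ℕ)
    (Q : Fin m → Finset (Fin n)) :
    projTensor q a (tensXS q Q) = if ∀ j, (Q j).card = a j then tensXS q Q else 0 := by
  rw [projTensor, tensXS, PiTensorProduct.map_tprod]
  simp only [projDeg_xS]
  split_ifs with h
  · simp only [h, if_true]
  · push Not at h
    obtain ⟨j, hj⟩ := h
    exact MultilinearMap.map_coord_zero _ j (if_neg hj)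

variable {m : ℕ}

theorem putPair_xS {k : Type} [Field k] {n : ℕ} {q : k} {a b : Fin m} (hab : a ≠ b)
    (Q : Fin m → Finset (Fin n)) (S T : Finset (Fin n)) :
    putPair a b hab (fun j => xS q (Q j)) (xS q S ⊗ₜ[k] xS q T) =
      tensXS q (Function.update (Function.update Q a S) b T) := by
  rw [putPair_tmul, tensXS]
  congr 1
  funext j
  by_cases hb : j = b
  · subst hb; simp
  · by_cases ha : j = a
    · subst ha; simp [hb]
    · simp [ha, hb]

theorem ladderE_tensXS (i : Fin (m - 1)) (a : Fin m → ℕ) (Q : Fin m → Finset (Fin N)) :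
    ladderE N i a (tensXS qN Q) = if ∀ j, (Q j).card = a j then
      ∑ c with c ∈ Q (hi i) ∧ c ∉ Q (lo i),
        v ^ (∑ c' with c' < c,
          ((if c' ∈ Q (lo i) then 1 else 0) - (if c' ∈ Q (hi i) then 1 else 0) : ℤ)) •
        tensXS qN (Function.update (Function.update Q (hi i) ((Q (hi i)).erase c)) (lo i)
          (insert c (Q (lo i)))) else 0 := by
  rw [ladderE, LinearMap.comp_apply, projTensor_tensXS]
  split_ifs with h
  · rw [tensXS, onPair_tprod, ← h, ← h, rungRight_xS, map_sum]
    simp only [map_smul, putPair_xS]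
  · rw [map_zero]

theorem ladderF_tensXS (i : Fin (m - 1)) (a : Fin m → ℕ) (Q : Fin m → Finset (Fin N)) :
    ladderF N i a (tensXS qN Q) = if ∀ j, (Q j).card = a j then
      ∑ c with c ∈ Q (lo i) ∧ c ∉ Q (hi i),
        v ^ (-∑ c' with c < c',
          ((if c' ∈ Q (lo i) then 1 else 0) - (if c' ∈ Q (hi i) then 1 else 0) : ℤ)) •
        tensXS qN (Function.update (Function.update Q (hi i) (insert c (Q (hi i)))) (lo i)
          ((Q (lo i)).erase c)) else 0 := by
  rw [ladderF, LinearMap.comp_apply, projTensor_tensXS]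
  split_ifs with h
  · rw [tensXS, onPair_tprod, ← h, ← h, rungLeft_xS, map_sum]
    simp only [map_smul, putPair_xS]
  · rw [map_zero]

end Ladder

/-! ### Transposition -/

section Transposition

variable {N m : ℕ}

/-- The transposition of families of subsets. -/
def transp : (Fin N → Finset (Fin m)) ≃ (Fin m → Finset (Fin N)) where
  toFun P j := Finset.univ.filter fun c => j ∈ P c
  invFun Q c := Finset.univ.filter fun j => c ∈ Q j
  left_inv P := by
    funext c
    ext j
    simp
  right_inv Q := by
    funext j
    ext c
    simp

theorem mem_transp {P : Fin N → Finset (Fin m)} {j : Fin m} {c : Fin N} :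
    c ∈ transp P j ↔ j ∈ P c := by
  simp [transp]

/-- The identification of the two tensor powers by the transposition of basis tensors. -/
def transpEquiv (N m : ℕ) : TPow Kv m v N ≃ₗ[Kv] TPow Kv N qN m :=
  (tensBasis v).equiv (tensBasis qN) transp

theorem transpEquiv_tensXS (P : Fin N → Finset (Fin m)) :
    transpEquiv N m (tensXS v P) = tensXS qN (transp P) := by
  rw [transpEquiv, ← tensBasis_apply, Module.Basis.equiv_apply, tensBasis_apply]

attribute [irreducible] transpEquiv

theorem setWt_eq_transp (i : Fin (m - 1)) (P : Fin N → Finset (Fin m)) (c : Fin N) :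
    setWt i (P c) = (if c ∈ transp P (lo i) then 1 else 0) -
      (if c ∈ transp P (hi i) then 1 else 0) := by
  simp only [mem_transp, setWt]

/-- Changing a letter inside column `c` of a 0-1 matrix moves `c` from one row set to another; this
is what a rung does. -/
theorem transp_raise {i : Fin (m - 1)} {P : Fin N → Finset (Fin m)} {c : Fin N} :
    transp (changeAt (hi i) (lo i) c P) =
      Function.update (Function.update (transp P) (hi i) ((transp P (hi i)).erase c)) (lo i)
          (insert c (transp P (lo i))) := by
  have hne := lo_ne_hi i
  funext j
  ext d
  rw [mem_transp, changeAt]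
  by_cases hj : j = lo i
  · subst hj
    by_cases hd : d = c
    · subst hd; simp
    · simp [hd, mem_transp]
  · by_cases hj' : j = hi i
    · subst hj'
      by_cases hd : d = c
      · subst hd; simp [hj]
      · simp [hd, hj, mem_transp]
    · by_cases hd : d = c
      · subst hd; simp [hj, hj', mem_transp]
      · simp [hd, hj, hj', mem_transp]

theorem transp_lower {i : Fin (m - 1)} {P : Fin N → Finset (Fin m)} {c : Fin N} :
    transp (changeAt (lo i) (hi i) c P) =
      Function.update (Function.update (transp P) (hi i) (insert c (transp P (hi i)))) (lo i)
          ((transp P (lo i)).erase c) := by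
  have hne := lo_ne_hi i
  funext j
  ext d
  rw [mem_transp, changeAt]
  by_cases hj : j = lo i
  · subst hj
    by_cases hd : d = c
    · subst hd; simp [hne]
    · simp [hd, mem_transp]
  · by_cases hj' : j = hi i
    · subst hj'
      by_cases hd : d = c
      · subst hd; simp [hj]
      · simp [hd, hj, mem_transp]
    · by_cases hd : d = c
      · subst hd; simp [hj, hj', mem_transp]
      · simp [hd, hj, hj', mem_transp]

/-- This is the heart of the duality: after transposition the two sums have the same index set, the
same exponents and the same basis vectors. -/
theorem ladderE_transp (i : Fin (m - 1)) (a : Fin m → ℕ) (P : Fin N → Finset (Fin m)) :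
    ladderE N i a (tensXS qN (transp P)) = if ∀ j, (transp P j).card = a j then
      transpEquiv N m (tensE i (tensXS v P)) else 0 := by
  rw [ladderE_tensXS, tensE_tensXS, map_sum]
  simp only [map_smul, transpEquiv_tensXS, setWt_eq_transp, transp_raise]
  simp only [mem_transp]

theorem ladderF_transp (i : Fin (m - 1)) (a : Fin m → ℕ) (P : Fin N → Finset (Fin m)) :
    ladderF N i a (tensXS qN (transp P)) = if ∀ j, (transp P j).card = a j then
      transpEquiv N m (tensF i (tensXS v P)) else 0 := by
  rw [ladderF_tensXS, tensF_tensXS, map_sum]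
  simp only [map_smul, transpEquiv_tensXS, setWt_eq_transp, transp_lower]
  simp only [mem_transp]

/-- Both sides count the ones of the matrix. -/
theorem sum_card_transp (P : Fin N → Finset (Fin m)) :
    ∑ j, (transp P j).card = ∑ c, (P c).card := by
  simp only [transp, Equiv.coe_fn_mk, Finset.card_filter]
  rw [Finset.sum_comm]
  refine Finset.sum_congr rfl fun c _ => ?_
  simp

theorem tensWt_eq_card (P : Fin N → Finset (Fin m)) (i : Fin (m - 1)) :
    tensWt P i = ((transp P (lo i)).card : ℤ) - (transp P (hi i)).card := by
  simp only [tensWt, setWt, Finset.sum_sub_distrib, transp, Equiv.coe_fn_mk, Finset.card_filter]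
  push_cast
  rfl

/-- A `gl_m`-weight is determined by its `sl_m`-weight and its degree. -/
theorem eq_of_sub_eq {a b : Fin m → ℕ} (h : ∀ i : Fin (m - 1),
    (a (lo i) : ℤ) - a (hi i) = (b (lo i) : ℤ) - b (hi i)) (hs : ∑ j, a j = ∑ j, b j) : a = b := by
  rcases Nat.eq_zero_or_pos m with rfl | hm
  · exact Subsingleton.elim _ _
  -- The difference `a j - b j` is constant in `j`; equal degrees make `m` times this constant zero.
  have key : ∀ (j : ℕ) (hj : j < m), (a ⟨j, hj⟩ : ℤ) - b ⟨j, hj⟩ = a ⟨0, hm⟩ - b ⟨0, hm⟩ := by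
    intro j
    induction j with
    | zero => intro _; rfl
    | succ j ih =>
      intro hj
      have h1 := ih (by omega)
      have h2 := h ⟨j, by omega⟩
      simp only [lo, hi] at h2
      linarith
  have h3 : ∑ j, ((a j : ℤ) - b j) = 0 := by
    rw [Finset.sum_sub_distrib, sub_eq_zero]
    exact_mod_cast hs
  have h4 : ∑ j : Fin m, ((a j : ℤ) - b j) = m * ((a ⟨0, hm⟩ : ℤ) - b ⟨0, hm⟩) := by
    rw [Finset.sum_congr rfl (fun (j : Fin m) _ => key j j.2)]
    simp [mul_sub]
  rw [h3] at h4
  have h5 : (a ⟨0, hm⟩ : ℤ) - b ⟨0, hm⟩ = 0 := by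
    rcases mul_eq_zero.1 h4.symm with h | h
    · exact absurd h (by exact_mod_cast hm.ne')
    · exact h
  funext j
  have := key j j.2
  rw [h5] at this
  have h6 : (a j : ℤ) = b j := sub_eq_zero.1 this
  exact_mod_cast h6

theorem isLift_card {P : Fin N → Finset (Fin m)} (hP : ∑ c, (P c).card = m) :
    IsLift m m N (tensWt P) fun j => (transp P j).card := by
  refine ⟨⟨fun j => ?_, by rw [sum_card_transp, hP]⟩, fun i => (tensWt_eq_card P i).symm⟩
  simpa using Finset.card_le_univ (transp P j)

/-- On matrices with `m` ones, the projection onto a summand of the Howe space and the weight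
projection select the same basis vectors. This is the agreement of the idempotents. -/
theorem card_eq_iff {P : Fin N → Finset (Fin m)} (hP : ∑ c, (P c).card = m) {lam : Wt m}
    {a : Fin m → ℕ} (ha : IsLift m m N lam a) :
    (∀ j, (transp P j).card = a j) ↔ tensWt P = lam := by
  constructor
  · intro h
    funext i
    rw [tensWt_eq_card, h, h, ha.2]
  · intro h j
    refine congrFun (eq_of_sub_eq (a := fun j => (transp P j).card) (b := a) (fun i => ?_) ?_) j
    · rw [ha.2, ← h, tensWt_eq_card]
    · rw [sum_card_transp, hP, ha.1.2]

theorem howeSpace_eq_span : HoweSpace N m = Submodule.span Kv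
    {y | ∃ P : Fin N → Finset (Fin m), ∑ c, (P c).card = m ∧ y = tensXS qN (transp P)} := by
  refine le_antisymm (iSup₂_le fun a ha => ?_) (Submodule.span_le.2 ?_)
  · rw [extTensor_eq_span]
    refine Submodule.span_mono ?_
    rintro _ ⟨Q, hQ, rfl⟩
    refine ⟨transp.symm Q, ?_, by rw [Equiv.apply_symm_apply]⟩
    rw [← sum_card_transp, Equiv.apply_symm_apply]
    exact (Finset.sum_congr rfl fun j _ => hQ j).trans ha.2
  · rintro _ ⟨P, hP, rfl⟩
    refine Submodule.mem_iSup_of_mem (fun j => (transp P j).card)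
      (Submodule.mem_iSup_of_mem (isLift_card hP).1 ?_)
    rw [extTensor_eq_span]
    exact Submodule.subset_span ⟨_, fun _ => rfl, rfl⟩

end Transposition

/-! ### Invariant subspaces -/

section Restrict

variable {k V : Type} [Field k] [AddCommGroup V] [Module k V] {n : ℕ} {q : k}

theorem uadj_invariant (φ : UAdj k n q →ₐ[k] Module.End k V) {S : Submodule k V}
    (h : ∀ g, ∀ w ∈ S, φ (ugen k q g) w ∈ S) (x : UAdj k n q) : ∀ w ∈ S, φ x w ∈ S := by
  obtain ⟨t, rfl⟩ := RingQuot.mkAlgHom_surjective k (URel k n q) x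
  induction t using FreeAlgebra.induction with
  | grade0 r =>
    intro w hw
    rw [AlgHom.commutes, AlgHom.commutes, Module.algebraMap_end_apply]
    exact S.smul_mem r hw
  | grade1 g => exact h g
  | mul a b ha hb =>
    intro w hw
    rw [map_mul, map_mul]
    exact ha _ (hb _ hw)
  | add a b ha hb =>
    intro w hw
    rw [map_add, map_add]
    exact S.add_mem (ha _ hw) (hb _ hw)

/-- The representation of the idempotented algebra on an invariant subspace. -/
def subRep (φ : UAdj k n q →ₐ[k] Module.End k V) {S : Submodule k V}
    (h : ∀ g, ∀ w ∈ S, φ (ugen k q g) w ∈ S) : Udot k n q →ₙₐ[k] Module.End k S where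
  toFun x := (φ x).restrict (uadj_invariant φ h x)
  map_smul' c x := by
    refine LinearMap.ext fun w => Subtype.ext ?_
    change φ (c • (x : UAdj k n q)) w = c • φ x w
    rw [map_smul]
    rfl
  map_zero' := by
    refine LinearMap.ext fun w => Subtype.ext ?_
    change φ 0 w = 0
    rw [map_zero]
    rfl
  map_add' x y := by
    refine LinearMap.ext fun w => Subtype.ext ?_
    change φ ((x : UAdj k n q) + y) w = φ x w + φ y w
    rw [map_add]
    rfl
  map_mul' x y := by
    refine LinearMap.ext fun w => Subtype.ext ?_
    change φ ((x : UAdj k n q) * y) w = φ x (φ y w)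
    rw [map_mul]
    rfl

theorem subRep_apply (φ : UAdj k n q →ₐ[k] Module.End k V) {S : Submodule k V}
    (h : ∀ g, ∀ w ∈ S, φ (ugen k q g) w ∈ S) (x : Udot k n q) (w : S) :
    (subRep φ h x w : V) = φ x w := rfl

/-- Representations of the idempotented algebra which agree on the generators are equal. -/
theorem udot_hom_ext (hq : q ≠ 0) {A : Type} [Ring A] [Algebra k A] {ρ σ : Udot k n q →ₙₐ[k] A}
    (h : ∀ x, IsUdotGen x → ρ x = σ x) : ρ = σ := by
  refine NonUnitalAlgHom.ext fun x => ?_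
  induction x using udot_induction hq with
  | hgen x hx => exact h x hx
  | h0 => rw [map_zero, map_zero]
  | hadd x y hx hy => rw [map_add, map_add, hx, hy]
  | hsmul c x hx => rw [map_smul, map_smul, hx]
  | hmul x y hx hy => rw [map_mul, map_mul, hx, hy]

end Restrict

/-! ### Invariance of the two spaces; existence and uniqueness of the actions -/

section Invariance

variable {m N : ℕ}

/-- The span of the tensor products of elementary tensors whose degrees satisfy `r`. -/
def degSpan (m : ℕ) (r : (Fin N → ℕ) → Prop) : Submodule Kv (TPow Kv m v N) :=
  Submodule.span Kv {y | ∃ P : Fin N → Finset (Fin m), r (fun c => (P c).card) ∧ y = tensXS v P}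

theorem card_changeAt {a b : Fin m} {c : Fin N} {P : Fin N → Finset (Fin m)}
    (h : a ∈ P c ∧ b ∉ P c) : (fun c' => (changeAt a b c P c').card) = fun c' => (P c').card := by
  funext c'
  by_cases hc : c' = c
  · subst hc
    have h0 : 0 < (P c').card := Finset.card_pos.2 ⟨a, h.1⟩
    rw [changeAt, Function.update_self, Finset.card_insert_of_notMem (by simp [h.2]),
      Finset.card_erase_of_mem h.1]
    omega
  · rw [changeAt, Function.update_of_ne hc]

/-- The generators scale, kill or replace letters within a column, so they preserve all column
sizes, hence any condition `r` on them. Fixed size `ℓ` gives the standard space, total size `m` the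
Howe space. -/
theorem stdGen_degSpan (r : (Fin N → ℕ) → Prop) (g : Gen m) :
    ∀ w ∈ degSpan m r, stdGen g w ∈ degSpan m r := by
  suffices h : degSpan m r ≤ (degSpan m r).comap (stdGen g) from h
  refine Submodule.span_le.2 ?_
  rintro _ ⟨P, hP, rfl⟩
  have hmem : tensXS v P ∈ degSpan m r := Submodule.subset_span ⟨P, hP, rfl⟩
  have hchange : ∀ a b c, a ∈ P c ∧ b ∉ P c → tensXS v (changeAt a b c P) ∈ degSpan m r :=
    fun a b c h => Submodule.subset_span ⟨_, by rwa [card_changeAt h], rfl⟩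
  change stdGen g (tensXS v P) ∈ degSpan m r
  cases g with
  | K i =>
    rw [stdGen, tensK_tensXS]
    exact Submodule.smul_mem _ _ hmem
  | Kinv i =>
    rw [stdGen, tensKinv_tensXS]
    exact Submodule.smul_mem _ _ hmem
  | E i =>
    rw [stdGen, tensE_tensXS]
    exact Submodule.sum_mem _ fun c hc =>
      Submodule.smul_mem _ _ (hchange _ _ c (Finset.mem_filter.1 hc).2)
  | F i =>
    rw [stdGen, tensF_tensXS]
    exact Submodule.sum_mem _ fun c hc =>
      Submodule.smul_mem _ _ (hchange _ _ c (Finset.mem_filter.1 hc).2)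
  | one lam =>
    rw [stdGen, wtProj_tensXS]
    split_ifs
    · exact hmem
    · exact Submodule.zero_mem _

theorem stdSpace_eq_degSpan (l : ℕ) : StdSpace N l m = degSpan m fun d => ∀ c, d c = l := by
  rw [StdSpace, extTensor_eq_span, degSpan]

theorem howeSpace_eq_map : HoweSpace N m =
    (degSpan m fun d : Fin N → ℕ => ∑ c, d c = m).map (transpEquiv N m).toLinearMap := by
  rw [howeSpace_eq_span, degSpan, Submodule.map_span]
  congr 1
  ext y
  constructor
  · rintro ⟨P, hP, rfl⟩
    exact ⟨_, ⟨P, hP, rfl⟩, transpEquiv_tensXS P⟩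
  · rintro ⟨_, ⟨P, hP, rfl⟩, rfl⟩
    exact ⟨P, hP, transpEquiv_tensXS P⟩

/-! ### The standard action -/

theorem stdHom_stdSpace (N l m : ℕ) (g : Gen m) :
    ∀ w ∈ StdSpace N l m, stdHom N m (ugen Kv v g) w ∈ StdSpace N l m := by
  rw [stdSpace_eq_degSpan, stdHom_ugen]
  exact stdGen_degSpan _ g

/-- The standard action on `Λ_v^ℓ(C_v^m)^{⊗ N}`. -/
def stdAction (N l m : ℕ) : Udot Kv m v →ₙₐ[Kv] Module.End Kv (StdSpace N l m) :=
  subRep (stdHom N m) (stdHom_stdSpace N l m)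

theorem stdHom_uOne (lam : Wt m) : stdHom N m (uOne v lam : UAdj Kv m v) = wtProj lam :=
  stdHom_ugen _

theorem stdHom_uE (i : Fin (m - 1)) (lam : Wt m) :
    stdHom N m (uE v i lam : UAdj Kv m v) = tensE i * wtProj lam := by
  change stdHom N m (ugen Kv v (.E i) * ugen Kv v (.one lam)) = _
  rw [map_mul, stdHom_ugen, stdHom_ugen, stdGen, stdGen]

theorem stdHom_uF (i : Fin (m - 1)) (lam : Wt m) :
    stdHom N m (uF v i lam : UAdj Kv m v) = tensF i * wtProj lam := by
  change stdHom N m (ugen Kv v (.F i) * ugen Kv v (.one lam)) = _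
  rw [map_mul, stdHom_ugen, stdHom_ugen, stdGen, stdGen]

theorem coord_tensXS (P Q : Fin N → Finset (Fin m)) :
    (tensBasis v).coord Q (tensXS v P) = if P = Q then (1 : Kv) else 0 := by
  rw [← tensBasis_apply, Module.Basis.coord_apply, Module.Basis.repr_self, Finsupp.single_apply]

theorem coord_tensK (i : Fin (m - 1)) (Q : Fin N → Finset (Fin m)) (w : TPow Kv m v N) :
    (tensBasis v).coord Q (tensK i w) = v ^ tensWt Q i * (tensBasis v).coord Q w := by
  have h : (tensBasis v).coord Q ∘ₗ tensK i = v ^ tensWt Q i • (tensBasis v).coord Q := by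
    refine ext_tensXS fun P => ?_
    rw [LinearMap.comp_apply, LinearMap.smul_apply, tensK_tensXS, map_smul, coord_tensXS]
    split_ifs with h
    · rw [h]
    · simp
  exact LinearMap.congr_fun h w

theorem coord_wtProj (lam : Wt m) (Q : Fin N → Finset (Fin m)) (w : TPow Kv m v N) :
    (tensBasis v).coord Q (wtProj lam w) =
      if tensWt Q = lam then (tensBasis v).coord Q w else 0 := by
  have h : (tensBasis v).coord Q ∘ₗ wtProj lam =
      if tensWt Q = lam then (tensBasis v).coord Q else 0 := by
    refine ext_tensXS fun P => ?_
    rw [LinearMap.comp_apply, wtProj_tensXS]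
    by_cases h : P = Q
    · subst h
      split_ifs <;> simp
    · have h0 : (tensBasis v).coord Q (tensXS v P) = 0 := by rw [coord_tensXS, if_neg h]
      split_ifs <;> simp only [h0, map_zero, LinearMap.zero_apply]
  have h2 := LinearMap.congr_fun h w
  rw [LinearMap.comp_apply] at h2
  rw [h2]
  split_ifs <;> rfl

/-- Comparing coordinates in the eigenvalue equations shows that a weight vector involves only basis
tensors of its weight, because powers of `v` are distinct. So weight vectors in the sense of
`IsWtVec` behave as the basis-defined projection expects. -/
theorem wtProj_of_isWtVec {lam mu : Wt m} {w : TPow Kv m v N} (hw : IsWtVec mu w) :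
    wtProj lam w = if mu = lam then w else 0 := by
  have key : ∀ Q, (tensBasis v).coord Q w ≠ 0 → tensWt Q = mu := by
    intro Q hQ
    funext i
    have h1 := coord_tensK i Q w
    rw [hw i, map_smul, smul_eq_mul] at h1
    exact (v_zpow_injective (mul_right_cancel₀ hQ h1)).symm
  refine (tensBasis v).ext_elem fun Q => ?_
  rw [← Module.Basis.coord_apply, ← Module.Basis.coord_apply, coord_wtProj]
  by_cases hQ : (tensBasis v).coord Q w = 0
  · split_ifs <;> simp [hQ]
  · rw [key Q hQ]
    split_ifs <;> simp

theorem isStdAction_stdAction (N l m : ℕ) : IsStdAction N l m (stdAction N l m) where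
  one_self lam w hw := Subtype.ext (by
    rw [stdAction, subRep_apply, stdHom_uOne, wtProj_of_isWtVec hw, if_pos rfl])
  one_ne lam mu w hw hne := Subtype.ext (by
    rw [stdAction, subRep_apply, stdHom_uOne, wtProj_of_isWtVec hw, if_neg hne.symm]
    rfl)
  E_apply i lam w := by
    rw [stdAction, subRep_apply, subRep_apply, stdHom_uE, stdHom_uOne]
    rfl
  F_apply i lam w := by
    rw [stdAction, subRep_apply, subRep_apply, stdHom_uF, stdHom_uOne]
    rfl

theorem isWtVec_tensXS (P : Fin N → Finset (Fin m)) : IsWtVec (tensWt P) (tensXS v P) :=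
  fun i => tensK_tensXS i P

theorem linearMap_ext_of_eq_span {k V M : Type} [Field k] [AddCommGroup V] [Module k V]
    [AddCommGroup M] [Module k M] {S : Submodule k V} {s : Set V} (hS : S = Submodule.span k s)
    {f g : S →ₗ[k] M} (h : ∀ y (hy : y ∈ S), y ∈ s → f ⟨y, hy⟩ = g ⟨y, hy⟩) : f = g := by
  subst hS
  refine LinearMap.ext fun ⟨w, hw⟩ => ?_
  induction hw using Submodule.span_induction with
  | mem y hy => exact h y _ hy
  | zero => exact (map_zero f).trans (map_zero g).symm
  | add x y hx hy ihx ihy =>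
    have := congrArg₂ (· + ·) ihx ihy
    rwa [← map_add, ← map_add] at this
  | smul c x hx ih =>
    have := congrArg (c • ·) ih
    rwa [← map_smul, ← map_smul] at this

/-- The space is spanned by weight vectors, which fixes every `1_lam`; the values on `E_i 1_lam` and
`F_i 1_lam` follow, and these elements generate. -/
theorem IsStdAction.eq {N l m : ℕ} {σ : Udot Kv m v →ₙₐ[Kv] Module.End Kv (StdSpace N l m)}
    (h : IsStdAction N l m σ) : σ = stdAction N l m := by
  have h0 := isStdAction_stdAction N l m
  have hone : ∀ lam, σ (uOne v lam) = stdAction N l m (uOne v lam) := by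
    intro lam
    refine linearMap_ext_of_eq_span (stdSpace_eq_degSpan l) ?_
    rintro _ hy ⟨P, -, rfl⟩
    have hP := isWtVec_tensXS P
    by_cases hlam : lam = tensWt P
    · subst hlam
      rw [h.one_self _ ⟨_, hy⟩ hP, h0.one_self _ ⟨_, hy⟩ hP]
    · rw [h.one_ne _ _ ⟨_, hy⟩ hP hlam, h0.one_ne _ _ ⟨_, hy⟩ hP hlam]
  refine udot_hom_ext v_ne_zero fun x hx => ?_
  cases hx with
  | one lam => exact hone lam
  | E i lam =>
    exact LinearMap.ext fun w => Subtype.ext (by rw [h.E_apply, h0.E_apply, hone])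
  | F i lam =>
    exact LinearMap.ext fun w => Subtype.ext (by rw [h.F_apply, h0.F_apply, hone])

/-! ### The action through ladders -/

/-- The standard representation, transported to `Λ_q^•(C_q^N)^{⊗ m}`. -/
def howeHom (N m : ℕ) : UAdj Kv m v →ₐ[Kv] Module.End Kv (TPow Kv N qN m) :=
  ((transpEquiv N m).conjAlgEquiv Kv).toAlgHom.comp (stdHom N m)

theorem howeHom_transpEquiv (x : UAdj Kv m v) (w : TPow Kv m v N) :
    howeHom N m x (transpEquiv N m w) = transpEquiv N m (stdHom N m x w) := by
  change transpEquiv N m (stdHom N m x ((transpEquiv N m).symm (transpEquiv N m w))) = _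
  rw [LinearEquiv.symm_apply_apply]

theorem howeHom_tensXS (x : UAdj Kv m v) (P : Fin N → Finset (Fin m)) :
    howeHom N m x (tensXS qN (transp P)) = transpEquiv N m (stdHom N m x (tensXS v P)) := by
  rw [← transpEquiv_tensXS, howeHom_transpEquiv]

attribute [irreducible] howeHom

theorem howeHom_howeSpace (N m : ℕ) (g : Gen m) :
    ∀ w ∈ HoweSpace N m, howeHom N m (ugen Kv v g) w ∈ HoweSpace N m := by
  rw [howeSpace_eq_map]
  rintro _ ⟨w, hw, rfl⟩
  refine ⟨stdGen g w, stdGen_degSpan _ g w hw, ?_⟩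
  have h := howeHom_transpEquiv (ugen Kv v g) w
  rw [stdHom_ugen] at h
  exact h.symm

/-- The action on `⨁ Λ_q^a(C_q^N)` which corresponds to the standard action under
transposition. -/
def howeAction (N m : ℕ) : Udot Kv m v →ₙₐ[Kv] Module.End Kv (HoweSpace N m) :=
  subRep (howeHom N m) (howeHom_howeSpace N m)

theorem howeSpace_eqOn {f g : TPow Kv N qN m →ₗ[Kv] TPow Kv N qN m}
    (h : ∀ P : Fin N → Finset (Fin m), ∑ c, (P c).card = m →
      f (tensXS qN (transp P)) = g (tensXS qN (transp P))) (w : HoweSpace N m) : f w = g w := by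
  obtain ⟨w, hw⟩ := w
  rw [howeSpace_eq_span] at hw
  refine LinearMap.eqOn_span ?_ hw
  rintro _ ⟨P, hP, rfl⟩
  exact h P hP

/-- A basis tensor of total degree `m` provides a lift of its own weight by its row sizes. If `lam`
has no lift, the weight projection therefore kills the whole Howe space. -/
theorem howeHom_eq_zero_of_no_lift {lam : Wt m} (hlam : ¬ ∃ a, IsLift m m N lam a)
    {x : Udot Kv m v} (hx : ∀ w : TPow Kv m v N, wtProj lam w = 0 → stdHom N m x w = 0) :
    howeAction N m x = 0 := by
  refine LinearMap.ext fun w => Subtype.ext ?_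
  rw [howeAction, subRep_apply]
  refine howeSpace_eqOn (g := 0) (fun P hP => ?_) w
  rw [howeHom_tensXS, hx, map_zero]
  · rfl
  · rw [wtProj_tensXS, if_neg]
    rintro rfl
    exact hlam ⟨_, isLift_card hP⟩

theorem isHoweAction_howeAction (N m : ℕ) : IsHoweAction N m (howeAction N m) where
  one_lift lam a ha w := by
    rw [howeAction, subRep_apply]
    refine howeSpace_eqOn (fun P hP => ?_) w
    rw [howeHom_tensXS, stdHom_uOne, wtProj_tensXS, projTensor_tensXS]
    simp only [card_eq_iff hP ha]
    split_ifs
    · rw [transpEquiv_tensXS]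
    · rw [map_zero]
  E_lift i lam a ha w := by
    rw [howeAction, subRep_apply]
    refine howeSpace_eqOn (fun P hP => ?_) w
    rw [howeHom_tensXS, stdHom_uE, Module.End.mul_apply, wtProj_tensXS, ladderE_transp]
    simp only [card_eq_iff hP ha]
    split_ifs
    · rfl
    · rw [map_zero, map_zero]
  F_lift i lam a ha w := by
    rw [howeAction, subRep_apply]
    refine howeSpace_eqOn (fun P hP => ?_) w
    rw [howeHom_tensXS, stdHom_uF, Module.End.mul_apply, wtProj_tensXS, ladderF_transp]
    simp only [card_eq_iff hP ha]
    split_ifs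
    · rfl
    · rw [map_zero, map_zero]
  one_none lam hlam := howeHom_eq_zero_of_no_lift hlam fun w hw => by rw [stdHom_uOne, hw]
  E_none i lam hlam := howeHom_eq_zero_of_no_lift hlam fun w hw => by
    rw [stdHom_uE, Module.End.mul_apply, hw, map_zero]
  F_none i lam hlam := howeHom_eq_zero_of_no_lift hlam fun w hw => by
    rw [stdHom_uF, Module.End.mul_apply, hw, map_zero]

theorem IsHoweAction.eq {N m : ℕ} {ρ : Udot Kv m v →ₙₐ[Kv] Module.End Kv (HoweSpace N m)}
    (h : IsHoweAction N m ρ) : ρ = howeAction N m := by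
  have h0 := isHoweAction_howeAction N m
  refine udot_hom_ext v_ne_zero fun x hx => ?_
  cases hx with
  | one lam =>
    by_cases hlam : ∃ a, IsLift m m N lam a
    · obtain ⟨a, ha⟩ := hlam
      exact LinearMap.ext fun w => Subtype.ext (by rw [h.one_lift lam a ha, h0.one_lift lam a ha])
    · rw [h.one_none lam hlam, h0.one_none lam hlam]
  | E i lam =>
    by_cases hlam : ∃ a, IsLift m m N lam a
    · obtain ⟨a, ha⟩ := hlam
      exact LinearMap.ext fun w => Subtype.ext (by
        rw [h.E_lift i lam a ha, h0.E_lift i lam a ha])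
    · rw [h.E_none i lam hlam, h0.E_none i lam hlam]
  | F i lam =>
    by_cases hlam : ∃ a, IsLift m m N lam a
    · obtain ⟨a, ha⟩ := hlam
      exact LinearMap.ext fun w => Subtype.ext (by
        rw [h.F_lift i lam a ha, h0.F_lift i lam a ha])
    · rw [h.F_none i lam hlam, h0.F_none i lam hlam]

end Invariance

/-! ### Tableaux -/

section Tableaux

variable {N l m : ℕ}

theorem entry_injective (T : Col N l m) (c : Fin N) : Function.Injective fun r => T.1 r c :=
  (show StrictMono fun r => T.1 r c from fun r r' h => T.2 c r r' h).injective

theorem mem_column {T : Col N l m} {c : Fin N} {j : Fin m} :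
    j ∈ column T c ↔ ∃ r, T.1 r c = j := by
  simp [column]

/-- Change the entry `a` of the column `c` to `b`. -/
def changeEntry (a b : Fin m) (c : Fin N) (T : Col N l m) (r : Fin l) (c' : Fin N) : Fin m :=
  if c' = c ∧ T.1 r c' = a then b else T.1 r c'

/-- The hypothesis `hadj` says that `a` and `b` compare alike with every other letter, so the
replacement keeps the order of the rows, and `b` is not already in the column. -/
theorem changeEntry_strict {a b : Fin m} (hadj : ∀ x, x ≠ a → x ≠ b → (x < a ↔ x < b))
    {c : Fin N} {T : Col N l m} (hb : b ∉ column T c) (c' : Fin N) (r r' : Fin l) (hr : r < r') :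
    changeEntry a b c T r c' < changeEntry a b c T r' c' := by
  have h := T.2 c' r r' hr
  unfold changeEntry
  by_cases hc : c' = c
  · subst hc
    have hx : T.1 r c' ≠ b := fun h => hb (mem_column.2 ⟨r, h⟩)
    have hy : T.1 r' c' ≠ b := fun h => hb (mem_column.2 ⟨r', h⟩)
    by_cases h1 : T.1 r c' = a
    · have h2 : T.1 r' c' ≠ a := (h1 ▸ h).ne'
      rw [if_pos ⟨rfl, h1⟩, if_neg (fun h => h2 h.2)]
      have h3 : ¬ T.1 r' c' < b := fun h4 =>
        ((hadj _ h2 hy).2 h4).not_gt (h1 ▸ h)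
      exact lt_of_le_of_ne (not_lt.1 h3) hy.symm
    · rw [if_neg (fun h => h1 h.2)]
      by_cases h2 : T.1 r' c' = a
      · rw [if_pos ⟨rfl, h2⟩]
        exact (hadj _ h1 hx).1 (h2 ▸ h)
      · rwa [if_neg (fun h => h2 h.2)]
  · rwa [if_neg (fun h => hc h.1), if_neg (fun h => hc h.1)]

/-- `T'` is obtained from `T` by changing the entry `a` of the column `c` to `b`. -/
def IsChangeAt (a b : Fin m) (c : Fin N) (T T' : Col N l m) : Prop :=
  (a ∈ column T c ∧ b ∉ column T c) ∧ ∀ r c', T'.1 r c' = changeEntry a b c T r c'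

variable {a b : Fin m} {c : Fin N} {T T' : Col N l m}

/-- This recovers `c` from the pair of tableaux, as needed for the exponents, which are phrased
through columns of disagreement. -/
theorem IsChangeAt.exists_ne_iff (h : IsChangeAt a b c T T') (hab : a ≠ b) (c' : Fin N) :
    (∃ r, T.1 r c' ≠ T'.1 r c') ↔ c' = c := by
  constructor
  · rintro ⟨r, hr⟩
    by_contra hc
    rw [h.2, changeEntry, if_neg (fun h => hc h.1)] at hr
    exact hr rfl
  · rintro rfl
    obtain ⟨r, hr⟩ := mem_column.1 h.1.1
    refine ⟨r, ?_⟩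
    rw [h.2, changeEntry, if_pos ⟨rfl, hr⟩, hr]
    exact hab

theorem IsChangeAt.column_eq (h : IsChangeAt a b c T T') :
    column T' = changeAt a b c (column T) := by
  funext c'
  ext j
  rw [mem_column]
  simp only [h.2, changeEntry, changeAt]
  by_cases hc : c' = c
  · subst hc
    obtain ⟨⟨ha, hb⟩, -⟩ := h
    simp only [true_and, Function.update_self, Finset.mem_insert, Finset.mem_erase, mem_column]
    constructor
    · rintro ⟨r, hr⟩
      split_ifs at hr with h1
      · exact Or.inl hr.symm
      · exact Or.inr ⟨hr ▸ h1, r, hr⟩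
    · rintro (rfl | ⟨hj, r, hr⟩)
      · obtain ⟨r, hr⟩ := mem_column.1 ha
        exact ⟨r, if_pos hr⟩
      · exact ⟨r, by rw [if_neg (hr ▸ hj), hr]⟩
  · simp [hc, mem_column]

theorem IsChangeAt.changes (h : IsChangeAt a b c T T') : Changes a b T T' := by
  obtain ⟨r, hr⟩ := mem_column.1 h.1.1
  refine ⟨r, c, hr, by rw [h.2, changeEntry, if_pos ⟨rfl, hr⟩], fun r' c' hne => ?_⟩
  rw [h.2, changeEntry, if_neg]
  rintro ⟨rfl, hr'⟩
  exact hne (by rw [entry_injective T c' (hr'.trans hr.symm)])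

theorem Changes.exists_isChangeAt (hab : a ≠ b) (h : Changes a b T T') :
    ∃ c, IsChangeAt a b c T T' := by
  obtain ⟨r, c, hr, hr', hne⟩ := h
  refine ⟨c, ⟨mem_column.2 ⟨r, hr⟩, fun hb => ?_⟩, fun r' c' => ?_⟩
  · obtain ⟨s, hs⟩ := mem_column.1 hb
    have hsr : s ≠ r := by
      rintro rfl
      exact hab (hr.symm.trans hs)
    -- If `b` already stood in row `s`, it would stay there, and column `c` of `T'` would contain
    -- `b` twice.
    have h1 := hne s c (by simp [hsr])
    exact hsr (entry_injective T' c ((h1.trans hs).trans hr'.symm))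
  · unfold changeEntry
    split_ifs with h1
    · obtain ⟨rfl, h1⟩ := h1
      rw [entry_injective T c' (h1.trans hr.symm)]
      exact hr'
    · refine hne r' c' fun h2 => h1 ?_
      rw [Prod.mk.injEq] at h2
      rw [h2.1, h2.2]
      exact ⟨rfl, hr⟩

/-- The changes of an entry `a` to `b` correspond to the columns which contain `a` but not `b`. -/
theorem sum_changes {M : Type} [AddCommMonoid M] (hab : a ≠ b)
    (hadj : ∀ x, x ≠ a → x ≠ b → (x < a ↔ x < b)) (f : Fin N → M) (g : Col N l m → M)
    (hfg : ∀ c T', IsChangeAt a b c T T' → f c = g T') :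
    ∑ c with a ∈ column T c ∧ b ∉ column T c, f c = ∑ T' with Changes a b T T', g T' := by
  have hch : ∀ (c : Fin N) (hc : c ∈ Finset.univ.filter
      fun c => a ∈ column T c ∧ b ∉ column T c),
      IsChangeAt a b c T ⟨changeEntry a b c T, fun c' r r' hr =>
        changeEntry_strict hadj (Finset.mem_filter.1 hc).2.2 c' r r' hr⟩ :=
    fun c hc => ⟨(Finset.mem_filter.1 hc).2, fun _ _ => rfl⟩
  refine Finset.sum_bij (fun c hc => ⟨changeEntry a b c T, fun c' r r' hr =>
        changeEntry_strict hadj (Finset.mem_filter.1 hc).2.2 c' r r' hr⟩) ?_ ?_ ?_ ?_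
  · intro c hc
    exact Finset.mem_filter.2 ⟨Finset.mem_univ _, (hch c hc).changes⟩
  · intro c hc d hd h
    -- Injectivity: the changed column is the only one where the tableaux differ.
    have h1 := ((hch c hc).exists_ne_iff hab c).2 rfl
    rw [h] at h1
    exact ((hch d hd).exists_ne_iff hab c).1 h1
  · intro T' hT'
    obtain ⟨c, hc⟩ := (Finset.mem_filter.1 hT').2.exists_isChangeAt hab
    exact ⟨c, Finset.mem_filter.2 ⟨Finset.mem_univ _, hc.1⟩,
      Subtype.ext (funext fun r => funext fun c' => (hc.2 r c').symm)⟩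
  · intro c hc
    exact hfg _ _ (hch c hc)

/-- A strictly increasing column contains each letter at most once, so counting entries is counting
columns. -/
theorem card_entries_eq_sum (T : Col N l m) (j : Fin m) (R : Fin N → Prop) [DecidablePred R] :
    ((Finset.univ.filter fun p : Fin l × Fin N => T.1 p.1 p.2 = j ∧ R p.2).card : ℤ) =
      ∑ c with R c, if j ∈ column T c then 1 else 0 := by
  have h : (Finset.univ.filter fun c => R c).filter (fun c => j ∈ column T c) =
      (Finset.univ.filter fun p : Fin l × Fin N => T.1 p.1 p.2 = j ∧ R p.2).image Prod.snd := by
    ext c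
    simp [mem_column, and_comm]
  rw [← Finset.sum_filter, Finset.sum_const, nsmul_one, h, Finset.card_image_of_injOn]
  rintro ⟨r, c⟩ hp ⟨r', c'⟩ hp' (hc : c = c')
  subst hc
  simp only [Finset.coe_filter, Finset.mem_univ, true_and, Set.mem_ofPred_eq] at hp hp'
  rw [entry_injective T c (hp.1.trans hp'.1.symm)]

theorem IsChangeAt.cntRight_eq (h : IsChangeAt a b c T T') (hab : a ≠ b) (j : Fin m) :
    (cntRight T T' j : ℤ) = ∑ c' with c < c', if j ∈ column T c' then 1 else 0 := by
  rw [← card_entries_eq_sum, cntRight]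
  congr 2
  ext p
  have : (∃ r c', T.1 r c' ≠ T'.1 r c' ∧ c' < p.2) ↔ c < p.2 := by
    constructor
    · rintro ⟨r, c', h1, h2⟩
      rwa [← (h.exists_ne_iff hab c').1 ⟨r, h1⟩]
    · intro h2
      obtain ⟨r, hr⟩ := (h.exists_ne_iff hab c).2 rfl
      exact ⟨r, c, hr, h2⟩
  simp only [Finset.mem_filter, this]

theorem IsChangeAt.cntLeft_eq (h : IsChangeAt a b c T T') (hab : a ≠ b) (j : Fin m) :
    (cntLeft T T' j : ℤ) = ∑ c' with c' < c, if j ∈ column T c' then 1 else 0 := by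
  rw [← card_entries_eq_sum T j (· < c), cntLeft]
  congr 2
  ext p
  have : (∃ r c', T.1 r c' ≠ T'.1 r c' ∧ p.2 < c') ↔ p.2 < c := by
    constructor
    · rintro ⟨r, c', h1, h2⟩
      rwa [← (h.exists_ne_iff hab c').1 ⟨r, h1⟩]
    · intro h2
      obtain ⟨r, hr⟩ := (h.exists_ne_iff hab c).2 rfl
      exact ⟨r, c, hr, h2⟩
  simp only [Finset.mem_filter, this]

/-- The combinatorial exponent is the weight of the columns of larger index, the exponent in
`tensF_tensXS` up to sign. -/
theorem IsChangeAt.aExp_eq (h : IsChangeAt a b c T T') (hab : a ≠ b) (i : Fin (m - 1)) :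
    aExp i T T' = ∑ c' with c < c', setWt i (column T c') := by
  rw [aExp, h.cntRight_eq hab, h.cntRight_eq hab, ← Finset.sum_sub_distrib]
  rfl

theorem IsChangeAt.bExp_eq (h : IsChangeAt a b c T T') (hab : a ≠ b) (i : Fin (m - 1)) :
    bExp i T T' = ∑ c' with c' < c, setWt i (column T c') := by
  rw [bExp, h.cntLeft_eq hab, h.cntLeft_eq hab, ← Finset.sum_sub_distrib]
  rfl

theorem lt_lo_iff_lt_hi (i : Fin (m - 1)) {x : Fin m} (h : x ≠ lo i) :
    x < lo i ↔ x < hi i :=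
  ⟨fun h' => h'.trans (lo_lt_hi i), fun h' => lt_lo_of_lt_hi h' h⟩

theorem tensF_column (i : Fin (m - 1)) (T : Col N l m) :
    tensF i (tensXS v (column T)) = ∑ T' with Changes (lo i) (hi i) T T',
      v ^ (-aExp i T T') • tensXS v (column T') := by
  rw [tensF_tensXS]
  refine sum_changes (lo_ne_hi i) (fun x hx _ => lt_lo_iff_lt_hi i hx) _ _ fun c T' h => ?_
  rw [h.aExp_eq (lo_ne_hi i), h.column_eq]

theorem tensE_column (i : Fin (m - 1)) (T : Col N l m) :
    tensE i (tensXS v (column T)) = ∑ T' with Changes (hi i) (lo i) T T',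
      v ^ bExp i T T' • tensXS v (column T') := by
  rw [tensE_tensXS]
  refine sum_changes (lo_ne_hi i).symm (fun x _ hx => (lt_lo_iff_lt_hi i hx).symm) _ _
    fun c T' h => ?_
  rw [h.bExp_eq (lo_ne_hi i).symm, h.column_eq]

theorem transp_column (T : Col N l m) : transp (column T) = colsWith T := by
  funext j
  ext c
  simp [mem_transp, mem_column, colsWith]

theorem tensWt_column (T : Col N l m) : tensWt (column T) = wt T := by
  funext i
  rw [tensWt_eq_card, transp_column, colsWith_card, colsWith_card, wt]

theorem coe_xUp (T : Col N l (N * l)) :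
    (xUp T : TPow Kv N qN (N * l)) = transpEquiv N (N * l) (tensXS v (column T)) := by
  rw [transpEquiv_tensXS, transp_column]
  rfl

theorem wtProj_column (lam : Wt m) (T : Col N l m) :
    wtProj lam (tensXS v (column T)) = if lam = wt T then tensXS v (column T) else 0 := by
  rw [wtProj_tensXS, tensWt_column]
  simp only [eq_comm]

theorem coe_howeAction_transpEquiv (x : Udot Kv m v) {u : TPow Kv m v N} {w : HoweSpace N m}
    (h : (w : TPow Kv N qN m) = transpEquiv N m u) :
    (howeAction N m x w : TPow Kv N qN m) = transpEquiv N m (stdHom N m x u) := by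
  rw [howeAction, subRep_apply, h, howeHom_transpEquiv]

/-- The formulas which describe the action `σ` of the idempotented algebra on the vectors `x T`
indexed by tableaux. -/
def TableauFormulas {V : Type} [AddCommGroup V] [Module Kv V]
    (σ : Udot Kv m v →ₙₐ[Kv] Module.End Kv V) (x : Col N l m → V) (T : Col N l m) : Prop :=
  (∀ i : Fin (m - 1), σ (uF v i (wt T)) (x T) =
    ∑ T' with Changes (lo i) (hi i) T T', v ^ (-aExp i T T') • x T') ∧
  (∀ i : Fin (m - 1), σ (uE v i (wt T)) (x T) =
    ∑ T' with Changes (hi i) (lo i) T T', v ^ (bExp i T T') • x T') ∧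
  σ (uOne v (wt T)) (x T) = x T ∧
  (∀ lam, lam ≠ wt T → σ (uOne v lam) (x T) = 0 ∧
    ∀ i : Fin (m - 1), σ (uE v i lam) (x T) = 0 ∧ σ (uF v i lam) (x T) = 0)

/-- A representation which is embedded into the tensor power compatibly with the standard
representation satisfies the formulas. -/
theorem tableauFormulas_of_embedding {V W : Type} [AddCommGroup V] [Module Kv V] [AddCommGroup W]
    [Module Kv W] {σ : Udot Kv m v →ₙₐ[Kv] Module.End Kv V} {x : Col N l m → V}
    (ι : V →ₗ[Kv] W) (hι : Function.Injective ι) (θ : TPow Kv m v N →ₗ[Kv] W)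
    (hx : ∀ T, ι (x T) = θ (tensXS v (column T)))
    (hσ : ∀ X T, ι (σ X (x T)) = θ (stdHom N m X (tensXS v (column T)))) (T : Col N l m) :
    TableauFormulas σ x T := by
  refine ⟨fun i => hι ?_, fun i => hι ?_, hι ?_, fun lam hlam => ⟨hι ?_, fun i => ⟨hι ?_, hι ?_⟩⟩⟩
  · rw [hσ, stdHom_uF, Module.End.mul_apply, wtProj_column, if_pos rfl, tensF_column, map_sum,
      map_sum]
    simp only [map_smul, hx]
  · rw [hσ, stdHom_uE, Module.End.mul_apply, wtProj_column, if_pos rfl, tensE_column, map_sum,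
      map_sum]
    simp only [map_smul, hx]
  · rw [hσ, stdHom_uOne, wtProj_column, if_pos rfl, hx]
  · rw [hσ, stdHom_uOne, wtProj_column, if_neg hlam, map_zero, map_zero]
  · rw [hσ, stdHom_uE, Module.End.mul_apply, wtProj_column, if_neg hlam, map_zero, map_zero,
      map_zero]
  · rw [hσ, stdHom_uF, Module.End.mul_apply, wtProj_column, if_neg hlam, map_zero, map_zero,
      map_zero]

theorem tableauFormulas_stdAction (T : Col N l m) :
    TableauFormulas (stdAction N l m) xDown T :=
  tableauFormulas_of_embedding (StdSpace N l m).subtype Subtype.val_injective LinearMap.id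
    (fun _ => rfl) (fun _ _ => rfl) T

theorem tableauFormulas_howeAction (T : Col N l (N * l)) :
    TableauFormulas (howeAction N (N * l)) xUp T :=
  tableauFormulas_of_embedding (σ := howeAction N (N * l)) (x := xUp) (HoweSpace N (N * l)).subtype
    Subtype.val_injective (transpEquiv N (N * l)).toLinearMap coe_xUp
    (fun X T => coe_howeAction_transpEquiv X (coe_xUp T)) T

/-- The equality `m = Nℓ` enters here: `N` columns of size `ℓ` have total degree `m`. -/
theorem transpEquiv_mem_howeSpace (N l : ℕ) :
    ∀ w ∈ StdSpace N l (N * l), transpEquiv N (N * l) w ∈ HoweSpace N (N * l) := by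
  intro w hw
  rw [howeSpace_eq_map]
  refine Submodule.mem_map_of_mem ?_
  rw [stdSpace_eq_degSpan] at hw
  refine Submodule.span_mono ?_ hw
  rintro _ ⟨P, hP, rfl⟩
  refine ⟨P, ?_, rfl⟩
  exact (Finset.sum_congr rfl fun c _ => hP c).trans (by simp)

/-- The embedding `x_T ↦ x^T`. -/
def howeEmbedding (N l : ℕ) : StdSpace N l (N * l) →ₗ[Kv] HoweSpace N (N * l) :=
  (transpEquiv N (N * l)).toLinearMap.restrict (transpEquiv_mem_howeSpace N l)

theorem coe_howeEmbedding (w : StdSpace N l (N * l)) :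
    (howeEmbedding N l w : TPow Kv N qN (N * l)) = transpEquiv N (N * l) w := rfl

theorem howeEmbedding_injective (N l : ℕ) : Function.Injective (howeEmbedding N l) := by
  intro w w' h
  have h1 := congrArg Subtype.val h
  rw [coe_howeEmbedding, coe_howeEmbedding] at h1
  exact Subtype.ext ((transpEquiv N (N * l)).injective h1)

theorem howeEmbedding_equivariant (X : Udot Kv (N * l) v) (w : StdSpace N l (N * l)) :
    howeEmbedding N l (stdAction N l (N * l) X w) = howeAction N (N * l) X (howeEmbedding N l w) :=
  Subtype.ext (coe_howeAction_transpEquiv X (coe_howeEmbedding w)).symm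

end Tableaux

end QHowe

end

/-! ### The proposition -/

theorem proposition4p4 (N l : ℕ) (hN : 2 ≤ N) :
    -- the action through the ladder functor and the standard action exist and are unique
    (∃! ρ, QHowe.IsHoweAction N (N * l) ρ) ∧
    (∃! σ, QHowe.IsStdAction N l (N * l) σ) ∧
    -- the action on the basis tensors `x^T`
    (∀ ρ, QHowe.IsHoweAction N (N * l) ρ → ∀ (T : QHowe.Col N l (N * l)),
      (∀ i : Fin (N * l - 1),
        ρ (QHowe.uF QHowe.v i (QHowe.wt T)) (QHowe.xUp T) =
          ∑ T' with QHowe.Changes (QHowe.lo i) (QHowe.hi i) T T',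
            QHowe.v ^ (-QHowe.aExp i T T') • QHowe.xUp T') ∧
      (∀ i : Fin (N * l - 1),
        ρ (QHowe.uE QHowe.v i (QHowe.wt T)) (QHowe.xUp T) =
          ∑ T' with QHowe.Changes (QHowe.hi i) (QHowe.lo i) T T',
            QHowe.v ^ (QHowe.bExp i T T') • QHowe.xUp T') ∧
      ρ (QHowe.uOne QHowe.v (QHowe.wt T)) (QHowe.xUp T) = QHowe.xUp T ∧
      (∀ lam, lam ≠ QHowe.wt T → ρ (QHowe.uOne QHowe.v lam) (QHowe.xUp T) = 0 ∧
        ∀ i : Fin (N * l - 1), ρ (QHowe.uE QHowe.v i lam) (QHowe.xUp T) = 0 ∧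
          ρ (QHowe.uF QHowe.v i lam) (QHowe.xUp T) = 0)) ∧
    -- the standard action on the basis tensors `x_T` is given by the same formulas
    (∀ σ, QHowe.IsStdAction N l (N * l) σ → ∀ (T : QHowe.Col N l (N * l)),
      (∀ i : Fin (N * l - 1),
        σ (QHowe.uF QHowe.v i (QHowe.wt T)) (QHowe.xDown T) =
          ∑ T' with QHowe.Changes (QHowe.lo i) (QHowe.hi i) T T',
            QHowe.v ^ (-QHowe.aExp i T T') • QHowe.xDown T') ∧
      (∀ i : Fin (N * l - 1),
        σ (QHowe.uE QHowe.v i (QHowe.wt T)) (QHowe.xDown T) =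
          ∑ T' with QHowe.Changes (QHowe.hi i) (QHowe.lo i) T T',
            QHowe.v ^ (QHowe.bExp i T T') • QHowe.xDown T') ∧
      σ (QHowe.uOne QHowe.v (QHowe.wt T)) (QHowe.xDown T) = QHowe.xDown T ∧
      (∀ lam, lam ≠ QHowe.wt T → σ (QHowe.uOne QHowe.v lam) (QHowe.xDown T) = 0 ∧
        ∀ i : Fin (N * l - 1), σ (QHowe.uE QHowe.v i lam) (QHowe.xDown T) = 0 ∧
          σ (QHowe.uF QHowe.v i lam) (QHowe.xDown T) = 0)) ∧
    -- hence `x_T ↦ x^T` is an embedding of representations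
    (∀ ρ σ, QHowe.IsHoweAction N (N * l) ρ → QHowe.IsStdAction N l (N * l) σ →
      ∃ Φ : QHowe.StdSpace N l (N * l) →ₗ[QHowe.Kv] QHowe.HoweSpace N (N * l),
        Function.Injective Φ ∧ (∀ T, Φ (QHowe.xDown T) = QHowe.xUp T) ∧
        ∀ X w, Φ (σ X w) = ρ X (Φ w)) := by
  refine ⟨⟨_, QHowe.isHoweAction_howeAction N (N * l), fun ρ hρ => hρ.eq⟩,
    ⟨_, QHowe.isStdAction_stdAction N l (N * l), fun σ hσ => hσ.eq⟩, fun ρ hρ T => ?_,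
    fun σ hσ T => ?_, fun ρ σ hρ hσ => ⟨QHowe.howeEmbedding N l,
      QHowe.howeEmbedding_injective N l, fun T => Subtype.ext (QHowe.coe_xUp T).symm,
      fun X w => ?_⟩⟩
  · rw [hρ.eq]
    exact QHowe.tableauFormulas_howeAction T
  · rw [hσ.eq]
    exact QHowe.tableauFormulas_stdAction T
  · rw [hρ.eq, hσ.eq]
    exact QHowe.howeEmbedding_equivariant X w
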